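/- An instance of Min Stable Cut is a finite simple graph $G=(V,E)$ with edge weights $w:E\to\mathbb{N}$. The weighted degree of $v\in V$ is $d_w(v)=\sum_{uv\in E}w(uv)$. A cut is a partition of $V$ into two (possibly empty) sides $V_0,V_1$; its weight is the sum of $w(uv)$ over the edges $uv$ with one endpoint on each side. A cut is stable if for every $v\in V$ the total weight of the edges incident on $v$ that cross the cut is at least $d_w(v)/2$. Theorem. There are a deterministic algorithm and a constant $c$ such that the following holds. Given a graph $G=(V,E)$ with $n$ vertices and edge weights $w:E\to\mathbb{N}$ of maximum $W$ (written in binary), a tree decomposition of $G$ with $N$ nodes and width $\mathrm{tw}$, and a rational error $\varepsilon>0$ (given by numerator and denominator in binary, with $L$ bits in total), the algorithm returns, in time at most $$c\cdot\max\left(1,\frac{\mathrm{tw}}{\varepsilon}\right)^{c\cdot\mathrm{tw}}\cdot\left(n+N+\log W+L\right)^{c},$$ a cut such that (i) for every $v\in V$, the total weight of the edges incident on $v$ that cross the cut is at least $(1-\varepsilon)\frac{d_w(v)}{2}$; (ii) the weight of the cut is at most the weight of every stable cut, that is, at most the minimum weight of a stable cut. (For a tree decomposition with polynomially many nodes, and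 an error written with polynomially many bits, the time is $(\mathrm{tw}/\varepsilon)^{O(\mathrm{tw})}(n+\log W)^{O(1)}$. Here $\log W$ is rounded down and read as $0$ for $W=0$; the width, i.e. the maximum bag size minus one, is read as $0$ for the graph without vertices. Time is the number of steps of a machine that works on pointer structures with binary numbers, in which a pointer operation costs one step and an arithmetic operation costs the bit length of its operands; up to a polynomial this is the running time of a Turing machine.) -/

import Mathlib

/-! ### Edge-weighted graphs and cuts

A graph with vertex set `V` carries weights `w : Sym2 V → ℕ`; only the values of `w` on edges are
ever used. A cut, that is, a partition of `V` into two (possibly empty) sides `V₀`, `V₁`, is a map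
`side : V → Bool`. -/

namespace MinStableCut

section Graph

variable {V : Type} [Fintype V]

open Classical in
/-- The weighted degree `d_w(v)`: the total weight of the edges incident on `v`. -/
noncomputable def weightedDegree (G : SimpleGraph V) (w : Sym2 V → ℕ) (v : V) : ℕ :=
  ∑ u : V, if G.Adj v u then w s(v, u) else 0

open Classical in
/-- The total weight of the edges incident on `v` that cross the cut. -/
noncomputable def crossWeight (G : SimpleGraph V) (w : Sym2 V → ℕ) (side : V → Bool) (v : V) : ℕ :=
  ∑ u : V, if G.Adj v u ∧ side u ≠ side v then w s(v, u) else 0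

open Classical in
/-- The weight of a cut: the sum of `w(uv)` over the edges `uv` with `u ∈ V₀` and `v ∈ V₁`. -/
noncomputable def cutWeight (G : SimpleGraph V) (w : Sym2 V → ℕ) (side : V → Bool) : ℕ :=
  ∑ u : V, ∑ v : V, if G.Adj u v ∧ side u = false ∧ side v = true then w s(u, v) else 0

/-- A cut is stable if, for every vertex, at least half of its weighted degree crosses the cut. -/
def IsStable (G : SimpleGraph V) (w : Sym2 V → ℕ) (side : V → Bool) : Prop :=
  ∀ v : V, (weightedDegree G w v : ℚ) / 2 ≤ (crossWeight G w side v : ℚ)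

open Classical in
/-- The maximum weight `W` of an edge (`0` if there are no edges). -/
noncomputable def maxWeight (G : SimpleGraph V) (w : Sym2 V → ℕ) : ℕ :=
  (Finset.univ.filter (fun e : Sym2 V => e ∈ G.edgeSet)).sup w

/-- A tree decomposition of `G` whose tree has the node set `Fin N`. -/
structure TreeDecomposition (G : SimpleGraph V) (N : ℕ) where
  tree : SimpleGraph (Fin N)
  isTree : tree.IsTree
  bag : Fin N → Finset V
  exists_mem_bag : ∀ v : V, ∃ i, v ∈ bag i
  exists_edge_bag : ∀ u v : V, G.Adj u v → ∃ i, u ∈ bag i ∧ v ∈ bag i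
  connected : ∀ v : V, (tree.induce {i | v ∈ bag i}).Connected

/-- The width: the maximum size of a bag, minus one (and `0` if all bags are empty, which happens
only for the graph without vertices). -/
def TreeDecomposition.width {G : SimpleGraph V} {N : ℕ} (D : TreeDecomposition G N) : ℕ :=
  (Finset.univ.sup fun i => (D.bag i).card) - 1

end Graph

/-! ### The machine model

A deterministic machine working on immutable binary trees whose leaves are natural numbers written
in binary: the one-variable WHILE language over trees, with arithmetic at logarithmic cost.
Trees are accessed through pointers, so that forming a pair, taking a component or copying a
reference is one step; an arithmetic operation costs the total bit length of its operands, as on the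
logarithmic-cost RAM. Running times agree with those of multitape Turing machines up to a
polynomial. -/

/-- The data of the machine. -/
inductive Val : Type
  | num : ℕ → Val
  | pair : Val → Val → Val

/-- The programs of the machine. Each program maps the current datum to a new one. -/
inductive Prog : Type
  /-- leave the datum as it is -/
  | id : Prog
  /-- a fixed number -/
  | const : ℕ → Prog
  /-- first component of a pair -/
  | fst : Prog
  /-- second component of a pair -/
  | snd : Prog
  /-- `1` on a pair, `0` on a number -/
  | isPair : Prog
  /-- sum of a pair of numbers -/
  | add : Prog
  /-- truncated difference of a pair of numbers -/
  | sub : Prog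
  /-- product of a pair of numbers -/
  | mul : Prog
  /-- rounded-down quotient of a pair of numbers -/
  | div : Prog
  /-- run both programs on the datum and pair the results -/
  | pair : Prog → Prog → Prog
  /-- `seq p q` runs `p` and then `q` -/
  | seq : Prog → Prog → Prog
  /-- `cond b p q` runs `p` on the datum if `b` yields a nonzero number on it, and `q` if `b` yields
  zero -/
  | cond : Prog → Prog → Prog → Prog
  /-- `loop b p` runs `p` as long as `b` yields a nonzero number on the datum -/
  | loop : Prog → Prog → Prog

/-- `Run p x y t`: on the datum `x`, the program `p` halts with result `y` after exactly `t` steps.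
There is no such `y` and `t` if `p` runs forever or meets an operation that is not defined on its
argument. -/
inductive Run : Prog → Val → Val → ℕ → Prop
  | id (x : Val) : Run Prog.id x x 1
  | const (k : ℕ) (x : Val) : Run (Prog.const k) x (Val.num k) 1
  | fst (x y : Val) : Run Prog.fst (Val.pair x y) x 1
  | snd (x y : Val) : Run Prog.snd (Val.pair x y) y 1
  | isPair_num (k : ℕ) : Run Prog.isPair (Val.num k) (Val.num 0) 1
  | isPair_pair (x y : Val) : Run Prog.isPair (Val.pair x y) (Val.num 1) 1
  | add (a b : ℕ) :
      Run Prog.add (Val.pair (Val.num a) (Val.num b)) (Val.num (a + b)) (a.size + b.size + 1)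
  | sub (a b : ℕ) :
      Run Prog.sub (Val.pair (Val.num a) (Val.num b)) (Val.num (a - b)) (a.size + b.size + 1)
  | mul (a b : ℕ) :
      Run Prog.mul (Val.pair (Val.num a) (Val.num b)) (Val.num (a * b)) (a.size + b.size + 1)
  | div (a b : ℕ) :
      Run Prog.div (Val.pair (Val.num a) (Val.num b)) (Val.num (a / b)) (a.size + b.size + 1)
  | pair {p q : Prog} {x y z : Val} {s t : ℕ} :
      Run p x y s → Run q x z t → Run (Prog.pair p q) x (Val.pair y z) (s + t + 1)
  | seq {p q : Prog} {x y z : Val} {s t : ℕ} :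
      Run p x y s → Run q y z t → Run (Prog.seq p q) x z (s + t + 1)
  | cond_true {b p q : Prog} {x y : Val} {k s t : ℕ} :
      Run b x (Val.num (k + 1)) s → Run p x y t → Run (Prog.cond b p q) x y (s + t + 1)
  | cond_false {b p q : Prog} {x y : Val} {s t : ℕ} :
      Run b x (Val.num 0) s → Run q x y t → Run (Prog.cond b p q) x y (s + t + 1)
  | loop_stop {b p : Prog} {x : Val} {s : ℕ} :
      Run b x (Val.num 0) s → Run (Prog.loop b p) x x (s + 1)
  | loop_step {b p : Prog} {x y z : Val} {k s t r : ℕ} :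
      Run b x (Val.num (k + 1)) s → Run p x y t → Run (Prog.loop b p) y z r →
      Run (Prog.loop b p) x z (s + t + r + 1)

/-! ### Input and output of the algorithm -/

/-- Lists are nested pairs that end in the number `0`. -/
def Val.ofList : List Val → Val
  | [] => Val.num 0
  | x :: l => Val.pair x (Val.ofList l)

open Classical in
/-- Adjacency lists with weights: for each vertex `v` the list of all `(u, w(vu))` with `vu` an
edge. -/
noncomputable def encodeGraph {n : ℕ} (G : SimpleGraph (Fin n)) (w : Sym2 (Fin n) → ℕ) : Val :=
  Val.ofList ((List.finRange n).map fun v =>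
    Val.ofList (((List.finRange n).filter fun u : Fin n => G.Adj v u).map fun u : Fin n =>
      Val.pair (Val.num (u : ℕ)) (Val.num (w s(v, u)))))

open Classical in
/-- For each node of the tree, the list of its neighbours and the list of the vertices in its
bag. -/
noncomputable def encodeDecomposition {n N : ℕ} {G : SimpleGraph (Fin n)}
    (D : TreeDecomposition G N) : Val :=
  Val.ofList ((List.finRange N).map fun i => Val.pair
    (Val.ofList (((List.finRange N).filter fun j : Fin N => D.tree.Adj i j).map fun j : Fin N => Val.num j))
    (Val.ofList (((List.finRange n).filter fun v : Fin n => v ∈ D.bag i).map fun v : Fin n => Val.num v)))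

/-- The input: the numbers of vertices and of nodes, the weighted graph, the tree decomposition, and
the numerator and denominator of the (positive) error `ε`. -/
noncomputable def encodeInput {n N : ℕ} (G : SimpleGraph (Fin n)) (w : Sym2 (Fin n) → ℕ)
    (D : TreeDecomposition G N) (ε : ℚ) : Val :=
  Val.ofList [Val.num n, Val.num N, encodeGraph G w, encodeDecomposition D,
    Val.num ε.num.toNat, Val.num ε.den]

/-- The output: for each vertex, in order, the number `0` or `1` of its side. -/
def encodeCut {n : ℕ} (side : Fin n → Bool) : Val :=
  Val.ofList ((List.finRange n).map fun v => Val.num (side v).toNat)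

/-- The number of bits of a positive rational, written as a numerator and a denominator. -/
def bitLength (ε : ℚ) : ℕ := ε.num.toNat.size + ε.den.size

end MinStableCut

/-! The algorithm is a dynamic program over sets S of nodes of the tree. An entry holds a cut of the
vertices in the bags of S and, for each vertex, a lower bound on the fraction of its weighted degree
inside S that crosses the cut. Each edge is charged to one node whose bag contains it, so degree,
crossing weight and cost are additive over disjoint sets of nodes (`Data.ow_add`). The part outside
S interacts with S only through the boundary vertices, those with bags both in S and outside; so
among entries that agree on S and its boundary only a cheapest one is kept.

Exact crossing weights would make the table as large as the weights. Instead fractions are rounded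
down to multiples of 1/q. When two sets are joined, the new fraction is the average of the old ones
weighted by degree: errors are averaged, not added, and rounding adds at most 1/q. The total error
is therefore governed by the depth of the joins and not by their number. A vertex is tested when all
its bags are in S, with a slack of R + 1 units of 1/q, where R is the number of rounds. Since
rounding goes down, every entry that passes is nearly stable (`Data.EntryOk`); since the slack
covers the error, for every stable cut an entry of no larger cost survives (`Data.Der.tracks`). The
set of all nodes has empty boundary, so it has a single entry, which is no worse than all stable
cuts at once (`Data.output_spec`); it exists because a maximum cut is stable (`exists_isStable`).

It remains to build the set of all nodes by joins of depth O(log² N) through sets with small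
boundary. In the first-child/next-sibling form of the rooted tree every binary subtree is an
interval of the preorder with only one outside neighbour. The difference of two nested subtrees thus
has its boundary in two bags (`Data.admissible_between`). Following a path into the larger subtrees
leaves behind subtrees of less than half the size. These are built recursively and then joined along
the path by repeated halving: log N levels with log N rounds each (`Data.der_between`,
`Data.der_block`).

There are at most (N+1)⁴ sets S and, for bags of size at most b, at most (2(q+1))^(2b) boundary
values (`Data.card_le_keyBound`), with q = O(log² N / ε). The factor (log N)^O(tw) is at most
tw^O(tw) times a polynomial in N (`pow_le_pow_self_mul_four_pow`). Instances without edges or with ε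
≥ 1 are answered separately, as the permitted time need not pay for a table there. Running times
come from a calculus of functions computable in time and output size polynomial in a measure (`PT`),
the number of keys being part of the measure. -/

namespace MinStableCut

/-! ### Polynomially bounded quantities -/

/-- `X` is bounded by a polynomial in `m`. -/
def PolyBdd {α : Type} (m X : α → ℕ) : Prop := ∃ c, ∀ a, X a ≤ (m a + 2) ^ c

namespace PolyBdd

variable {α β : Type} {m X Y : α → ℕ}

theorem mono (hY : PolyBdd m Y) (h : ∀ a, X a ≤ Y a) : PolyBdd m X :=
  hY.imp fun _ hc a => (h a).trans (hc a)

theorem self (m : α → ℕ) : PolyBdd m m := ⟨1, fun a => by simp⟩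

theorem const (m : α → ℕ) (k : ℕ) : PolyBdd m (fun _ => k) :=
  ⟨k, fun a => (Nat.lt_two_pow_self).le.trans (Nat.pow_le_pow_left (by omega) k)⟩

theorem add (hX : PolyBdd m X) (hY : PolyBdd m Y) : PolyBdd m (fun a => X a + Y a) := by
  obtain ⟨c, hc⟩ := hX
  obtain ⟨d, hd⟩ := hY
  refine ⟨c + d + 1, fun a => ?_⟩
  have h1 : (m a + 2) ^ c ≤ (m a + 2) ^ (c + d) := Nat.pow_le_pow_right (by omega) (by omega)
  have h2 : (m a + 2) ^ d ≤ (m a + 2) ^ (c + d) := Nat.pow_le_pow_right (by omega) (by omega)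
  calc X a + Y a ≤ (m a + 2) ^ (c + d) * 2 := by linarith [hc a, hd a]
    _ ≤ (m a + 2) ^ (c + d) * (m a + 2) := Nat.mul_le_mul_left _ (by omega)
    _ = _ := (pow_succ _ _).symm

theorem mul (hX : PolyBdd m X) (hY : PolyBdd m Y) : PolyBdd m (fun a => X a * Y a) := by
  obtain ⟨c, hc⟩ := hX
  obtain ⟨d, hd⟩ := hY
  exact ⟨c + d, fun a => (Nat.mul_le_mul (hc a) (hd a)).trans_eq (pow_add _ _ _).symm⟩

theorem pow (hX : PolyBdd m X) (k : ℕ) : PolyBdd m (fun a => X a ^ k) := by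
  obtain ⟨c, hc⟩ := hX
  exact ⟨c * k, fun a => (Nat.pow_le_pow_left (hc a) k).trans_eq (pow_mul _ _ _).symm⟩

theorem comp {m' Z : β → ℕ} {f : α → β} (hZ : PolyBdd m' Z)
    (hm : PolyBdd m (fun a => m' (f a))) : PolyBdd m (fun a => Z (f a)) := by
  obtain ⟨c, hc⟩ := hZ
  exact ((hm.add (const m 2)).pow c).mono fun a => hc (f a)

/-- A bound by a sum over the measure of the argument. -/
theorem le_self (h : ∀ a, X a ≤ m a) : PolyBdd m X := (self m).mono h

end PolyBdd

/-! ### Encodings -/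

/-- The number of nodes of a tree plus the number of bits of its leaves. -/
def Val.size : Val → ℕ
  | num k => k.size + 1
  | pair x y => x.size + y.size + 1

/-- Types whose elements are written as data of the machine. -/
class Enc (α : Type) where
  enc : α → Val

/-- The size of the encoding. -/
def sz {α : Type} [Enc α] (a : α) : ℕ := (Enc.enc a).size

section Instances

variable {α β : Type} [Enc α] [Enc β]

instance : Enc ℕ := ⟨Val.num⟩
instance : Enc Bool := ⟨fun b => Val.num b.toNat⟩
instance : Enc (α × β) := ⟨fun p => Val.pair (Enc.enc p.1) (Enc.enc p.2)⟩
instance : Enc (List α) := ⟨fun l => Val.ofList (l.map Enc.enc)⟩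
instance (P : α → Prop) : Enc {a // P a} := ⟨fun a => Enc.enc a.1⟩

theorem enc_nat (k : ℕ) : Enc.enc k = Val.num k := rfl
theorem enc_bool (b : Bool) : Enc.enc b = Val.num b.toNat := rfl
theorem enc_cons (a : α) (l : List α) : Enc.enc (a :: l) = Val.pair (Enc.enc a) (Enc.enc l) := rfl

theorem sz_nat (k : ℕ) : sz k = k.size + 1 := rfl
theorem sz_pair (a : α) (b : β) : sz (a, b) = sz a + sz b + 1 := rfl
theorem sz_nil : sz ([] : List α) = 1 := rfl
theorem sz_cons (a : α) (l : List α) : sz (a :: l) = sz a + sz l + 1 := rfl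

theorem sz_pos (a : α) : 1 ≤ sz a := by
  unfold sz; cases Enc.enc a <;> simp [Val.size]

theorem sz_append (l l' : List α) : sz (l ++ l') + 1 = sz l + sz l' := by
  induction l with
  | nil => simp [sz_nil]; omega
  | cons a l ih => simp only [List.cons_append, sz_cons]; omega

theorem sz_reverse (l : List α) : sz l.reverse = sz l := by
  induction l with
  | nil => rfl
  | cons a l ih =>
    have := sz_append l.reverse [a]
    simp only [List.reverse_cons, sz_cons, sz_nil] at this ⊢
    omega

theorem length_lt_sz (l : List α) : l.length < sz l := by
  induction l with
  | nil => simp [sz_nil]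
  | cons a l ih => simp only [List.length_cons, sz_cons]; omega

theorem sz_lt_of_mem {l : List α} {a : α} (h : a ∈ l) : sz a < sz l := by
  induction l with
  | nil => cases h
  | cons b l ih =>
    rw [sz_cons]
    rcases List.mem_cons.1 h with rfl | h
    · omega
    · have := ih h; omega

theorem sz_take_le (l : List α) (j : ℕ) : sz (l.take j) ≤ sz l := by
  have := sz_append (l.take j) (l.drop j)
  have := sz_pos (l.drop j)
  rw [List.take_append_drop] at *
  omega

theorem sz_list_le {l : List α} {B : ℕ} (h : ∀ a ∈ l, sz a ≤ B) :
    sz l ≤ l.length * (B + 1) + 1 := by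
  induction l with
  | nil => simp [sz_nil]
  | cons a l ih =>
    have h1 := h a (by simp)
    have h2 := ih fun b hb => h b (by simp [hb])
    rw [sz_cons, List.length_cons, add_mul]
    omega

end Instances

theorem natSize_le_self (k : ℕ) : k.size ≤ k := Nat.size_le.2 Nat.lt_two_pow_self

theorem natSize_add_le (a b : ℕ) : (a + b).size ≤ a.size + b.size := by
  rcases Nat.eq_zero_or_pos a with rfl | ha
  · simp
  rcases Nat.eq_zero_or_pos b with rfl | hb
  · simp
  rw [Nat.size_le]
  have h1 := Nat.lt_size_self a
  have h2 := Nat.lt_size_self b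
  have h3 := Nat.size_pos.2 ha
  have h4 := Nat.size_pos.2 hb
  have e1 : 2 ^ a.size ≥ 2 := Nat.le_self_pow (by omega) 2
  have e2 : 2 ^ b.size ≥ 2 := Nat.le_self_pow (by omega) 2
  rw [pow_add]
  nlinarith

theorem natSize_mul_le (a b : ℕ) : (a * b).size ≤ a.size + b.size := by
  rw [Nat.size_le, pow_add]
  exact Nat.mul_lt_mul'' (Nat.lt_size_self a) (Nat.lt_size_self b)

theorem sz_nat_mono {a b : ℕ} (h : a ≤ b) : sz a ≤ sz b := by
  simpa [sz_nat] using Nat.size_le_size h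

theorem sz_nat_le (a : ℕ) : sz a ≤ a + 1 := by
  simpa [sz_nat] using natSize_le_self a

/-! ### Functions computable in polynomial time -/

/-- The function `f` is computed by a program whose running time and output size are bounded by a
polynomial in `m`. -/
def PT {α β : Type} [Enc α] [Enc β] (m : α → ℕ) (f : α → β) : Prop :=
  ∃ (p : Prog) (T : α → ℕ), PolyBdd m T ∧ PolyBdd m (fun a => sz (f a)) ∧
    ∀ a, ∃ t ≤ T a, Run p (Enc.enc a) (Enc.enc (f a)) t

/-- The measure of an environment extended by a further value. -/
def ext {α β : Type} [Enc β] (m : α → ℕ) : α × β → ℕ := fun p => m p.1 + sz p.2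

/-- Carries the standing assumption on the environment into the body of a loop, where one more
variable is in scope. -/
theorem PolyBdd.ext {α β : Type} [Enc α] [Enc β] {m : α → ℕ} (hm : PolyBdd m (fun a => sz a)) :
    PolyBdd (MinStableCut.ext (β := β) m) (fun p => sz p) := by
  obtain ⟨c, hc⟩ := hm
  refine ((((PolyBdd.self _).add (.const _ 2)).pow c).add
    ((PolyBdd.self _).add (.const _ 1))).mono fun p => ?_
  have h1 : sz p.1 ≤ _ := hc p.1
  have h2 := Nat.pow_le_pow_left (show m p.1 + 2 ≤ MinStableCut.ext m p + 2 by
    simp only [MinStableCut.ext]; omega) c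
  have h3 : sz p = sz p.1 + sz p.2 + 1 := rfl
  have h4 : MinStableCut.ext m p = m p.1 + sz p.2 := rfl
  omega

theorem PolyBdd.lift {α β : Type} [Enc β] {m X : α → ℕ} (h : PolyBdd m X) :
    PolyBdd (MinStableCut.ext (β := β) m) (fun p => X p.1) :=
  h.comp (.le_self fun p => by simp [MinStableCut.ext])

namespace PT

variable {α β γ δ σ : Type} [Enc α] [Enc β] [Enc γ] [Enc δ] [Enc σ] {m : α → ℕ}

theorem bdd {f : α → β} (hf : PT m f) : PolyBdd m (fun a => sz (f a)) := by
  obtain ⟨p, T, -, h, -⟩ := hf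
  exact h

/-- Same program on other data with the same encodings. -/
theorem of_enc {f : α → β} (h : ∀ a, Enc.enc (f a) = Enc.enc a) (hm : PolyBdd m (fun a => sz a)) :
    PT m f :=
  ⟨Prog.id, fun _ => 1, .const m 1, hm.mono fun a => by simp [sz, h],
    fun a => ⟨1, le_rfl, by rw [h]; exact Run.id _⟩⟩

theorem id (hm : PolyBdd m (fun a => sz a)) : PT m (fun a => a) := of_enc (fun _ => rfl) hm

theorem congr {f g : α → β} (hf : PT m f) (h : ∀ a, g a = f a) : PT m g := by
  rwa [show g = f from funext h]

/-- A program sees only encodings, so a value may change its type for free: truth values become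
numbers, pairs become lists or structures. -/
theorem cast {f : α → β} {g : α → γ} (hf : PT m f) (h : ∀ a, Enc.enc (g a) = Enc.enc (f a)) :
    PT m g := by
  obtain ⟨p, T, hT, hs, h'⟩ := hf
  exact ⟨p, T, hT, hs.mono fun a => by simp [sz, h], fun a => by rw [h]; exact h' a⟩

theorem mono_measure {m' : α → ℕ} {f : α → β} (hf : PT m f) (h : PolyBdd m' m) : PT m' f := by
  obtain ⟨p, T, hT, hs, h'⟩ := hf
  exact ⟨p, T, hT.comp (f := fun a => a) h, hs.comp (f := fun a => a) h, h'⟩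

/-- The time of the second program is polynomial in the measure of the intermediate value, which
must itself be under control. This is why `PT` bounds output sizes along with times. -/
theorem comp_gen {m' : β → ℕ} {g : β → γ} {f : α → β} (hg : PT m' g) (hf : PT m f)
    (hm : PolyBdd m (fun a => m' (f a))) : PT m (fun a => g (f a)) := by
  obtain ⟨p, T, hT, hs, h⟩ := hg
  obtain ⟨q, U, hU, -, h'⟩ := hf
  refine ⟨q.seq p, fun a => U a + T (f a) + 1, (hU.add (hT.comp hm)).add (.const m 1),
    hs.comp hm, fun a => ?_⟩
  obtain ⟨t, ht, ht'⟩ := h (f a)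
  obtain ⟨u, hu, hu'⟩ := h' a
  exact ⟨u + t + 1, by beta_reduce; omega, Run.seq hu' ht'⟩

/-- Composition with a function that takes time polynomial in the size of its argument. -/
theorem comp {g : β → γ} {f : α → β} (hg : PT sz g) (hf : PT m f) : PT m (fun a => g (f a)) :=
  hg.comp_gen hf hf.bdd

theorem const_nat (k : ℕ) : PT m (fun _ => k) :=
  ⟨Prog.const k, fun _ => 1, .const m 1, .const m (sz k), fun _ => ⟨1, le_rfl, Run.const _ _⟩⟩

theorem nil : PT m (fun _ => ([] : List β)) := (const_nat 0).cast fun _ => rfl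

theorem pair {f : α → β} {g : α → γ} (hf : PT m f) (hg : PT m g) : PT m (fun a => (f a, g a)) := by
  obtain ⟨p, T, hT, hs, h⟩ := hf
  obtain ⟨q, U, hU, hs', h'⟩ := hg
  refine ⟨p.pair q, fun a => T a + U a + 1, (hT.add hU).add (.const m 1),
    (hs.add hs').add (.const m 1), fun a => ?_⟩
  obtain ⟨t, ht, ht'⟩ := h a
  obtain ⟨u, hu, hu'⟩ := h' a
  exact ⟨t + u + 1, by beta_reduce; omega, Run.pair ht' hu'⟩

theorem fst {f : α → β × γ} (hf : PT m f) : PT m (fun a => (f a).1) := by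
  have : PT sz (fun p : β × γ => p.1) :=
    ⟨Prog.fst, fun _ => 1, .const _ 1, .le_self fun p => by
      have : sz p = sz p.1 + sz p.2 + 1 := rfl
      beta_reduce; omega, fun p => ⟨1, le_rfl, Run.fst _ _⟩⟩
  exact this.comp hf

theorem snd {f : α → β × γ} (hf : PT m f) : PT m (fun a => (f a).2) := by
  have : PT sz (fun p : β × γ => p.2) :=
    ⟨Prog.snd, fun _ => 1, .const _ 1, .le_self fun p => by
      have : sz p = sz p.1 + sz p.2 + 1 := rfl
      beta_reduce; omega, fun p => ⟨1, le_rfl, Run.snd _ _⟩⟩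
  exact this.comp hf

/-- A value computed in the environment, used in an extended environment. -/
theorem lift {f : α → β} (hf : PT m f) : PT (ext m) (fun p : α × γ => f p.1) := by
  obtain ⟨p, T, hT, hs, h⟩ := hf
  have hm : PolyBdd (ext m) (fun p : α × γ => m p.1) := .le_self fun p => by simp [ext]
  refine ⟨Prog.fst.seq p, fun a => T a.1 + 2, (hT.comp hm).add (.const _ 2), hs.comp hm,
    fun a => ?_⟩
  obtain ⟨t, ht, ht'⟩ := h a.1
  exact ⟨1 + t + 1, by beta_reduce; omega, Run.seq (Run.fst _ _) ht'⟩

/-- The last variable of an environment. -/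
theorem var : PT (ext m) (fun p : α × γ => p.2) :=
  ⟨Prog.snd, fun _ => 1, .const _ 1, .le_self fun p => by simp [ext],
    fun p => ⟨1, le_rfl, Run.snd _ _⟩⟩

theorem cons {f : α → β} {g : α → List β} (hf : PT m f) (hg : PT m g) :
    PT m (fun a => f a :: g a) := (hf.pair hg).cast fun _ => rfl

/-! #### Arithmetic -/

theorem add {f g : α → ℕ} (hf : PT m f) (hg : PT m g) : PT m (fun a => f a + g a) := by
  have : PT sz (fun p : ℕ × ℕ => p.1 + p.2) :=
    ⟨Prog.add, fun p => p.1.size + p.2.size + 1,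
      .le_self fun p => by simp only [sz, Val.size, Enc.enc]; omega,
      .le_self fun p => by
        have := natSize_add_le p.1 p.2
        simp only [sz, Val.size, Enc.enc] at *; omega,
      fun p => ⟨_, le_rfl, Run.add _ _⟩⟩
  exact this.comp (hf.pair hg)

theorem sub {f g : α → ℕ} (hf : PT m f) (hg : PT m g) : PT m (fun a => f a - g a) := by
  have : PT sz (fun p : ℕ × ℕ => p.1 - p.2) :=
    ⟨Prog.sub, fun p => p.1.size + p.2.size + 1,
      .le_self fun p => by simp only [sz, Val.size, Enc.enc]; omega,
      .le_self fun p => by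
        have := Nat.size_le_size (Nat.sub_le p.1 p.2)
        simp only [sz, Val.size, Enc.enc] at *; omega,
      fun p => ⟨_, le_rfl, Run.sub _ _⟩⟩
  exact this.comp (hf.pair hg)

theorem mul {f g : α → ℕ} (hf : PT m f) (hg : PT m g) : PT m (fun a => f a * g a) := by
  have : PT sz (fun p : ℕ × ℕ => p.1 * p.2) :=
    ⟨Prog.mul, fun p => p.1.size + p.2.size + 1,
      .le_self fun p => by simp only [sz, Val.size, Enc.enc]; omega,
      .le_self fun p => by
        have := natSize_mul_le p.1 p.2
        simp only [sz, Val.size, Enc.enc] at *; omega,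
      fun p => ⟨_, le_rfl, Run.mul _ _⟩⟩
  exact this.comp (hf.pair hg)

theorem div {f g : α → ℕ} (hf : PT m f) (hg : PT m g) : PT m (fun a => f a / g a) := by
  have : PT sz (fun p : ℕ × ℕ => p.1 / p.2) :=
    ⟨Prog.div, fun p => p.1.size + p.2.size + 1,
      .le_self fun p => by simp only [sz, Val.size, Enc.enc]; omega,
      .le_self fun p => by
        have := Nat.size_le_size (Nat.div_le_self p.1 p.2)
        simp only [sz, Val.size, Enc.enc] at *; omega,
      fun p => ⟨_, le_rfl, Run.div _ _⟩⟩
  exact this.comp (hf.pair hg)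

/-! #### Tests -/

theorem not {f : α → Bool} (hf : PT m f) : PT m (fun a => !f a) :=
  ((const_nat 1).sub (hf.cast (g := fun a => (f a).toNat) fun _ => rfl)).cast fun a => by
    cases f a <;> rfl

theorem and {f g : α → Bool} (hf : PT m f) (hg : PT m g) : PT m (fun a => f a && g a) :=
  ((hf.cast (g := fun a => (f a).toNat) fun _ => rfl).mul
    (hg.cast (g := fun a => (g a).toNat) fun _ => rfl)).cast fun a => by
    cases f a <;> cases g a <;> rfl

theorem or {f g : α → Bool} (hf : PT m f) (hg : PT m g) : PT m (fun a => f a || g a) :=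
  (hf.not.and hg.not).not.congr fun a => by simp

/-- With truncated subtraction, 1 - (f - g) is 1 if f ≤ g and 0 otherwise. -/
theorem le {f g : α → ℕ} (hf : PT m f) (hg : PT m g) : PT m (fun a => decide (f a ≤ g a)) :=
  ((const_nat 1).sub (hf.sub hg)).cast fun a => by
    rw [enc_bool, enc_nat]
    by_cases h : f a ≤ g a
    · simp [h]
    · have : 1 - (f a - g a) = 0 := by omega
      simp [h, this]

theorem lt {f g : α → ℕ} (hf : PT m f) (hg : PT m g) : PT m (fun a => decide (f a < g a)) :=
  ((hf.add (const_nat 1)).le hg).congr fun _ => rfl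

theorem eq {f g : α → ℕ} (hf : PT m f) (hg : PT m g) : PT m (fun a => decide (f a = g a)) :=
  ((hf.le hg).and (hg.le hf)).congr fun a => by
    rw [← Bool.decide_and]; exact decide_eq_decide.2 le_antisymm_iff

theorem beq {f g : α → Bool} (hf : PT m f) (hg : PT m g) : PT m (fun a => f a == g a) :=
  ((hf.and hg).or (hf.not.and hg.not)).congr fun a => by cases f a <;> cases g a <;> rfl

/-- Each branch has to be fast only on the inputs that reach it. The main case distinction needs
this form, since the dynamic program is too slow, and its measure too large, on trivial instances.
-/
theorem ite_sub {b : α → Bool} {f : {a // b a = true} → β} {g : {a // b a = false} → β} {r : α → β}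
    (hb : PT m b) (hf : PT (fun a => m a.1) f) (hg : PT (fun a => m a.1) g)
    (hrf : ∀ a (h : b a = true), r a = f ⟨a, h⟩) (hrg : ∀ a (h : b a = false), r a = g ⟨a, h⟩) :
    PT m r := by
  obtain ⟨pb, Tb, ⟨cb, hTb⟩, -, hb⟩ := hb
  obtain ⟨pf, Tf, ⟨cf, hTf⟩, ⟨df, hsf⟩, hf⟩ := hf
  obtain ⟨pg, Tg, ⟨cg, hTg⟩, ⟨dg, hsg⟩, hg⟩ := hg
  refine ⟨pb.cond pf pg, fun a => (m a + 2) ^ cb + ((m a + 2) ^ cf + (m a + 2) ^ cg) + 1,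
    ?_, ?_, fun a => ?_⟩
  · have h := ((PolyBdd.self m).add (.const m 2))
    exact ((h.pow cb).add ((h.pow cf).add (h.pow cg))).add (.const m 1)
  · have h := ((PolyBdd.self m).add (.const m 2))
    refine ((h.pow df).add (h.pow dg)).mono fun a => ?_
    cases hba : b a
    · rw [hrg a hba]; exact (hsg ⟨a, hba⟩).trans (Nat.le_add_left _ _)
    · rw [hrf a hba]; exact (hsf ⟨a, hba⟩).trans (Nat.le_add_right _ _)
  · obtain ⟨s, hs, hs'⟩ := hb a
    have h0 := hTb a
    cases hba : b a
    · obtain ⟨t, ht, ht'⟩ := hg ⟨a, hba⟩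
      have := hTg ⟨a, hba⟩
      rw [hba] at hs'
      refine ⟨s + t + 1, ?_, ?_⟩
      · simp only at *; omega
      · rw [hrg a hba]; exact Run.cond_false hs' ht'
    · obtain ⟨t, ht, ht'⟩ := hf ⟨a, hba⟩
      have := hTf ⟨a, hba⟩
      rw [hba] at hs'
      refine ⟨s + t + 1, ?_, ?_⟩
      · simp only at *; omega
      · rw [hrf a hba]; exact Run.cond_true hs' ht'

theorem restrict {f : α → β} (hf : PT m f) (P : α → Prop) :
    PT (fun a : {a // P a} => m a.1) (fun a => f a.1) := by
  obtain ⟨p, T, ⟨c, hT⟩, ⟨d, hs⟩, h⟩ := hf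
  exact ⟨p, fun a => T a.1, ⟨c, fun a => hT a.1⟩, ⟨d, fun a => hs a.1⟩, fun a => h a.1⟩

theorem ite {b : α → Bool} {f g : α → β} (hb : PT m b) (hf : PT m f) (hg : PT m g) :
    PT m (fun a => if b a = true then f a else g a) :=
  ite_sub hb (hf.restrict _) (hg.restrict _) (fun a h => by simp [h]) (fun a h => by simp [h])

theorem ite_prop {P : α → Prop} [∀ a, Decidable (P a)] {f g : α → β}
    (hb : PT m fun a => decide (P a)) (hf : PT m f) (hg : PT m g) :
    PT m (fun a => if P a then f a else g a) := (ite hb hf hg).congr fun a => by simp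

end PT

theorem Run.loop_iterate {b p : Prog} {B : ℕ} (k : ℕ) (s : ℕ → Val)
    (hb : ∀ j < k, ∃ t ≤ B, ∃ c, Run b (s j) (Val.num (c + 1)) t)
    (hp : ∀ j < k, ∃ t ≤ B, Run p (s j) (s (j + 1)) t)
    (hend : ∃ t ≤ B, Run b (s k) (Val.num 0) t) :
    ∃ t ≤ (k + 1) * (2 * B + 1), Run (Prog.loop b p) (s 0) (s k) t := by
  induction k generalizing s with
  | zero =>
    obtain ⟨t, ht, h⟩ := hend
    exact ⟨t + 1, by omega, Run.loop_stop h⟩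
  | succ k ih =>
    obtain ⟨t, ht, c, hc⟩ := hb 0 (by omega)
    obtain ⟨u, hu, hu'⟩ := hp 0 (by omega)
    obtain ⟨r, hr, hr'⟩ := ih (fun j => s (j + 1)) (fun j hj => hb (j + 1) (by omega))
      (fun j hj => hp (j + 1) (by omega)) hend
    refine ⟨t + u + r + 1, ?_, Run.loop_step hc hu' hr'⟩
    rw [add_mul (k + 1) 1]
    omega

namespace PT

variable {α β γ δ σ : Type} [Enc α] [Enc β] [Enc γ] [Enc δ] [Enc σ] {m : α → ℕ}

/-! #### Loops -/

/-- Folding over a list, if the intermediate results stay polynomially bounded. -/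
theorem foldl {l : α → List γ} {init : α → σ} {f : α → σ → γ → σ} {B : α → ℕ}
    (hm : PolyBdd m (fun a => sz a)) (hl : PT m l) (hi : PT m init)
    (hf : PT (ext (ext m)) fun q : (α × σ) × γ => f q.1.1 q.1.2 q.2)
    (hB : PolyBdd m B)
    (hle : ∀ a j, j ≤ (l a).length →
      sz (((l a).take j).foldl (fun s c => f a s c) (init a)) ≤ B a) :
    PT m (fun a => (l a).foldl (fun s c => f a s c) (init a)) := by
  obtain ⟨pf, Tf, ⟨c, hTf⟩, -, hf⟩ := hf
  have hpair := ((id hm).pair (hi.pair hl))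
  obtain ⟨pi, Ti, hTi, -, hpi⟩ := hpair
  -- The loop state is `(a, (s, rest))`. `R` rearranges it to `((a, s), head of rest)`, the argument
  -- of the loop body, and the test asks whether `rest` is a pair, that is, nonempty.
  let R : Prog := ((Prog.fst.pair (Prog.snd.seq Prog.fst)).pair
    ((Prog.snd.seq Prog.snd).seq Prog.fst))
  let body : Prog := Prog.fst.pair ((R.seq pf).pair ((Prog.snd.seq Prog.snd).seq Prog.snd))
  let test : Prog := (Prog.snd.seq Prog.snd).seq Prog.isPair
  -- A bound for one pass that is uniform over the passes: the current state has size at most `B a`,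
  -- the current element less than `sz (l a)`, and 30 pays for the rearrangements.
  let U : α → ℕ := fun a => (m a + B a + sz (l a) + 2) ^ c + 30
  have hU : PolyBdd m U :=
    (((((PolyBdd.self m).add hB).add hl.bdd).add (.const m 2)).pow c).add (.const m 30)
  refine ⟨(pi.seq (Prog.loop test body)).seq (Prog.snd.seq Prog.fst),
    fun a => Ti a + (sz (l a) + 1) * (2 * U a + 1) + 10, ?_, ?_, fun a => ?_⟩
  · exact (hTi.add ((hl.bdd.add (.const m 1)).mul (((PolyBdd.const m 2).mul hU).add
      (.const m 1)))).add (.const m 10)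
  · exact hB.mono fun a => by simpa using hle a _ le_rfl
  let st : ℕ → σ := fun j => ((l a).take j).foldl (fun s c => f a s c) (init a)
  have hloop := Run.loop_iterate (b := test) (p := body) (B := U a) (l a).length
    (fun j => Val.pair (Enc.enc a) (Val.pair (Enc.enc (st j)) (Enc.enc ((l a).drop j)))) ?_ ?_ ?_
  · obtain ⟨t, ht, hrun⟩ := hloop
    obtain ⟨u, hu, hu'⟩ := hpi a
    have hfin : Run (Prog.snd.seq Prog.fst) (Val.pair (Enc.enc a) (Val.pair
        (Enc.enc (st (l a).length)) (Enc.enc ((l a).drop (l a).length))))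
        (Enc.enc (st (l a).length)) (1 + 1 + 1) := Run.seq (Run.snd _ _) (Run.fst _ _)
    have hst : st (l a).length = (l a).foldl (fun s c => f a s c) (init a) := by
      simp only [st, List.take_length]
    beta_reduce
    rw [← hst]
    refine ⟨_, ?_, Run.seq (Run.seq hu' hrun) hfin⟩
    · have h1 : (l a).length + 1 ≤ sz (l a) + 1 := by have := length_lt_sz (l a); omega
      have := Nat.mul_le_mul_right (2 * U a + 1) h1
      omega
  · intro j hj
    rw [List.drop_eq_getElem_cons hj, enc_cons]
    refine ⟨_, ?_, 0, Run.seq (Run.seq (Run.snd _ _) (Run.snd _ _)) (Run.isPair_pair _ _)⟩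
    simp only [U]; omega
  · intro j hj
    obtain ⟨t, ht, hrun⟩ := hf ((a, st j), (l a)[j])
    have hst : st (j + 1) = f a (st j) (l a)[j] := by
      simp only [st]
      rw [List.take_add_one, List.foldl_append]
      simp [hj]
    rw [hst, List.drop_eq_getElem_cons hj, enc_cons]
    refine ⟨_, ?_, Run.pair (Run.fst _ _) (Run.pair (Run.seq (Run.pair (Run.pair (Run.fst _ _)
      (Run.seq (Run.snd _ _) (Run.fst _ _))) (Run.seq (Run.seq (Run.snd _ _) (Run.snd _ _))
        (Run.fst _ _))) hrun) (Run.seq (Run.seq (Run.snd _ _) (Run.snd _ _)) (Run.snd _ _)))⟩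
    · have h1 := hTf ((a, st j), (l a)[j])
      have h2 : ext (ext m) ((a, st j), (l a)[j]) + 2 ≤ m a + B a + sz (l a) + 2 := by
        have e1 := hle a j hj.le
        have e2 := sz_lt_of_mem (List.getElem_mem hj)
        simp only [ext, st]
        omega
      have h3 := Nat.pow_le_pow_left h2 c
      simp only [U]
      omega
  · simp only [List.drop_length]
    refine ⟨_, ?_, Run.seq (Run.seq (Run.snd _ _) (Run.snd _ _)) (Run.isPair_num _)⟩
    simp only [U]; omega

theorem sz_range_le (k : ℕ) : sz (List.range k) ≤ k * (k + 2) + 1 := by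
  have := sz_list_le (l := List.range k) (B := k + 1) fun a ha =>
    (sz_nat_le a).trans (by have := List.mem_range.1 ha; omega)
  simpa using this

/-- The value of `g`, not only its bit length, must be polynomial. The list is built from its end
with a counter running down to 0. -/
theorem range {g : α → ℕ} (hg : PT m g) (hb : PolyBdd m g) : PT m (fun a => List.range (g a)) := by
  obtain ⟨pg, Tg, hTg, -, hg⟩ := hg
  let dec : Prog := (Prog.fst.pair (Prog.const 1)).seq Prog.sub
  let body : Prog := dec.pair (dec.pair Prog.snd)
  refine ⟨((pg.pair (Prog.const 0)).seq (Prog.loop Prog.fst body)).seq Prog.snd,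
    fun a => Tg a + (g a + 1) * (2 * (2 * g a + 30) + 1) + 10, ?_, ?_, fun a => ?_⟩
  · exact (hTg.add ((hb.add (.const m 1)).mul (((PolyBdd.const m 2).mul
      (((PolyBdd.const m 2).mul hb).add (.const m 30))).add (.const m 1)))).add (.const m 10)
  · exact ((hb.mul (hb.add (.const m 2))).add (.const m 1)).mono fun a => sz_range_le _
  have hloop := Run.loop_iterate (b := Prog.fst) (p := body) (B := 2 * g a + 30) (g a)
    (fun j => Val.pair (Val.num (g a - j)) (Enc.enc (List.range' (g a - j) j))) ?_ ?_ ?_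
  · obtain ⟨t, ht, hrun⟩ := hloop
    obtain ⟨u, hu, hu'⟩ := hg a
    refine ⟨(u + 1 + 1) + t + 1 + 1 + 1, by beta_reduce; omega, Run.seq (Run.seq (Run.pair hu'
      (Run.const 0 _)) hrun) ?_⟩
    simpa [List.range_eq_range'] using Run.snd (Val.num 0) (Enc.enc (List.range' 0 (g a)))
  · intro j hj
    refine ⟨1, by omega, g a - j - 1, ?_⟩
    rw [show g a - j - 1 + 1 = g a - j by omega]
    exact Run.fst _ _
  · intro j hj
    have h1 := natSize_le_self (g a - j)
    have h3 : Run dec (Val.pair (Val.num (g a - j)) (Enc.enc (List.range' (g a - j) j)))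
        (Val.num (g a - (j + 1))) ((1 + 1 + 1) + ((g a - j).size + Nat.size 1 + 1) + 1) :=
      Run.seq (Run.pair (Run.fst _ _) (Run.const 1 _)) (Run.sub _ _)
    have h4 : Nat.size 1 = 1 := by simp
    rw [show List.range' (g a - (j + 1)) (j + 1) = (g a - (j + 1)) :: List.range' (g a - j) j by
      rw [List.range'_succ, show g a - (j + 1) + 1 = g a - j by omega], enc_cons]
    exact ⟨_, by omega, Run.pair h3 (Run.pair h3 (Run.snd _ _))⟩
  · refine ⟨1, by omega, ?_⟩
    simp only [Nat.sub_self]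
    exact Run.fst _ _

theorem foldl_const_iterate {σ γ : Type} (f : σ → σ) (l : List γ) (s : σ) :
    l.foldl (fun s _ => f s) s = f^[l.length] s := by
  induction l generalizing s with
  | nil => rfl
  | cons a l ih => simp [ih]

/-- Iteration, if the intermediate results stay polynomially bounded. -/
theorem iterate {k : α → ℕ} {init : α → σ} {f : α → σ → σ} {B : α → ℕ}
    (hm : PolyBdd m (fun a => sz a)) (hk : PT m k) (hkb : PolyBdd m k) (hi : PT m init)
    (hf : PT (ext m) fun q : α × σ => f q.1 q.2) (hB : PolyBdd m B)
    (hle : ∀ a, ∀ j ≤ k a, sz ((f a)^[j] (init a)) ≤ B a) :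
    PT m (fun a => (f a)^[k a] (init a)) := by
  have := foldl (l := fun a => List.range (k a)) (init := init) (f := fun a s _ => f a s) hm
    (range hk hkb) hi hf.lift hB ?_
  · exact this.congr fun a => by rw [foldl_const_iterate (f a), List.length_range]
  · intro a j hj
    simp only [List.length_range] at hj
    rw [foldl_const_iterate (f a), List.length_take, List.length_range,
      min_eq_left hj]
    exact hle a j hj

/-! #### Lists -/

theorem reverse {l : α → List β} (hl : PT m l) : PT m (fun a => (l a).reverse) := by
  have key : ∀ l : List β, l.foldl (fun s c => c :: s) [] = l.reverse := fun l => by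
    simp
  have : PT sz (fun l : List β => l.reverse) := by
    have := foldl (m := sz) (l := fun l : List β => l) (init := fun _ => [])
      (f := fun _ s c => c :: s) (.self _) (id (.self _)) nil
      (var.cons var.lift) (B := sz) (.self _) fun l j _ => by
        simp only [key, sz_reverse]; exact sz_take_le l j
    exact this.congr fun l => (key l).symm
  exact this.comp hl

theorem append {l l' : α → List β} (hl : PT m l) (hl' : PT m l') :
    PT m (fun a => l a ++ l' a) := by
  have key : ∀ l l' : List β, l.foldl (fun s c => c :: s) l' = l.reverse ++ l' := fun l l' => by
    simp
  have : PT sz (fun p : List β × List β => p.1.reverse ++ p.2) := by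
    have := foldl (m := sz) (l := fun p : List β × List β => p.1) (init := fun p => p.2)
      (f := fun _ s c => c :: s) (.self _)
      (id (.self _)).fst (id (.self _)).snd (var.cons var.lift) (B := sz) (.self _) fun p j _ => by
        simp only [key]
        have h1 := sz_append (p.1.take j).reverse p.2
        rw [sz_reverse] at h1
        have h2 := sz_take_le p.1 j
        have h3 : sz p = sz p.1 + sz p.2 + 1 := rfl
        omega
    exact this.congr fun p => (key _ _).symm
  exact (this.comp (hl.reverse.pair hl')).congr fun a => by simp

theorem map {l : α → List γ} {f : α → γ → β} (hm : PolyBdd m (fun a => sz a)) (hl : PT m l)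
    (hf : PT (ext m) fun q : α × γ => f q.1 q.2) :
    PT m (fun a => (l a).map fun c => f a c) := by
  obtain ⟨c, hc⟩ := hf.bdd
  have key : ∀ a, ∀ l : List γ, l.foldl (fun s c => f a c :: s) [] =
      (l.map fun c => f a c).reverse := fun a l => by
    induction l using List.reverseRecOn with
    | nil => rfl
    | append_singleton l c ih => simp [ih]
  have := foldl (l := l) (init := fun _ => []) (f := fun a s c => f a c :: s)
    (B := fun a => sz (l a) * ((m a + sz (l a) + 2) ^ c + 1) + 1) hm hl
    nil ?_ ?_ ?_
  · exact this.reverse.congr fun a => by rw [key]; simp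
  · refine cons (hf.comp_gen (f := fun q : (α × List β) × γ => (q.1.1, q.2)) ?_ ?_) var.lift
    · exact pair ((id hm).lift.lift) var
    · exact .le_self fun q => by simp only [ext]; omega
  · exact ((hl.bdd.mul ((((PolyBdd.self m).add hl.bdd).add (.const m 2)).pow c |>.add
      (.const m 1))).add (.const m 1))
  · intro a j _
    rw [key, sz_reverse]
    refine (sz_list_le (B := (m a + sz (l a) + 2) ^ c) ?_).trans ?_
    · intro x hx
      obtain ⟨y, hy, rfl⟩ := List.mem_map.1 hx
      have h1 := sz_lt_of_mem (List.mem_of_mem_take hy)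
      exact (hc (a, y)).trans (Nat.pow_le_pow_left (by simp only [ext]; omega) _)
    · have h1 : (((l a).take j).map fun c => f a c).length ≤ sz (l a) := by
        have := length_lt_sz (l a)
        simp; omega
      have := Nat.mul_le_mul_right ((m a + sz (l a) + 2) ^ c + 1) h1
      omega

theorem sz_flatten_le (l : List (List β)) : sz l.flatten ≤ sz l := by
  induction l with
  | nil => simp [sz_nil]
  | cons x l ih =>
    have := sz_append x l.flatten
    simp only [List.flatten_cons, sz_cons]
    omega

theorem flatten {l : α → List (List β)} (hl : PT m l) : PT m (fun a => (l a).flatten) := by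
  have key : ∀ l : List (List β), l.foldl (fun s c => s ++ c) [] = l.flatten := fun l => by
    induction l using List.reverseRecOn with
    | nil => rfl
    | append_singleton l c ih => simp [ih]
  have : PT sz (fun l : List (List β) => l.flatten) := by
    have := foldl (m := sz) (l := fun l : List (List β) => l) (init := fun _ => [])
      (f := fun _ s c => s ++ c) (.self _) (id (.self _)) nil
      (var.lift.append var) (B := sz) (.self _) fun l j _ => by
        rw [key]
        exact (sz_flatten_le _).trans (sz_take_le l j)
    exact this.congr fun l => (key l).symm
  exact this.comp hl

theorem flatMap {l : α → List γ} {f : α → γ → List β} (hm : PolyBdd m (fun a => sz a))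
    (hl : PT m l) (hf : PT (ext m) fun q : α × γ => f q.1 q.2) :
    PT m (fun a => (l a).flatMap fun c => f a c) :=
  (map hm hl hf).flatten.congr fun a => by rw [List.flatMap_def]

theorem filter {l : α → List γ} {f : α → γ → Bool} (hm : PolyBdd m (fun a => sz a))
    (hl : PT m l) (hf : PT (ext m) fun q : α × γ => f q.1 q.2) :
    PT m (fun a => (l a).filter fun c => f a c) :=
  (flatMap (f := fun a c => if f a c = true then [c] else []) hm hl
    (ite hf (var.cons nil) nil)).congr fun a => by
      induction l a with
      | nil => rfl
      | cons c l ih => by_cases h : f a c <;> simp [h, ih]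

theorem sum {l : α → List ℕ} (hl : PT m l) : PT m (fun a => (l a).sum) := by
  have key : ∀ l : List ℕ, l.foldl (fun s c => s + c) 0 = l.sum := fun l =>
    List.sum_eq_foldl.symm
  have hs : ∀ l : List ℕ, sz l.sum ≤ sz l := fun l => by
    induction l with
    | nil => simp [sz_nil, sz_nat]
    | cons a l ih =>
      have := natSize_add_le a l.sum
      simp only [List.sum_cons, sz_cons, sz_nat] at *
      omega
  have : PT sz (fun l : List ℕ => l.sum) := by
    have := foldl (m := sz) (l := fun l : List ℕ => l) (init := fun _ => 0)
      (f := fun _ s c => s + c) (.self _) (id (.self _)) (const_nat 0)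
      (var.lift.add var) (B := sz) (.self _) fun l j _ => by
        rw [key]
        exact (hs _).trans (sz_take_le l j)
    exact this.congr fun l => (key l).symm
  exact this.comp hl

theorem length {l : α → List γ} (hl : PT m l) : PT m (fun a => (l a).length) := by
  have : PT sz (fun l : List γ => l.length) :=
    (map (m := sz) (f := fun _ _ => 1) (.self _) (id (.self _)) (const_nat 1)).sum.congr
      fun l => by simp
  exact this.comp hl

theorem any {l : α → List γ} {f : α → γ → Bool} (hm : PolyBdd m (fun a => sz a))
    (hl : PT m l) (hf : PT (ext m) fun q : α × γ => f q.1 q.2) :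
    PT m (fun a => (l a).any fun c => f a c) :=
  (lt (const_nat 0) (filter hm hl hf).length).congr fun a => by
    rw [Bool.eq_iff_iff]; simp [List.length_pos_iff, List.filter_eq_nil_iff]

theorem all {l : α → List γ} {f : α → γ → Bool} (hm : PolyBdd m (fun a => sz a))
    (hl : PT m l) (hf : PT (ext m) fun q : α × γ => f q.1 q.2) :
    PT m (fun a => (l a).all fun c => f a c) :=
  (any (f := fun a c => !f a c) hm hl hf.not).not.congr fun a => by simp [List.all_eq_not_any_not]

theorem getD {l : α → List γ} {i : α → ℕ} {d : α → γ} (hl : PT m l) (hi : PT m i) (hd : PT m d) :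
    PT m (fun a => (l a).getD (i a) (d a)) := by
  -- The counter starts at `i + 1`, equals 1 exactly when the element of index `i` is read, and then
  -- stays at 0 because subtraction is truncated.
  have key : ∀ (i : ℕ) (d : γ) (l : List γ),
      l.foldl (fun (s : ℕ × γ) c => (s.1 - 1, if s.1 = 1 then c else s.2)) (i + 1, d) =
        (i + 1 - l.length, l.getD i d) := fun i d l => by
    induction l using List.reverseRecOn with
    | nil => rfl
    | append_singleton l c ih =>
      rw [List.foldl_append, ih]
      simp only [List.foldl_cons, List.foldl_nil, List.length_append, List.length_singleton]
      refine Prod.ext (by simp only; omega) ?_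
      simp only [List.getD_eq_getElem?_getD]
      rcases lt_trichotomy i l.length with h | h | h
      · rw [if_neg (by omega), List.getElem?_append_left h]
      · rw [if_pos (by omega)]; simp [h]
      · rw [if_neg (by omega), List.getElem?_eq_none (by omega),
          List.getElem?_eq_none (by simp; omega)]
  have hdsz : ∀ (l : List γ) (i : ℕ) (d : γ), sz (l.getD i d) ≤ sz l + sz d := fun l i d => by
    rw [List.getD_eq_getElem?_getD]
    by_cases h : i < l.length
    · have := sz_lt_of_mem (List.getElem_mem h)
      simp [h]; omega
    · simp [h]
  have : PT sz (fun p : List γ × ℕ × γ => p.1.getD p.2.1 p.2.2) := by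
    have := foldl (m := sz) (l := fun p : List γ × ℕ × γ => p.1)
      (init := fun p => (p.2.1 + 1, p.2.2))
      (f := fun _ (s : ℕ × γ) c =>
        (s.1 - 1, if s.1 = 1 then c else s.2)) (.self _) (id (.self _)).fst
      (((id (.self _)).snd.fst.add (const_nat 1)).pair (id (.self _)).snd.snd)
      (pair (var.lift.fst.sub (const_nat 1)) (ite_prop (var.lift.fst.eq (const_nat 1)) var
        var.lift.snd)) (B := fun p => 2 * sz p + 2)
      (((PolyBdd.const _ 2).mul (.self _)).add (.const _ 2)) fun p j _ => by
        rw [key]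
        have h1 := hdsz (p.1.take j) p.2.1 p.2.2
        have h2 := sz_take_le p.1 j
        have h3 : sz p = sz p.1 + (sz p.2.1 + sz p.2.2 + 1) + 1 := rfl
        have h4 : sz (p.2.1 + 1 - (p.1.take j).length) ≤ sz p.2.1 + 1 := by
          refine (sz_nat_mono (Nat.sub_le _ _)).trans ?_
          have := natSize_add_le p.2.1 1
          simp only [sz_nat, Nat.size_one] at *
          omega
        rw [sz_pair]
        omega
    exact this.snd.congr fun p => by rw [key]
  exact this.comp (hl.pair (hi.pair hd))

end PT

/-! ### Vectors and sums -/

/-- The entry of a list of numbers at an index, `0` beyond its end. -/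
def get0 (l : List ℕ) (i : ℕ) : ℕ := l.getD i 0

/-- The list of the first `n` values of a function. -/
def vec (n : ℕ) (f : ℕ → ℕ) : List ℕ := (List.range n).map f

/-- The sum of the first `n` values of a function. -/
def rsum (n : ℕ) (f : ℕ → ℕ) : ℕ := ((List.range n).map f).sum

theorem get0_vec (n : ℕ) (f : ℕ → ℕ) (i : ℕ) : get0 (vec n f) i = if i < n then f i else 0 := by
  unfold get0 vec
  rw [List.getD_eq_getElem?_getD]
  by_cases h : i < n
  · simp [h]
  · simp [h]

theorem get0_of_length_le {l : List ℕ} {i : ℕ} (h : l.length ≤ i) : get0 l i = 0 := by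
  simp [get0, h]

theorem length_vec (n : ℕ) (f : ℕ → ℕ) : (vec n f).length = n := by simp [vec]

theorem rsum_eq (n : ℕ) (f : ℕ → ℕ) : rsum n f = ∑ i ∈ Finset.range n, f i := rfl

theorem rsum_add (n : ℕ) (f g : ℕ → ℕ) : rsum n (fun i => f i + g i) = rsum n f + rsum n g := by
  simp only [rsum_eq, Finset.sum_add_distrib]

theorem rsum_congr {n : ℕ} {f g : ℕ → ℕ} (h : ∀ i, f i = g i) : rsum n f = rsum n g := by
  rw [funext h]

theorem rsum_mono {n : ℕ} {f g : ℕ → ℕ} (h : ∀ i, f i ≤ g i) : rsum n f ≤ rsum n g := by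
  simp only [rsum_eq]
  exact Finset.sum_le_sum fun i _ => h i

theorem rsum_eq_zero {n : ℕ} {f : ℕ → ℕ} (h : ∀ i, f i = 0) : rsum n f = 0 := by
  rw [rsum_eq]
  exact Finset.sum_eq_zero fun i _ => h i

/-- The indicator function of a set of numbers. -/
def ind (F : Finset ℕ) (i : ℕ) : ℕ := if i ∈ F then 1 else 0

theorem ind_pos {F : Finset ℕ} {i : ℕ} : 0 < ind F i ↔ i ∈ F := by
  unfold ind; split_ifs <;> simp_all

theorem ind_eq_zero {F : Finset ℕ} {i : ℕ} : ind F i = 0 ↔ i ∉ F := by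
  unfold ind; split_ifs <;> simp_all

/-! ### The dynamic program -/

/-- The data of the dynamic program: the weighted adjacency lists, the neighbour lists and bags of
the nodes, an ordering of the nodes, a bound on the size of the bags, the number `q` of steps of the
scale on which crossing weights are recorded, and the number `R` of rounds. -/
structure Data where
  adj : List (List (ℕ × ℕ))
  dec : List (List ℕ × List ℕ)
  ord : List ℕ
  b : ℕ
  q : ℕ
  R : ℕ

/-- An entry `(S, x, k)` of a table: a set `S` of nodes, a cut `x` of the vertices in their bags,
and for each vertex a lower bound `k v / q` on the fraction of its weighted degree inside `S` that
crosses the cut. -/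
abbrev Entry := List ℕ × List ℕ × List ℕ

namespace Data

variable (d : Data)

/-- The number of vertices. -/
def n : ℕ := d.adj.length

/-- The number of nodes. -/
def N : ℕ := d.dec.length

/-- The weight of an edge, `0` for non-edges. -/
def wt (u v : ℕ) : ℕ := (((d.adj.getD u []).filter fun e => decide (e.1 = v)).map fun e => e.2).sum

/-- The vertices of a bag. -/
def bag (i : ℕ) : List ℕ := (d.dec.getD i ([], [])).2

def inBag (i v : ℕ) : Bool := (d.bag i).any fun u => decide (u = v)

/-- The node that owns the edge `uv`: the first one whose bag contains `u` and `v`. -/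
def own (u v : ℕ) : ℕ := get0 ((List.range d.N).filter fun i => d.inBag i u && d.inBag i v) 0

/-- The weight of `uv` if the edge is owned by a node of `S`. -/
def ow (S : ℕ → ℕ) (u v : ℕ) : ℕ := if S (d.own u v) = 0 then 0 else d.wt u v

/-- The weighted degree of `v` inside `S`. -/
def deg (S : ℕ → ℕ) (v : ℕ) : ℕ := rsum d.n fun u => d.ow S v u

/-- The weight of the edges inside `S` that are incident on `v` and cross the cut `x`. -/
def cr (S x : ℕ → ℕ) (v : ℕ) : ℕ := rsum d.n fun u => if x u = x v then 0 else d.ow S v u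

/-- The weight of the cut `x` inside `S`. -/
def cost (S x : ℕ → ℕ) : ℕ :=
  rsum d.n fun u => rsum d.n fun v =>
    if (decide (x u = 0) && !decide (x v = 0)) = true then d.ow S u v else 0

/-- `v` occurs in a bag of `S`. -/
def inV (S : ℕ → ℕ) (v : ℕ) : Bool := (List.range d.N).any fun i => decide (0 < S i) && d.inBag i v

/-- `v` occurs in a bag outside `S`. -/
def outV (S : ℕ → ℕ) (v : ℕ) : Bool :=
  (List.range d.N).any fun i => decide (S i = 0) && d.inBag i v

/-- `v` is on the boundary of `S`. -/
def inB (S : ℕ → ℕ) (v : ℕ) : Bool := d.inV S v && d.outV S v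

/-- `S` is a difference of two intervals of the ordering of the nodes. -/
def shape (S : ℕ → ℕ) : Bool :=
  (List.range (d.N + 1)).any fun a => (List.range (d.N + 1)).any fun b =>
    (List.range (d.N + 1)).any fun c => (List.range (d.N + 1)).any fun e =>
      (List.range d.N).all fun i => decide (0 < S (get0 d.ord i)) ==
        ((decide (a ≤ i) && decide (i < b)) && !(decide (c ≤ i) && decide (i < e)))

/-- The size of the boundary of `S`. -/
def bcount (S : ℕ → ℕ) : ℕ := ((List.range d.n).filter fun v => d.inB S v).length

/-- `S` is one of the sets of nodes for which entries are kept. -/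
def admissible (S : ℕ → ℕ) : Bool := d.shape S && decide (d.bcount S ≤ 2 * d.b)

/-- The vertices all of whose bags are in `S` are (nearly) stable. -/
def settled (S k : ℕ → ℕ) : Bool :=
  -- Up to the factor `deg`, which lets vertices without weight inside `S` pass, the test says k/q +
  -- (R+1)/q ≥ 1/2; the term R + 1 absorbs all rounding errors.
  (List.range d.n).all fun v => d.inB S v ||
    decide (d.q * d.deg S v ≤ 2 * (k v + (d.R + 1)) * d.deg S v)

def good (e : Entry) : Bool := d.admissible (get0 e.1) && d.settled (get0 e.1) (get0 e.2.2)

/-- Entries that need not be distinguished. -/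
def sameKey (e e' : Entry) : Bool :=
  ((List.range d.N).all fun i => decide (get0 e.1 i = get0 e'.1 i)) &&
    ((List.range d.n).all fun v => !d.inB (get0 e.1) v ||
      (decide (get0 e.2.1 v = get0 e'.2.1 v) && decide (get0 e.2.2 v = get0 e'.2.2 v)))

/-- Two entries fit together. -/
def compat (e e' : Entry) : Bool :=
  ((List.range d.N).all fun i => decide (get0 e.1 i = 0) || decide (get0 e'.1 i = 0)) &&
    ((List.range d.n).all fun v => !(d.inV (get0 e.1) v && d.inV (get0 e'.1) v) ||
      decide (get0 e.2.1 v = get0 e'.2.1 v))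

/-- The entry for the union of the node sets of two entries. -/
def merge (e e' : Entry) : Entry :=
  (vec d.N fun i => get0 e.1 i + get0 e'.1 i,
    -- Cuts are 0 off the bags of their node sets and agree where both are defined, so this glues
    -- them.
    vec d.n fun v => if get0 e.2.1 v = 0 then get0 e'.2.1 v else get0 e.2.1 v,
    -- The average of the two fractions weighted by degree, rounded down; it is 0 if both degrees
    -- vanish.
    vec d.n fun v => (get0 e.2.2 v * d.deg (get0 e.1) v + get0 e'.2.2 v * d.deg (get0 e'.1) v) /
      (d.deg (get0 e.1) v + d.deg (get0 e'.1) v))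

/-- All cuts of the vertices in a list. -/
def assign (n : ℕ) (l : List ℕ) : List (List ℕ) :=
  l.foldl (fun acc v => acc ++ acc.map fun x => vec n fun u => if u = v then 1 else get0 x u)
    [vec n fun _ => 0]

def single (i : ℕ) : List ℕ := vec d.N fun j => if j = i then 1 else 0

/-- The entry for a single node and a cut of its bag. -/
def leaf (i : ℕ) (x : List ℕ) : Entry :=
  (d.single i, x, vec d.n fun v => d.q * d.cr (get0 (d.single i)) (get0 x) v /
    d.deg (get0 (d.single i)) v)

def leaves : List Entry :=
  ((List.range d.N).flatMap fun i => (assign d.n (d.bag i)).map fun x => d.leaf i x).filter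
    fun e => d.good e

/-- Insertion of an entry into a list of entries with distinct keys, only the cheapest one of each
key being kept. -/
def ins (l : List Entry) (e : Entry) : List Entry :=
  if (l.any fun e' => d.sameKey e e' &&
      decide (d.cost (get0 e'.1) (get0 e'.2.1) ≤ d.cost (get0 e.1) (get0 e.2.1))) = true then l
  else e :: l.filter fun e' => !d.sameKey e e'

def prune (l : List Entry) : List Entry := l.foldl (fun acc e => d.ins acc e) []

def merges (T : List Entry) : List Entry :=
  (T.flatMap fun e => (T.filter fun e' => d.compat e e').map fun e' => d.merge e e').filter
    fun e => d.good e

def step (T : List Entry) : List Entry := d.prune (T ++ d.merges T)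

/-- The table after `r` rounds. -/
def table (r : ℕ) : List Entry := d.step^[r] (d.prune d.leaves)

/-- The cut of an entry for the set of all nodes. -/
def output : List ℕ :=
  ((d.table d.R).filter fun e => (List.range d.N).all fun i => decide (0 < get0 e.1 i)).getD 0
    ([], [], []) |>.2.1

/-- The data describe a graph whose edges are covered by the bags. -/
structure Valid : Prop where
  cover : ∀ u v, d.wt u v ≠ 0 → ∃ i < d.N, d.inBag i u = true ∧ d.inBag i v = true
  lt_n : ∀ i v, d.inBag i v = true → v < d.n

/-! ### Locality and additivity of the quantities inside a set of nodes -/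

variable {d}

theorem inV_iff {S : ℕ → ℕ} {v : ℕ} :
    d.inV S v = true ↔ ∃ i < d.N, 0 < S i ∧ d.inBag i v = true := by
  simp [inV]

theorem outV_iff {S : ℕ → ℕ} {v : ℕ} :
    d.outV S v = true ↔ ∃ i < d.N, S i = 0 ∧ d.inBag i v = true := by
  simp [outV]

theorem inB_iff {S : ℕ → ℕ} {v : ℕ} :
    d.inB S v = true ↔ d.inV S v = true ∧ d.outV S v = true := by
  simp [inB]

theorem own_spec {u v i : ℕ} (hi : i < d.N) (hu : d.inBag i u = true) (hv : d.inBag i v = true) :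
    d.own u v < d.N ∧ d.inBag (d.own u v) u = true ∧ d.inBag (d.own u v) v = true := by
  have hmem : i ∈ (List.range d.N).filter fun i => d.inBag i u && d.inBag i v := by
    simp [hi, hu, hv]
  have hpos := List.length_pos_of_mem hmem
  have hown : d.own u v ∈ (List.range d.N).filter fun i => d.inBag i u && d.inBag i v := by
    unfold own get0
    rw [List.getD_eq_getElem?_getD, List.getElem?_eq_getElem hpos]
    exact List.getElem_mem hpos
  simpa using hown

/-- The owner of the edge lies in `S` and its bag contains both ends. Hence crossing weights and
costs inside `S` depend only on the cut of the vertices in the bags of `S`. -/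
theorem ow_ne_zero (hd : d.Valid) {S : ℕ → ℕ} {u v : ℕ} (h : d.ow S u v ≠ 0) :
    d.inV S u = true ∧ d.inV S v = true := by
  unfold ow at h
  split_ifs at h with hS
  · exact absurd rfl h
  obtain ⟨i, hi, h1, h2⟩ := hd.cover u v h
  obtain ⟨h3, h4, h5⟩ := own_spec hi h1 h2
  exact ⟨inV_iff.2 ⟨_, h3, by omega, h4⟩, inV_iff.2 ⟨_, h3, by omega, h5⟩⟩

/-- If no bag outside `S` contains `v`, then `S` owns every edge at `v`, so `v` can be tested for
stability once and for all. -/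
theorem ow_eq_wt (hd : d.Valid) {S : ℕ → ℕ} {v : ℕ} (h : d.outV S v ≠ true) (u : ℕ) :
    d.ow S v u = d.wt v u := by
  unfold ow
  split_ifs with hS
  · by_contra hne
    obtain ⟨i, hi, h1, h2⟩ := hd.cover v u (Ne.symm hne)
    obtain ⟨h3, h4, -⟩ := own_spec hi h1 h2
    exact h (outV_iff.2 ⟨_, h3, hS, h4⟩)
  · rfl

/-- Each edge has one owner, so disjoint sets never count it twice; degree, crossing weight and cost
inherit additivity from here. -/
theorem ow_add {S T : ℕ → ℕ} (h : ∀ i, S i = 0 ∨ T i = 0) (u v : ℕ) :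
    d.ow (fun i => S i + T i) u v = d.ow S u v + d.ow T u v := by
  unfold ow
  rcases h (d.own u v) with h | h <;> simp [h]

theorem deg_eq_zero (hd : d.Valid) {S : ℕ → ℕ} {v : ℕ} (h : d.inV S v ≠ true) : d.deg S v = 0 :=
  rsum_eq_zero fun u => by
    by_contra hne
    exact h (ow_ne_zero hd hne).1

theorem deg_add {S T : ℕ → ℕ} (h : ∀ i, S i = 0 ∨ T i = 0) (v : ℕ) :
    d.deg (fun i => S i + T i) v = d.deg S v + d.deg T v := by
  unfold deg
  rw [← rsum_add]
  exact rsum_congr fun u => ow_add h v u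

theorem cr_add {S T : ℕ → ℕ} (h : ∀ i, S i = 0 ∨ T i = 0) (x : ℕ → ℕ) (v : ℕ) :
    d.cr (fun i => S i + T i) x v = d.cr S x v + d.cr T x v := by
  unfold cr
  rw [← rsum_add]
  refine rsum_congr fun u => ?_
  split_ifs
  · rfl
  · exact ow_add h v u

theorem cost_add {S T : ℕ → ℕ} (h : ∀ i, S i = 0 ∨ T i = 0) (x : ℕ → ℕ) :
    d.cost (fun i => S i + T i) x = d.cost S x + d.cost T x := by
  unfold cost
  rw [← rsum_add]
  refine rsum_congr fun u => ?_
  rw [← rsum_add]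
  refine rsum_congr fun v => ?_
  split_ifs
  · exact ow_add h u v
  · rfl

theorem cr_congr (hd : d.Valid) {S x y : ℕ → ℕ} (h : ∀ u, d.inV S u = true → x u = y u) (v : ℕ) :
    d.cr S x v = d.cr S y v := by
  refine rsum_congr fun u => ?_
  by_cases hz : d.ow S v u = 0
  · simp [hz]
  · obtain ⟨h1, h2⟩ := ow_ne_zero hd hz
    rw [h u h2, h v h1]

theorem cost_congr (hd : d.Valid) {S x y : ℕ → ℕ} (h : ∀ u, d.inV S u = true → x u = y u) :
    d.cost S x = d.cost S y := by
  refine rsum_congr fun u => rsum_congr fun v => ?_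
  by_cases hz : d.ow S u v = 0
  · simp [hz]
  · obtain ⟨h1, h2⟩ := ow_ne_zero hd hz
    rw [h u h1, h v h2]

theorem cr_le_deg (S x : ℕ → ℕ) (v : ℕ) : d.cr S x v ≤ d.deg S v :=
  rsum_mono fun u => by split_ifs <;> simp

theorem inV_congr {S T : ℕ → ℕ} (h : ∀ i < d.N, S i = T i) (v : ℕ) : d.inV S v = d.inV T v := by
  rw [Bool.eq_iff_iff, inV_iff, inV_iff]
  exact exists_congr fun i => and_congr_right fun hi => by rw [h i hi]

theorem outV_congr {S T : ℕ → ℕ} (h : ∀ i < d.N, S i = T i) (v : ℕ) :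
    d.outV S v = d.outV T v := by
  rw [Bool.eq_iff_iff, outV_iff, outV_iff]
  exact exists_congr fun i => and_congr_right fun hi => by rw [h i hi]

theorem inB_congr {S T : ℕ → ℕ} (h : ∀ i < d.N, S i = T i) (v : ℕ) : d.inB S v = d.inB T v := by
  rw [inB, inB, inV_congr h, outV_congr h]

theorem settled_iff {S k : ℕ → ℕ} : d.settled S k = true ↔ ∀ v < d.n, d.inB S v = true ∨
    d.q * d.deg S v ≤ 2 * (k v + (d.R + 1)) * d.deg S v := by
  simp [settled]

theorem good_iff {e : Entry} : d.good e = true ↔ d.admissible (get0 e.1) = true ∧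
    d.settled (get0 e.1) (get0 e.2.2) = true := by
  simp [good]

theorem sameKey_iff {e e' : Entry} : d.sameKey e e' = true ↔
    (∀ i < d.N, get0 e.1 i = get0 e'.1 i) ∧ ∀ v < d.n, d.inB (get0 e.1) v = true →
      get0 e.2.1 v = get0 e'.2.1 v ∧ get0 e.2.2 v = get0 e'.2.2 v := by
  simp only [sameKey, Bool.and_eq_true, List.all_eq_true, List.mem_range, decide_eq_true_eq,
    Bool.or_eq_true, Bool.not_eq_true', ← Bool.not_eq_true]
  exact and_congr_right fun _ => forall₂_congr fun v _ => by tauto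

theorem compat_iff {e e' : Entry} : d.compat e e' = true ↔
    (∀ i < d.N, get0 e.1 i = 0 ∨ get0 e'.1 i = 0) ∧ ∀ v < d.n, d.inV (get0 e.1) v = true →
      d.inV (get0 e'.1) v = true → get0 e.2.1 v = get0 e'.2.1 v := by
  simp only [compat, Bool.and_eq_true, List.all_eq_true, List.mem_range, decide_eq_true_eq,
    Bool.or_eq_true, Bool.not_eq_true', ← Bool.not_eq_true]
  exact and_congr_right fun _ => forall₂_congr fun v _ => by tauto

theorem sameKey_refl (e : Entry) : d.sameKey e e = true := sameKey_iff.2 (by simp)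

theorem sameKey_symm {e e' : Entry} (h : d.sameKey e e' = true) : d.sameKey e' e = true := by
  rw [sameKey_iff] at *
  refine ⟨fun i hi => (h.1 i hi).symm, fun v hv hB => ?_⟩
  rw [← inB_congr h.1] at hB
  exact ⟨(h.2 v hv hB).1.symm, (h.2 v hv hB).2.symm⟩

theorem sameKey_trans {e e' e'' : Entry} (h : d.sameKey e e' = true)
    (h' : d.sameKey e' e'' = true) : d.sameKey e e'' = true := by
  rw [sameKey_iff] at *
  refine ⟨fun i hi => (h.1 i hi).trans (h'.1 i hi), fun v hv hB => ?_⟩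
  have hB' := hB
  rw [inB_congr h.1] at hB'
  exact ⟨(h.2 v hv hB).1.trans (h'.2 v hv hB').1, (h.2 v hv hB).2.trans (h'.2 v hv hB').2⟩

/-! #### Pruning -/

theorem mem_of_mem_ins {l : List Entry} {e e' : Entry} (h : e' ∈ d.ins l e) : e' = e ∨ e' ∈ l := by
  unfold ins at h
  split_ifs at h
  · exact Or.inr h
  · rcases List.mem_cons.1 h with h | h
    · exact Or.inl h
    · exact Or.inr (List.mem_of_mem_filter h)

/-- `e'` has the key of `e` and costs no more. -/
def Dominates (d : Data) (e' e : Entry) : Prop :=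
  d.sameKey e e' = true ∧ d.cost (get0 e'.1) (get0 e'.2.1) ≤ d.cost (get0 e.1) (get0 e.2.1)

theorem Dominates.trans {e e' e'' : Entry} (h : d.Dominates e'' e') (h' : d.Dominates e' e) :
    d.Dominates e'' e := ⟨sameKey_trans h'.1 h.1, h.2.trans h'.2⟩

theorem exists_mem_ins_self (l : List Entry) (e : Entry) : ∃ e' ∈ d.ins l e, d.Dominates e' e := by
  unfold ins
  split_ifs with h
  · obtain ⟨e', he', h⟩ := List.any_eq_true.1 h
    simp only [Bool.and_eq_true, decide_eq_true_eq] at h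
    exact ⟨e', he', h⟩
  · exact ⟨e, by simp, sameKey_refl e, le_rfl⟩

theorem exists_mem_ins {l : List Entry} (e : Entry) {e' : Entry} (he' : e' ∈ l) :
    ∃ e'' ∈ d.ins l e, d.Dominates e'' e' := by
  unfold ins
  split_ifs with h
  · exact ⟨e', he', sameKey_refl e', le_rfl⟩
  · by_cases hk : d.sameKey e e' = true
    · refine ⟨e, by simp, sameKey_symm hk, ?_⟩
      by_contra hlt
      refine h (List.any_eq_true.2 ⟨e', he', ?_⟩)
      simp only [Bool.and_eq_true, decide_eq_true_eq]
      exact ⟨hk, by omega⟩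
    · exact ⟨e', by simp [he', hk], sameKey_refl e', le_rfl⟩

theorem pairwise_ins {l : List Entry} (h : l.Pairwise fun e e' => d.sameKey e e' ≠ true)
    (e : Entry) : (d.ins l e).Pairwise fun e e' => d.sameKey e e' ≠ true := by
  unfold ins
  split_ifs
  · exact h
  · refine List.pairwise_cons.2 ⟨fun e' he' => ?_, h.filter _⟩
    simpa using (List.mem_filter.1 he').2

theorem prune_append_singleton (l : List Entry) (e : Entry) :
    d.prune (l ++ [e]) = d.ins (d.prune l) e := by
  simp [prune]

theorem mem_of_mem_prune {l : List Entry} {e : Entry} (h : e ∈ d.prune l) : e ∈ l := by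
  induction l using List.reverseRecOn with
  | nil => simp [prune] at h
  | append_singleton l a ih =>
    rw [prune_append_singleton] at h
    rcases mem_of_mem_ins h with rfl | h
    · simp
    · simp [ih h]

theorem exists_mem_prune {l : List Entry} {e : Entry} (h : e ∈ l) :
    ∃ e' ∈ d.prune l, d.Dominates e' e := by
  induction l using List.reverseRecOn with
  | nil => simp at h
  | append_singleton l a ih =>
    rw [prune_append_singleton]
    rcases List.mem_append.1 h with h | h
    · obtain ⟨e', he', hd'⟩ := ih h
      obtain ⟨e'', he'', hd''⟩ := exists_mem_ins a he'
      exact ⟨e'', he'', hd''.trans hd'⟩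
    · obtain rfl : e = a := by simpa using h
      exact exists_mem_ins_self _ _

theorem pairwise_prune (l : List Entry) :
    (d.prune l).Pairwise fun e e' => d.sameKey e e' ≠ true := by
  induction l using List.reverseRecOn with
  | nil => simp [prune]
  | append_singleton l a ih =>
    rw [prune_append_singleton]
    exact pairwise_ins ih a

theorem table_succ (r : ℕ) : d.table (r + 1) = d.step (d.table r) :=
  Function.iterate_succ_apply' _ _ _

theorem pairwise_table (r : ℕ) : (d.table r).Pairwise fun e e' => d.sameKey e e' ≠ true := by
  cases r with
  | zero => exact pairwise_prune _
  | succ r => rw [table_succ]; exact pairwise_prune _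

/-! #### Soundness -/

/-- The entry describes a cut of the vertices in the bags of its set of nodes. -/
structure EntryOk (d : Data) (e : Entry) : Prop where
  len_S : e.1.length = d.N
  len_x : e.2.1.length = d.n
  len_k : e.2.2.length = d.n
  S_le : ∀ i, get0 e.1 i ≤ 1
  x_le : ∀ v, get0 e.2.1 v ≤ 1
  x_out : ∀ v, d.inV (get0 e.1) v ≠ true → get0 e.2.1 v = 0
  k_le : ∀ v, get0 e.2.2 v ≤ d.q
  -- Rounding is always down, so the recorded fraction never exceeds the true one.
  k_mul : ∀ v, get0 e.2.2 v * d.deg (get0 e.1) v ≤ d.q * d.cr (get0 e.1) (get0 e.2.1) v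
  isGood : d.good e = true

theorem get0_merge_fst {e e' : Entry} (h : e.1.length = d.N) (h' : e'.1.length = d.N) :
    get0 (d.merge e e').1 = fun i => get0 e.1 i + get0 e'.1 i := by
  funext i
  simp only [merge, get0_vec]
  split_ifs with hi
  · rfl
  · rw [get0_of_length_le (by omega), get0_of_length_le (by omega)]

theorem get0_merge_cut {e e' : Entry} (h : e.2.1.length = d.n) (h' : e'.2.1.length = d.n) (v : ℕ) :
    get0 (d.merge e e').2.1 v =
      if get0 e.2.1 v = 0 then get0 e'.2.1 v else get0 e.2.1 v := by
  simp only [merge, get0_vec]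
  split_ifs with hi h1 h1
  · rfl
  · rfl
  · rw [get0_of_length_le (by omega)]
  · exact absurd (get0_of_length_le (by omega)) h1

section Merge

variable {e e' : Entry}

theorem EntryOk.disj (he : d.EntryOk e) (hc : d.compat e e' = true) (i : ℕ) :
    get0 e.1 i = 0 ∨ get0 e'.1 i = 0 := by
  by_cases hi : i < d.N
  · exact (compat_iff.1 hc).1 i hi
  · exact Or.inl (get0_of_length_le (by rw [he.len_S]; omega))

theorem EntryOk.merge_cut_left (hd : d.Valid) (he : d.EntryOk e) (he' : d.EntryOk e')
    (hc : d.compat e e' = true) {v : ℕ} (hv : d.inV (get0 e.1) v = true) :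
    get0 (d.merge e e').2.1 v = get0 e.2.1 v := by
  rw [get0_merge_cut he.len_x he'.len_x]
  split_ifs with h
  · obtain ⟨i, -, -, hi⟩ := inV_iff.1 hv
    by_cases hv' : d.inV (get0 e'.1) v = true
    · exact ((compat_iff.1 hc).2 v (hd.lt_n i v hi) hv hv').symm
    · rw [he'.x_out v hv', h]
  · rfl

theorem EntryOk.merge_cut_right (hd : d.Valid) (he : d.EntryOk e) (he' : d.EntryOk e')
    (hc : d.compat e e' = true) {v : ℕ} (hv : d.inV (get0 e'.1) v = true) :
    get0 (d.merge e e').2.1 v = get0 e'.2.1 v := by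
  rw [get0_merge_cut he.len_x he'.len_x]
  split_ifs with h
  · rfl
  · obtain ⟨i, -, -, hi⟩ := inV_iff.1 hv
    by_cases hv' : d.inV (get0 e.1) v = true
    · exact (compat_iff.1 hc).2 v (hd.lt_n i v hi) hv' hv
    · exact absurd (he.x_out v hv') h

theorem EntryOk.cr_merge (hd : d.Valid) (he : d.EntryOk e) (he' : d.EntryOk e')
    (hc : d.compat e e' = true) (v : ℕ) :
    d.cr (get0 (d.merge e e').1) (get0 (d.merge e e').2.1) v =
      d.cr (get0 e.1) (get0 e.2.1) v + d.cr (get0 e'.1) (get0 e'.2.1) v := by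
  rw [get0_merge_fst he.len_S he'.len_S, cr_add (he.disj hc),
    cr_congr hd fun u hu => he.merge_cut_left hd he' hc hu,
    cr_congr hd fun u hu => he.merge_cut_right hd he' hc hu]

theorem EntryOk.cost_merge (hd : d.Valid) (he : d.EntryOk e) (he' : d.EntryOk e')
    (hc : d.compat e e' = true) :
    d.cost (get0 (d.merge e e').1) (get0 (d.merge e e').2.1) =
      d.cost (get0 e.1) (get0 e.2.1) + d.cost (get0 e'.1) (get0 e'.2.1) := by
  rw [get0_merge_fst he.len_S he'.len_S, cost_add (he.disj hc),
    cost_congr hd fun u hu => he.merge_cut_left hd he' hc hu,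
    cost_congr hd fun u hu => he.merge_cut_right hd he' hc hu]

theorem EntryOk.deg_merge (he : d.EntryOk e) (he' : d.EntryOk e') (hc : d.compat e e' = true)
    (v : ℕ) : d.deg (get0 (d.merge e e').1) v = d.deg (get0 e.1) v + d.deg (get0 e'.1) v := by
  rw [get0_merge_fst he.len_S he'.len_S, deg_add (he.disj hc)]

theorem inV_add {S T : ℕ → ℕ} {v : ℕ} :
    d.inV (fun i => S i + T i) v = true ↔ d.inV S v = true ∨ d.inV T v = true := by
  simp only [inV_iff]
  constructor
  · rintro ⟨i, hi, h, hb⟩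
    rcases Nat.eq_zero_or_pos (S i) with h0 | h0
    · exact Or.inr ⟨i, hi, by omega, hb⟩
    · exact Or.inl ⟨i, hi, h0, hb⟩
  · rintro (⟨i, hi, h, hb⟩ | ⟨i, hi, h, hb⟩) <;> exact ⟨i, hi, by omega, hb⟩

theorem EntryOk.merge (hd : d.Valid) (he : d.EntryOk e) (he' : d.EntryOk e')
    (hc : d.compat e e' = true) (hg : d.good (d.merge e e') = true) :
    d.EntryOk (d.merge e e') where
  len_S := length_vec _ _
  len_x := length_vec _ _
  len_k := length_vec _ _
  S_le i := by
    rw [get0_merge_fst he.len_S he'.len_S]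
    have h1 := he.S_le i
    have h2 := he'.S_le i
    have := he.disj hc i
    beta_reduce
    omega
  x_le v := by
    rw [get0_merge_cut he.len_x he'.len_x]
    split_ifs
    · exact he'.x_le v
    · exact he.x_le v
  x_out v hv := by
    rw [get0_merge_fst he.len_S he'.len_S, ne_eq, inV_add, not_or] at hv
    rw [get0_merge_cut he.len_x he'.len_x, he.x_out v hv.1, he'.x_out v hv.2]
    simp
  k_le v := by
    simp only [Data.merge, get0_vec]
    split_ifs
    · refine Nat.div_le_of_le_mul ?_
      have h1 := Nat.mul_le_mul_right (d.deg (get0 e.1) v) (he.k_le v)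
      have h2 := Nat.mul_le_mul_right (d.deg (get0 e'.1) v) (he'.k_le v)
      nlinarith
    · omega
  k_mul v := by
    rw [he.deg_merge he' hc, he.cr_merge hd he' hc, mul_add d.q]
    refine le_trans ?_ (Nat.add_le_add (he.k_mul v) (he'.k_mul v))
    simp only [Data.merge, get0_vec]
    split_ifs
    · exact Nat.div_mul_le_self _ _
    · simp
  isGood := hg

end Merge

theorem mem_assign {n : ℕ} {l : List ℕ} {x : List ℕ} (h : x ∈ assign n l) :
    x.length = n ∧ (∀ v, get0 x v ≤ 1) ∧ ∀ v ∉ l, get0 x v = 0 := by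
  induction l using List.reverseRecOn generalizing x with
  | nil =>
    obtain rfl : x = vec n fun _ => 0 := by simpa [assign] using h
    exact ⟨length_vec _ _, by simp [get0_vec], by simp [get0_vec]⟩
  | append_singleton l a ih =>
    simp only [assign, List.foldl_append, List.foldl_cons, List.foldl_nil] at h
    rcases List.mem_append.1 h with h | h
    · obtain ⟨h1, h2, h3⟩ := ih h
      exact ⟨h1, h2, fun v hv => h3 v fun hv' => hv (by simp [hv'])⟩
    · obtain ⟨y, hy, rfl⟩ := List.mem_map.1 h
      obtain ⟨h1, h2, h3⟩ := ih hy
      refine ⟨length_vec _ _, fun v => ?_, fun v hv => ?_⟩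
      · rw [get0_vec]
        split_ifs
        · exact le_rfl
        · exact h2 v
        · omega
      · simp only [List.mem_append, List.mem_singleton, not_or] at hv
        rw [get0_vec, if_neg hv.2, h3 v hv.1, ite_self]

theorem exists_mem_assign {n : ℕ} {l : List ℕ} (hl : ∀ v ∈ l, v < n) {σ : ℕ → ℕ}
    (hσ : ∀ v, σ v ≤ 1) : ∃ x ∈ assign n l, ∀ v, get0 x v = if v ∈ l then σ v else 0 := by
  induction l using List.reverseRecOn with
  | nil => exact ⟨vec n fun _ => 0, by simp [assign], by simp [get0_vec]⟩
  | append_singleton l a ih =>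
    obtain ⟨x, hx, h⟩ := ih fun v hv => hl v (by simp [hv])
    simp only [assign, List.foldl_append, List.foldl_cons, List.foldl_nil]
    rcases Nat.le_one_iff_eq_zero_or_eq_one.1 (hσ a) with h0 | h1
    · refine ⟨x, List.mem_append_left _ hx, fun v => ?_⟩
      rw [h]
      by_cases hva : v = a
      · simp [hva, h0]
      · simp [hva]
    · refine ⟨_, List.mem_append_right _ (List.mem_map.2 ⟨x, hx, rfl⟩), fun v => ?_⟩
      rw [get0_vec]
      by_cases hva : v = a
      · simp [hva, h1, hl a (by simp)]
      · simp only [hva, if_false, h, List.mem_append, List.mem_singleton, or_false]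
        split_ifs with h2 h3 h3
        · rfl
        · rfl
        · exact absurd (hl v (by simp [h3])) h2
        · rfl

theorem get0_single {i : ℕ} (hi : i < d.N) : get0 (d.single i) = ind {i} := by
  funext j
  simp only [single, get0_vec, ind, Finset.mem_singleton]
  split_ifs with h1 h2 h2 <;> first | rfl | omega

theorem inBag_iff {i v : ℕ} : d.inBag i v = true ↔ v ∈ d.bag i := by simp [inBag]

theorem inV_single {i v : ℕ} (hi : i < d.N) : d.inV (get0 (d.single i)) v = true ↔ v ∈ d.bag i := by
  rw [get0_single hi, inV_iff, ← inBag_iff]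
  constructor
  · rintro ⟨j, -, h, hb⟩
    obtain rfl : j = i := by simpa [ind_pos] using h
    exact hb
  · exact fun h => ⟨i, hi, by simp [ind_pos], h⟩

theorem EntryOk.leaf {i : ℕ} (hi : i < d.N) {x : List ℕ} (hx : x ∈ assign d.n (d.bag i))
    (hg : d.good (d.leaf i x) = true) : d.EntryOk (d.leaf i x) where
  len_S := length_vec _ _
  len_x := (mem_assign hx).1
  len_k := length_vec _ _
  S_le j := by
    simp only [Data.leaf, single, get0_vec]
    split_ifs <;> omega
  x_le := (mem_assign hx).2.1
  x_out v hv := (mem_assign hx).2.2 v fun h => hv ((inV_single hi).2 h)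
  k_le v := by
    simp only [Data.leaf, get0_vec]
    split_ifs
    · refine Nat.div_le_of_le_mul ?_
      rw [mul_comm]
      exact Nat.mul_le_mul_right _ (cr_le_deg _ _ _)
    · omega
  k_mul v := by
    simp only [Data.leaf]
    rw [get0_vec]
    split_ifs
    · exact Nat.div_mul_le_self _ _
    · simp
  isGood := hg

theorem entryOk_of_mem_leaves {e : Entry} (h : e ∈ d.leaves) : d.EntryOk e := by
  obtain ⟨h, hg⟩ := List.mem_filter.1 h
  obtain ⟨i, hi, h⟩ := List.mem_flatMap.1 h
  obtain ⟨x, hx, rfl⟩ := List.mem_map.1 h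
  exact .leaf (List.mem_range.1 hi) hx hg

theorem entryOk_of_mem_step (hd : d.Valid) {T : List Entry} (hT : ∀ e ∈ T, d.EntryOk e)
    {e : Entry} (h : e ∈ T ++ d.merges T) : d.EntryOk e := by
  rcases List.mem_append.1 h with h | h
  · exact hT e h
  · obtain ⟨h, hg⟩ := List.mem_filter.1 h
    obtain ⟨e₁, h₁, h⟩ := List.mem_flatMap.1 h
    obtain ⟨e₂, h₂, rfl⟩ := List.mem_map.1 h
    obtain ⟨h₂, hc⟩ := List.mem_filter.1 h₂
    exact (hT e₁ h₁).merge hd (hT e₂ h₂) hc hg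

theorem entryOk_of_mem_table (hd : d.Valid) {r : ℕ} {e : Entry} (h : e ∈ d.table r) :
    d.EntryOk e := by
  induction r generalizing e with
  | zero => exact entryOk_of_mem_leaves (mem_of_mem_prune h)
  | succ r ih =>
    rw [table_succ] at h
    exact entryOk_of_mem_step hd (fun e he => ih he) (mem_of_mem_prune h)

/-! #### Completeness -/

/-- Sets of nodes that arise from single nodes by at most `h - 1` rounds of disjoint unions. -/
inductive Der (d : Data) : Finset ℕ → ℕ → Prop
  | leaf (i : ℕ) : i < d.N → d.admissible (ind {i}) = true → Der d {i} 1
  | merge {F F' : Finset ℕ} {h : ℕ} : Der d F h → Der d F' h → Disjoint F F' →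
      d.admissible (ind (F ∪ F')) = true → Der d (F ∪ F') (h + 1)
  | succ {F : Finset ℕ} {h : ℕ} : Der d F h → Der d F (h + 1)

theorem Der.mono {F : Finset ℕ} {h h' : ℕ} (hF : d.Der F h) (hh : h ≤ h') : d.Der F h' := by
  induction hh with
  | refl => exact hF
  | step _ ih => exact ih.succ

theorem Der.pos {F : Finset ℕ} {h : ℕ} (hF : d.Der F h) : 1 ≤ h := by
  induction hF <;> omega

/-- The table contains an entry for `F` that is no worse than the cut `σ`. -/
def Tracks (d : Data) (σ : ℕ → ℕ) (r : ℕ) (F : Finset ℕ) : Prop :=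
  ∃ e ∈ d.table r, get0 e.1 = ind F ∧
    -- Agreement with `σ` is demanded only on the boundary; elsewhere a cheaper cut may have taken
    -- over. The recorded fraction lags behind that of `σ` by at most r + 1 units: one for the leaf
    -- and one for each round.
    (∀ v, d.inB (ind F) v = true → get0 e.2.1 v = σ v ∧
      d.q * d.cr (ind F) σ v ≤ (get0 e.2.2 v + (r + 1)) * d.deg (ind F) v) ∧
    d.cost (ind F) (get0 e.2.1) ≤ d.cost (ind F) σ

/-- At least half of the weighted degree of every vertex crosses the cut. -/
def Stable (d : Data) (σ : ℕ → ℕ) : Prop :=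
  (∀ v, σ v ≤ 1) ∧ ∀ v, rsum d.n (fun u => d.wt v u) ≤
    2 * rsum d.n fun u => if σ u = σ v then 0 else d.wt v u

theorem lt_n_of_inB (hd : d.Valid) {S : ℕ → ℕ} {v : ℕ} (h : d.inB S v = true) : v < d.n := by
  obtain ⟨i, -, -, hi⟩ := inV_iff.1 (inB_iff.1 h).1
  exact hd.lt_n i v hi

/-- Entries that are as good as `σ` survive pruning. -/
theorem tracks_of_mem (hd : d.Valid) {σ : ℕ → ℕ} {r : ℕ} {F : Finset ℕ} {T : List Entry}
    (hT : d.table r = d.prune T) (hok : ∀ e ∈ T, d.EntryOk e) {e : Entry} (he : e ∈ T)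
    (hS : get0 e.1 = ind F)
    (hB : ∀ v, d.inB (ind F) v = true → get0 e.2.1 v = σ v ∧
      d.q * d.cr (ind F) σ v ≤ (get0 e.2.2 v + (r + 1)) * d.deg (ind F) v)
    (hc : d.cost (ind F) (get0 e.2.1) ≤ d.cost (ind F) σ) : d.Tracks σ r F := by
  obtain ⟨e', he', hk, hle⟩ := exists_mem_prune (d := d) he
  have hok' := hok e' (mem_of_mem_prune he')
  obtain ⟨h1, h2⟩ := sameKey_iff.1 hk
  have hS' : get0 e'.1 = ind F := by
    rw [← hS]
    funext i
    by_cases hi : i < d.N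
    · exact (h1 i hi).symm
    · rw [get0_of_length_le (by rw [hok'.len_S]; omega),
        get0_of_length_le (by rw [(hok e he).len_S]; omega)]
  refine ⟨e', hT ▸ he', hS', fun v hv => ?_, ?_⟩
  · obtain ⟨h3, h4⟩ := h2 v (lt_n_of_inB hd hv) (by rwa [hS])
    rw [← h3, ← h4]
    exact hB v hv
  · rw [hS, hS'] at hle
    exact hle.trans hc

/-- At an interior vertex the quantities inside `S` are those of the whole graph, so stability of
`σ` applies and the error of k is within the slack of the test. A vertex in no bag of `S` has degree
0. -/
theorem stable_settled (hd : d.Valid) {σ : ℕ → ℕ} (hσ : d.Stable σ) {S k : ℕ → ℕ} {v : ℕ}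
    (hB : d.inB S v ≠ true)
    (h : d.q * d.cr S σ v ≤ (k v + (d.R + 1)) * d.deg S v) :
    d.q * d.deg S v ≤ 2 * (k v + (d.R + 1)) * d.deg S v := by
  by_cases hV : d.inV S v = true
  · have ho : d.outV S v ≠ true := fun ho => hB (inB_iff.2 ⟨hV, ho⟩)
    have h1 : d.deg S v = rsum d.n (fun u => d.wt v u) := rsum_congr fun u => ow_eq_wt hd ho u
    have h2 : d.cr S σ v = rsum d.n fun u => if σ u = σ v then 0 else d.wt v u :=
      rsum_congr fun u => by rw [ow_eq_wt hd ho u]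
    have h3 := hσ.2 v
    rw [← h1, ← h2] at h3
    calc d.q * d.deg S v ≤ d.q * (2 * d.cr S σ v) := Nat.mul_le_mul_left _ h3
      _ = 2 * (d.q * d.cr S σ v) := by ring
      _ ≤ 2 * ((k v + (d.R + 1)) * d.deg S v) := Nat.mul_le_mul_left _ h
      _ = _ := by ring
  · simp [deg_eq_zero hd hV]

theorem tracks_leaf (hd : d.Valid) {σ : ℕ → ℕ} (hσ : d.Stable σ) {i : ℕ} (hi : i < d.N)
    (ha : d.admissible (ind {i}) = true) : d.Tracks σ 0 {i} := by
  obtain ⟨x, hx, hxv⟩ := exists_mem_assign (n := d.n) (l := d.bag i)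
    (fun v hv => hd.lt_n i v (inBag_iff.2 hv)) hσ.1
  have hagree : ∀ v, d.inV (ind {i}) v = true → get0 x v = σ v := fun v hv => by
    rw [← get0_single hi, inV_single hi] at hv
    rw [hxv, if_pos hv]
  have hS : get0 (d.leaf i x).1 = ind {i} := get0_single hi
  have hk : ∀ v < d.n, d.q * d.cr (ind {i}) σ v ≤
      (get0 (d.leaf i x).2.2 v + 1) * d.deg (ind {i}) v := fun v hv => by
    simp only [leaf, get0_vec, if_pos hv, get0_single hi]
    rw [cr_congr hd hagree, add_mul, one_mul]
    rcases Nat.eq_zero_or_pos (d.deg (ind {i}) v) with h0 | h0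
    · have := cr_le_deg (d := d) (ind {i}) σ v
      have h1 : d.cr (ind {i}) σ v = 0 := by omega
      simp [h0, h1]
    -- Rounding the quotient down loses less than one unit.
    · exact (Nat.lt_div_mul_add h0).le
  have hgood : d.good (d.leaf i x) = true := by
    refine good_iff.2 ⟨by rwa [hS], settled_iff.2 fun v hv => ?_⟩
    rw [hS]
    by_cases hB : d.inB (ind {i}) v = true
    · exact Or.inl hB
    · refine Or.inr (stable_settled hd hσ hB ((hk v hv).trans (Nat.mul_le_mul_right _ ?_)))
      omega
  refine tracks_of_mem hd (T := d.leaves) rfl (fun e => entryOk_of_mem_leaves)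
    (e := d.leaf i x) ?_ hS ?_ (cost_congr hd hagree).le
  · exact List.mem_filter.2 ⟨List.mem_flatMap.2 ⟨i, List.mem_range.2 hi,
      List.mem_map.2 ⟨x, hx, rfl⟩⟩, hgood⟩
  · exact fun v hv => ⟨hagree v (inB_iff.1 hv).1, hk v (lt_n_of_inB hd hv)⟩

theorem ind_union {F F' : Finset ℕ} (h : Disjoint F F') :
    ind (F ∪ F') = fun i => ind F i + ind F' i := by
  funext i
  have h1 : i ∈ F → i ∉ F' := fun h2 => Finset.disjoint_left.1 h h2
  simp only [ind, Finset.mem_union]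
  by_cases hF : i ∈ F
  · simp [hF, h1 hF]
  · simp [hF]

/-- A vertex shared by two disjoint sets is a boundary vertex of each. Entries that follow `σ` on
their boundaries are therefore compatible. -/
theorem inB_of_mem_both {F F' : Finset ℕ} (h : Disjoint F F') {v : ℕ}
    (hv : d.inV (ind F) v = true) (hv' : d.inV (ind F') v = true) : d.inB (ind F) v = true := by
  obtain ⟨i, hi, h1, h2⟩ := inV_iff.1 hv'
  exact inB_iff.2 ⟨hv, outV_iff.2 ⟨i, hi, ind_eq_zero.2 fun h3 =>
    Finset.disjoint_left.1 h h3 (ind_pos.1 h1), h2⟩⟩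

theorem inB_of_inB_union {F F' : Finset ℕ} {v : ℕ} (h : d.inB (ind (F ∪ F')) v = true)
    (hv : d.inV (ind F) v = true) : d.inB (ind F) v = true := by
  obtain ⟨i, hi, h1, h2⟩ := outV_iff.1 (inB_iff.1 h).2
  refine inB_iff.2 ⟨hv, outV_iff.2 ⟨i, hi, ?_, h2⟩⟩
  rw [ind_eq_zero] at *
  exact fun h3 => h1 (Finset.mem_union_left _ h3)

/-- The entries for the two parts are compatible, and their merge has the right boundary values and
cost by additivity. The point is that it passes the test at the vertices that are no longer on the
boundary. -/
theorem tracks_merge (hd : d.Valid) {σ : ℕ → ℕ} (hσ : d.Stable σ) {F F' : Finset ℕ} {r : ℕ}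
    (h : d.Tracks σ r F) (h' : d.Tracks σ r F') (hdis : Disjoint F F')
    (ha : d.admissible (ind (F ∪ F')) = true) (hr : r + 1 ≤ d.R) : d.Tracks σ (r + 1) (F ∪ F') := by
  obtain ⟨e, he, hS, hB, hcost⟩ := h
  obtain ⟨e', he', hS', hB', hcost'⟩ := h'
  have hok := entryOk_of_mem_table hd he
  have hok' := entryOk_of_mem_table hd he'
  have hc : d.compat e e' = true := by
    refine compat_iff.2 ⟨fun i _ => ?_, fun v _ hv hv' => ?_⟩
    · rw [hS, hS', ind_eq_zero, ind_eq_zero, ← not_and_or]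
      exact fun ⟨h1, h2⟩ => Finset.disjoint_left.1 hdis h1 h2
    · rw [hS] at hv
      rw [hS'] at hv'
      rw [(hB v (inB_of_mem_both hdis hv hv')).1, (hB' v (inB_of_mem_both hdis.symm hv' hv)).1]
  have hM : get0 (d.merge e e').1 = ind (F ∪ F') := by
    rw [get0_merge_fst hok.len_S hok'.len_S, ind_union hdis, hS, hS']
  have hdeg : ∀ v, d.deg (ind (F ∪ F')) v = d.deg (ind F) v + d.deg (ind F') v := fun v => by
    rw [← hM, hok.deg_merge hok' hc, hS, hS']
  have hcr : ∀ v, d.cr (ind (F ∪ F')) σ v = d.cr (ind F) σ v + d.cr (ind F') σ v := fun v => by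
    rw [ind_union hdis, cr_add]
    intro i
    rw [← hS, ← hS']
    exact hok.disj hc i
  have hcr0 : ∀ {G : Finset ℕ} {v : ℕ}, d.inV (ind G) v ≠ true →
      d.deg (ind G) v = 0 ∧ d.cr (ind G) σ v = 0 := fun {G v} hv => by
    have h1 := deg_eq_zero hd hv
    have h2 := cr_le_deg (d := d) (ind G) σ v
    omega
  have hk : ∀ v < d.n, get0 (d.merge e e').2.2 v =
      (get0 e.2.2 v * d.deg (ind F) v + get0 e'.2.2 v * d.deg (ind F') v) /
        (d.deg (ind F) v + d.deg (ind F') v) := fun v hv => by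
    simp only [merge, get0_vec, if_pos hv, hS, hS']
  -- The two lags, each at most r + 1 units, are averaged with the degrees as weights, and rounding
  -- down adds less than one unit.
  have happrox : ∀ v < d.n, (d.inV (ind F) v = true → d.inB (ind F) v = true) →
      (d.inV (ind F') v = true → d.inB (ind F') v = true) → d.q * d.cr (ind (F ∪ F')) σ v ≤
        (get0 (d.merge e e').2.2 v + (r + 1 + 1)) * d.deg (ind (F ∪ F')) v := by
    intro v hv h1 h2
    have e1 : d.q * d.cr (ind F) σ v ≤ (get0 e.2.2 v + (r + 1)) * d.deg (ind F) v := by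
      by_cases hV : d.inV (ind F) v = true
      · exact (hB v (h1 hV)).2
      · simp [hcr0 hV]
    have e2 : d.q * d.cr (ind F') σ v ≤ (get0 e'.2.2 v + (r + 1)) * d.deg (ind F') v := by
      by_cases hV : d.inV (ind F') v = true
      · exact (hB' v (h2 hV)).2
      · simp [hcr0 hV]
    rw [hk v hv, hdeg, hcr]
    set D := d.deg (ind F) v
    set D' := d.deg (ind F') v
    rcases Nat.eq_zero_or_pos (D + D') with h0 | h0
    · have hD : D = 0 := by omega
      have hD' : D' = 0 := by omega
      rw [hD] at e1
      rw [hD'] at e2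
      rw [h0]
      nlinarith
    · have := Nat.lt_div_mul_add h0 (a := get0 e.2.2 v * D + get0 e'.2.2 v * D')
      nlinarith
  have hgood : d.good (d.merge e e') = true := by
    refine good_iff.2 ⟨by rwa [hM], settled_iff.2 fun v hv => ?_⟩
    rw [hM]
    by_cases hBv : d.inB (ind (F ∪ F')) v = true
    · exact Or.inl hBv
    refine Or.inr ?_
    -- A vertex already interior to one part need not follow `σ` any more, but it has no weight in
    -- the other part. The average then returns its old fraction, so the test it has passed before
    -- is passed again.
    have hinner : ∀ {G G' : Finset ℕ} {a a' : Entry}, Disjoint G G' → d.EntryOk a →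
        get0 a.1 = ind G → d.inV (ind G) v = true → d.inB (ind G) v ≠ true →
        (get0 a.2.2 v * d.deg (ind G) v) / d.deg (ind G) v = get0 (d.merge e e').2.2 v →
        d.q * d.deg (ind G) v ≤ 2 * (get0 (d.merge e e').2.2 v + (d.R + 1)) * d.deg (ind G) v := by
      intro G G' a a' hGG ha1 ha2 hV hnB hkk
      rcases Nat.eq_zero_or_pos (d.deg (ind G) v) with h0 | h0
      · simp [h0]
      · rw [← hkk, Nat.mul_div_cancel _ h0]
        have := settled_iff.1 (good_iff.1 ha1.isGood).2 v hv
        rw [ha2] at this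
        exact this.resolve_left hnB
    by_cases h1 : d.inV (ind F) v = true → d.inB (ind F) v = true
    · by_cases h2 : d.inV (ind F') v = true → d.inB (ind F') v = true
      · refine stable_settled hd hσ hBv ((happrox v hv h1 h2).trans (Nat.mul_le_mul_right _ ?_))
        omega
      · push Not at h2
        have hV : d.inV (ind F) v ≠ true := fun hV => h2.2 (inB_of_mem_both hdis.symm h2.1 hV)
        rw [hdeg, (hcr0 hV).1, zero_add]
        refine hinner hdis.symm hok' hS' h2.1 h2.2 ?_ (a' := e)
        rw [hk v hv, (hcr0 hV).1]
        simp
    · push Not at h1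
      have hV : d.inV (ind F') v ≠ true := fun hV => h1.2 (inB_of_mem_both hdis h1.1 hV)
      rw [hdeg, (hcr0 hV).1, add_zero]
      refine hinner hdis hok hS h1.1 h1.2 ?_ (a' := e)
      rw [hk v hv, (hcr0 hV).1]
      simp
  refine tracks_of_mem hd (T := d.table r ++ d.merges (d.table r)) (table_succ r)
    (fun a ha => entryOk_of_mem_step hd (fun a ha => entryOk_of_mem_table hd ha) ha)
    (e := d.merge e e') ?_ hM ?_ ?_
  · exact List.mem_append_right _ (List.mem_filter.2 ⟨List.mem_flatMap.2 ⟨e, he,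
      List.mem_map.2 ⟨e', List.mem_filter.2 ⟨he', hc⟩, rfl⟩⟩, hgood⟩)
  · intro v hv
    have h1 : d.inV (ind F) v = true → d.inB (ind F) v = true := inB_of_inB_union hv
    have h2 : d.inV (ind F') v = true → d.inB (ind F') v = true :=
      inB_of_inB_union (by rwa [Finset.union_comm])
    refine ⟨?_, happrox v (lt_n_of_inB hd hv) h1 h2⟩
    have hV := (inB_iff.1 hv).1
    rw [ind_union hdis, inV_add] at hV
    rcases hV with hV | hV
    · rw [hok.merge_cut_left hd hok' hc (by rwa [hS])]
      exact (hB v (h1 hV)).1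
    · rw [hok.merge_cut_right hd hok' hc (by rwa [hS'])]
      exact (hB' v (h2 hV)).1
  · have h1 := hok.cost_merge hd hok' hc
    rw [hM, hS, hS'] at h1
    rw [h1, ind_union hdis, cost_add]
    · exact Nat.add_le_add hcost hcost'
    · intro i
      rw [← hS, ← hS']
      exact hok.disj hc i

theorem tracks_succ (hd : d.Valid) {σ : ℕ → ℕ} {F : Finset ℕ} {r : ℕ} (h : d.Tracks σ r F) :
    d.Tracks σ (r + 1) F := by
  obtain ⟨e, he, hS, hB, hcost⟩ := h
  refine tracks_of_mem hd (T := d.table r ++ d.merges (d.table r)) (table_succ r)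
    (fun a ha => entryOk_of_mem_step hd (fun a ha => entryOk_of_mem_table hd ha) ha)
    (List.mem_append_left _ he) hS (fun v hv => ⟨(hB v hv).1, (hB v hv).2.trans ?_⟩) hcost
  exact Nat.mul_le_mul_right _ (by omega)

theorem Der.tracks (hd : d.Valid) {σ : ℕ → ℕ} (hσ : d.Stable σ) {F : Finset ℕ} {h : ℕ}
    (hF : d.Der F h) : ∀ r, h = r + 1 → r ≤ d.R → d.Tracks σ r F := by
  induction hF with
  | leaf i hi ha =>
    rintro r hr -
    obtain rfl : r = 0 := by omega
    exact tracks_leaf hd hσ hi ha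
  | @merge F F' h hF hF' hdis ha ih ih' =>
    intro r hr hR
    have := hF.pos
    obtain ⟨r, rfl⟩ : ∃ s, r = s + 1 := ⟨r - 1, by omega⟩
    exact tracks_merge hd hσ (ih r (by omega) (by omega)) (ih' r (by omega) (by omega)) hdis ha hR
  | @succ F h hF ih =>
    intro r hr hR
    have := hF.pos
    obtain ⟨r, rfl⟩ : ∃ s, r = s + 1 := ⟨r - 1, by omega⟩
    exact tracks_succ hd (ih r (by omega) (by omega))

/-- The weight of a cut. -/
def totalCost (d : Data) (x : ℕ → ℕ) : ℕ :=
  rsum d.n fun u => rsum d.n fun v =>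
    if (decide (x u = 0) && !decide (x v = 0)) = true then d.wt u v else 0

theorem ow_full (hd : d.Valid) {S : ℕ → ℕ} (hS : ∀ i < d.N, 0 < S i) (u v : ℕ) :
    d.ow S u v = d.wt u v :=
  ow_eq_wt hd (fun h => by
    obtain ⟨i, hi, h1, -⟩ := outV_iff.1 h
    have := hS i hi
    omega) v

/-- The cut that is returned is nearly stable and weighs no more than any stable cut. -/
theorem output_spec (hd : d.Valid) (hD : d.Der (Finset.range d.N) (d.R + 1)) {σ₀ : ℕ → ℕ}
    (hσ₀ : d.Stable σ₀) :
    d.output.length = d.n ∧ (∀ v, get0 d.output v ≤ 1) ∧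
    (∀ v < d.n, d.q * rsum d.n (fun u => d.wt v u) ≤
      2 * d.q * rsum d.n (fun u => if get0 d.output u = get0 d.output v then 0 else d.wt v u) +
        2 * (d.R + 1) * rsum d.n (fun u => d.wt v u)) ∧
    ∀ σ, d.Stable σ → d.totalCost (get0 d.output) ≤ d.totalCost σ := by
  set L := (d.table d.R).filter fun e => (List.range d.N).all fun i => decide (0 < get0 e.1 i)
    with hL
  have hmemL : ∀ {e}, e ∈ L ↔ e ∈ d.table d.R ∧ ∀ i < d.N, 0 < get0 e.1 i := by
    intro e; simp [hL]
  have hex : ∀ σ, d.Stable σ → ∃ e ∈ L, d.totalCost (get0 e.2.1) ≤ d.totalCost σ := by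
    intro σ hσ
    obtain ⟨e, he, hS, -, hc⟩ := hD.tracks hd hσ d.R rfl le_rfl
    have hpos : ∀ i < d.N, 0 < ind (Finset.range d.N) i := fun i hi =>
      ind_pos.2 (Finset.mem_range.2 hi)
    refine ⟨e, hmemL.2 ⟨he, by rwa [hS]⟩, ?_⟩
    have hcost : ∀ x, d.cost (ind (Finset.range d.N)) x = d.totalCost x := fun x =>
      rsum_congr fun u => rsum_congr fun v => by rw [ow_full hd hpos]
    rwa [hcost, hcost] at hc
  -- The set of all nodes has no boundary, so all its entries share one key and pruning leaves at
  -- most one.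
  have huniq : ∀ e ∈ L, ∀ e' ∈ L, e = e' := by
    intro e he e' he'
    obtain ⟨h1, h2⟩ := hmemL.1 he
    obtain ⟨h1', h2'⟩ := hmemL.1 he'
    by_contra hne
    have : Std.Symm fun e e' : Entry => d.sameKey e e' ≠ true :=
      ⟨fun a b h h' => h (sameKey_symm h')⟩
    refine (pairwise_table d.R).forall h1 h1' hne (sameKey_iff.2 ⟨fun i hi => ?_, fun v _ hv => ?_⟩)
    · have e1 := h2 i hi
      have e2 := h2' i hi
      have e3 := (entryOk_of_mem_table hd h1).S_le i
      have e4 := (entryOk_of_mem_table hd h1').S_le i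
      omega
    · obtain ⟨i, hi, h3, -⟩ := outV_iff.1 (inB_iff.1 hv).2
      have := h2 i hi
      omega
  -- One stable cut is needed to know that an entry for all nodes is present, so that the default
  -- value is not returned.
  obtain ⟨e, he, -⟩ := hex σ₀ hσ₀
  have hout : d.output = e.2.1 := by
    have hpos := List.length_pos_of_mem he
    have : L.getD 0 ([], [], []) ∈ L := by
      rw [List.getD_eq_getElem?_getD, List.getElem?_eq_getElem hpos]
      exact List.getElem_mem hpos
    unfold output
    rw [← hL, huniq _ this _ he]
  obtain ⟨h1, h2⟩ := hmemL.1 he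
  have hok := entryOk_of_mem_table hd h1
  rw [hout]
  refine ⟨hok.len_x, hok.x_le, fun v hv => ?_, fun σ hσ => ?_⟩
  · have h3 := settled_iff.1 (good_iff.1 hok.isGood).2 v hv
    have h4 : d.inB (get0 e.1) v ≠ true := fun hB => by
      obtain ⟨i, hi, h3, -⟩ := outV_iff.1 (inB_iff.1 hB).2
      have := h2 i hi
      omega
    have h5 := h3.resolve_left h4
    have h6 := hok.k_mul v
    have h7 : d.deg (get0 e.1) v = rsum d.n (fun u => d.wt v u) :=
      rsum_congr fun u => ow_full hd h2 v u
    have h8 : d.cr (get0 e.1) (get0 e.2.1) v =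
        rsum d.n (fun u => if get0 e.2.1 u = get0 e.2.1 v then 0 else d.wt v u) :=
      rsum_congr fun u => by rw [ow_full hd h2]
    rw [← h7, ← h8]
    -- From q·deg ≤ 2(k + R + 1)·deg, the test passed by `v`, and k·deg ≤ q·cr.
    nlinarith
  · obtain ⟨e', he', hc⟩ := hex σ hσ
    rwa [huniq e he e' he']

end Data

/-! ### Ordered trees and their preorder

An ordered rooted tree is given as a binary tree: the left subtree of a node consists of the
children of the node, the right subtree of its later siblings. -/

inductive BT
  | nil : BT
  | node : ℕ → BT → BT → BT

namespace BT

/-- The preorder of the nodes. -/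
def flat : BT → List ℕ
  | nil => []
  | node x l r => x :: (l.flat ++ r.flat)

/-- The pairs of a node and its parent; `p` is the parent of the topmost nodes. -/
def edges (p : ℕ) : BT → List (ℕ × ℕ)
  | nil => []
  | node x l r => (x, p) :: (edges x l ++ edges p r)

theorem mem_of_mem_edges {t : BT} {p a b : ℕ} (h : (a, b) ∈ t.edges p) :
    a ∈ t.flat ∧ (b = p ∨ b ∈ t.flat) := by
  induction t generalizing p with
  | nil => simp [edges] at h
  | node x l r ihl ihr =>
    simp only [edges, List.mem_cons, List.mem_append, Prod.mk.injEq] at h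
    simp only [flat, List.mem_cons, List.mem_append]
    rcases h with ⟨rfl, rfl⟩ | h | h
    · simp
    · have := ihl h; tauto
    · have := ihr h; tauto

/-- `Path s p fs s' p'`: the subtree `s'` of `s` is reached along the steps `fs`. Each step is given
by the node that is passed and the subtree that is left behind, with its parent. -/
inductive Path : BT → ℕ → List (ℕ × BT × ℕ) → BT → ℕ → Prop
  | refl (s : BT) (p : ℕ) : Path s p [] s p
  | left {x p p' : ℕ} {l r s' : BT} {fs : List (ℕ × BT × ℕ)} :
      Path l x fs s' p' → Path (node x l r) p ((x, r, p) :: fs) s' p'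
  | right {x p p' : ℕ} {l r s' : BT} {fs : List (ℕ × BT × ℕ)} :
      Path r p fs s' p' → Path (node x l r) p ((x, l, x) :: fs) s' p'

theorem Path.split {s s'' : BT} {p p'' : ℕ} {fs fs' : List (ℕ × BT × ℕ)}
    (h : Path s p (fs ++ fs') s'' p'') : ∃ s' p', Path s p fs s' p' ∧ Path s' p' fs' s'' p'' := by
  induction fs generalizing s p with
  | nil => exact ⟨s, p, .refl s p, h⟩
  | cons f fs ih =>
    cases h with
    | left h =>
      obtain ⟨s', p', h1, h2⟩ := ih h
      exact ⟨s', p', h1.left, h2⟩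
    | right h =>
      obtain ⟨s', p', h1, h2⟩ := ih h
      exact ⟨s', p', h1.right, h2⟩

theorem Path.subset {s s' : BT} {p p' : ℕ} {fs : List (ℕ × BT × ℕ)} (h : Path s p fs s' p') :
    ∀ a ∈ s'.flat, a ∈ s.flat := by
  induction h with
  | refl => exact fun a h => h
  | left _ ih => intro a ha; simp [flat, ih a ha]
  | right _ ih => intro a ha; simp [flat, ih a ha]

/-- The path into the larger subtrees: what is left behind is small. -/
theorem exists_heavy_path (t : BT) (p : ℕ) : ∃ fs p', Path t p fs nil p' ∧
    fs.length ≤ t.flat.length ∧ ∀ f ∈ fs, 2 * f.2.1.flat.length + 1 ≤ t.flat.length := by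
  induction t generalizing p with
  | nil => exact ⟨[], p, .refl _ _, by simp, by simp⟩
  | node x l r ihl ihr =>
    simp only [flat, List.length_cons, List.length_append]
    rcases le_total r.flat.length l.flat.length with h | h
    · obtain ⟨fs, p', h1, h2, h3⟩ := ihl x
      refine ⟨_, p', h1.left, by simp; omega, fun f hf => ?_⟩
      rcases List.mem_cons.1 hf with rfl | hf
      · simp only; omega
      · have := h3 f hf; omega
    · obtain ⟨fs, p', h1, h2, h3⟩ := ihr p
      refine ⟨_, p', h1.right, by simp; omega, fun f hf => ?_⟩
      rcases List.mem_cons.1 hf with rfl | hf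
      · simp only; omega
      · have := h3 f hf; omega

end BT

/-! ### Shallow derivations of the set of all nodes -/

namespace Data

variable {d : Data} {A : ℕ → ℕ → Prop}

/-- The ordering enumerates the nodes, and the bags form a tree decomposition with respect to the
adjacency relation `A` on the nodes. -/
structure Layout (d : Data) (A : ℕ → ℕ → Prop) : Prop where
  nodup : d.ord.Nodup
  mem_ord : ∀ i, i ∈ d.ord ↔ i < d.N
  symm : ∀ i j, A i j → A j i
  conn : ∀ (F : Finset ℕ) (v : ℕ), d.inB (ind F) v = true →
    ∃ a ∈ F, ∃ b ∉ F, A a b ∧ v ∈ d.bag a ∧ v ∈ d.bag b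
  bag_le : ∀ i, (d.bag i).length ≤ d.b

/-- `s` is a block of the ordered tree whose only outside neighbour is `p`. -/
structure Block (d : Data) (A : ℕ → ℕ → Prop) (s : BT) (p : ℕ) : Prop where
  infix_ord : ∃ u w, d.ord = u ++ s.flat ++ w
  cov : ∀ a ∈ s.flat, ∀ b, A a b → (a, b) ∈ s.edges p ∨ (b, a) ∈ s.edges p
  notMem : p ∉ s.flat

theorem Layout.length_ord (hL : d.Layout A) : d.ord.length = d.N := by
  have : d.ord.toFinset = Finset.range d.N := by
    ext i; simp [hL.mem_ord]
  rw [← List.toFinset_card_of_nodup hL.nodup, this, Finset.card_range]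

theorem Layout.get0_mem_iff (hL : d.Layout A) {u X w : List ℕ} (h : d.ord = u ++ X ++ w) {i : ℕ}
    (hi : i < d.N) : get0 d.ord i ∈ X ↔ u.length ≤ i ∧ i < u.length + X.length := by
  have hnd := hL.nodup
  have hlen := hL.length_ord
  rw [h] at hnd hlen
  simp only [List.length_append] at hlen
  have hget : get0 d.ord i = (u ++ X ++ w)[i]'(by simp; omega) := by
    unfold get0
    rw [h, List.getD_eq_getElem?_getD, List.getElem?_eq_getElem (by simp; omega)]
    rfl
  rw [hget]
  constructor
  · intro hmem
    obtain ⟨j, hj, hj'⟩ := List.getElem_of_mem hmem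
    have h1 : (u ++ X ++ w)[u.length + j]'(by simp; omega) = X[j] := by
      rw [List.getElem_append_left (by simp; omega), List.getElem_append_right (by omega)]
      simp
    rw [← h1] at hj'
    have := (hnd.getElem_inj_iff).1 hj'
    omega
  · rintro ⟨h1, h2⟩
    rw [List.getElem_append_left (by simp; omega), List.getElem_append_right (by omega)]
    exact List.getElem_mem _

theorem Layout.shape_sdiff (hL : d.Layout A) {X Y : List ℕ} (hX : ∃ u w, d.ord = u ++ X ++ w)
    (hY : ∃ u w, d.ord = u ++ Y ++ w) : d.shape (ind (X.toFinset \ Y.toFinset)) = true := by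
  obtain ⟨u, w, hX⟩ := hX
  obtain ⟨u', w', hY⟩ := hY
  have h1 := congrArg List.length hX
  have h2 := congrArg List.length hY
  simp only [List.length_append, hL.length_ord] at h1 h2
  simp only [shape, List.any_eq_true, List.all_eq_true, List.mem_range]
  refine ⟨u.length, by omega, u.length + X.length, by omega, u'.length, by omega,
    u'.length + Y.length, by omega, fun i hi => ?_⟩
  rw [beq_iff_eq, Bool.eq_iff_iff]
  simp only [ind_pos, decide_eq_true_eq, Finset.mem_sdiff, List.mem_toFinset,
    hL.get0_mem_iff hX hi, hL.get0_mem_iff hY hi, Bool.and_eq_true, Bool.not_eq_true',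
    ← Bool.not_eq_true]

theorem Layout.bcount_le (hL : d.Layout A) {S : ℕ → ℕ} {p p' : ℕ}
    (h : ∀ v, d.inB S v = true → v ∈ d.bag p ∨ v ∈ d.bag p') : d.bcount S ≤ 2 * d.b := by
  have h1 := hL.bag_le p
  have h2 := hL.bag_le p'
  have h3 : ((List.range d.n).filter fun v => d.inB S v).toFinset ⊆
      (d.bag p ++ d.bag p').toFinset := fun v hv => by
    simp only [List.mem_toFinset, List.mem_filter, List.mem_append] at *
    exact h v hv.2
  have h4 := (Finset.card_le_card h3).trans (List.toFinset_card_le _)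
  rw [List.toFinset_card_of_nodup (List.nodup_range.filter _), List.length_append] at h4
  unfold bcount
  omega

theorem Block.lt (hL : d.Layout A) {s : BT} {p a : ℕ} (h : d.Block A s p) (ha : a ∈ s.flat) :
    a < d.N := by
  obtain ⟨u, w, h⟩ := h.infix_ord
  rw [← hL.mem_ord, h]
  simp [ha]

theorem Block.nodup (hL : d.Layout A) {s : BT} {p : ℕ} (h : d.Block A s p) : s.flat.Nodup := by
  obtain ⟨u, w, h⟩ := h.infix_ord
  have := hL.nodup
  rw [h] at this
  exact (List.nodup_append.1 (List.nodup_append.1 this).1).2.1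

theorem Block.eq_of_adj {s : BT} {p a b : ℕ} (h : d.Block A s p) (ha : a ∈ s.flat)
    (hb : b ∉ s.flat) (hab : A a b) : b = p := by
  rcases h.cov a ha b hab with h1 | h1
  · exact (BT.mem_of_mem_edges h1).2.resolve_right hb
  · exact absurd (BT.mem_of_mem_edges h1).1 hb

/-- A parent-child pair that involves a node of `l` cannot be the pair of `x` and `p` or a pair
recorded for `r`, because the preorder has no repetitions and `p` lies outside the block. It is
therefore recorded for `l`, with `x` as the parent of the topmost nodes. -/
theorem Block.left (hL : d.Layout A) {x p : ℕ} {l r : BT} (h : d.Block A (.node x l r) p) :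
    d.Block A l x := by
  have hnd := h.nodup hL
  simp only [BT.flat, List.nodup_cons, List.mem_append, not_or] at hnd
  have hdis := (List.nodup_append.1 hnd.2).2.2
  have hp := h.notMem
  simp only [BT.flat, List.mem_cons, List.mem_append, not_or] at hp
  obtain ⟨u, w, hu⟩ := h.infix_ord
  refine ⟨⟨u ++ [x], r.flat ++ w, by simp [hu, BT.flat]⟩, fun a ha b hab => ?_, hnd.1.1⟩
  rcases h.cov a (by simp [BT.flat, ha]) b hab with h1 | h1 <;>
    simp only [BT.edges, List.mem_cons, List.mem_append, Prod.mk.injEq] at h1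
  · rcases h1 with ⟨rfl, -⟩ | h1 | h1
    · exact absurd ha hnd.1.1
    · exact Or.inl h1
    · exact absurd rfl (hdis a ha a (BT.mem_of_mem_edges h1).1)
  · rcases h1 with ⟨-, rfl⟩ | h1 | h1
    · exact absurd ha hp.2.1
    · exact Or.inr h1
    · rcases (BT.mem_of_mem_edges h1).2 with rfl | h2
      · exact absurd ha hp.2.1
      · exact absurd rfl (hdis a ha a h2)

theorem Block.right (hL : d.Layout A) {x p : ℕ} {l r : BT} (h : d.Block A (.node x l r) p) :
    d.Block A r p := by
  have hnd := h.nodup hL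
  simp only [BT.flat, List.nodup_cons, List.mem_append, not_or] at hnd
  have hdis := (List.nodup_append.1 hnd.2).2.2
  have hp := h.notMem
  simp only [BT.flat, List.mem_cons, List.mem_append, not_or] at hp
  obtain ⟨u, w, hu⟩ := h.infix_ord
  refine ⟨⟨u ++ x :: l.flat, w, by simp [hu, BT.flat]⟩, fun a ha b hab => ?_, hp.2.2⟩
  rcases h.cov a (by simp [BT.flat, ha]) b hab with h1 | h1 <;>
    simp only [BT.edges, List.mem_cons, List.mem_append, Prod.mk.injEq] at h1
  · rcases h1 with ⟨rfl, -⟩ | h1 | h1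
    · exact absurd ha hnd.1.2
    · exact absurd rfl (hdis a (BT.mem_of_mem_edges h1).1 a ha)
    · exact Or.inl h1
  · rcases h1 with ⟨-, rfl⟩ | h1 | h1
    · exact absurd ha hp.2.2
    · rcases (BT.mem_of_mem_edges h1).2 with rfl | h2
      · exact absurd ha hnd.1.2
      · exact absurd rfl (hdis a h2 a ha)
    · exact Or.inr h1

theorem Block.path (hL : d.Layout A) {s s' : BT} {p p' : ℕ} {fs : List (ℕ × BT × ℕ)}
    (h : BT.Path s p fs s' p') (hs : d.Block A s p) :
    d.Block A s' p' ∧ ∀ f ∈ fs, d.Block A f.2.1 f.2.2 := by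
  induction h with
  | refl => exact ⟨hs, by simp⟩
  | left _ ih =>
    obtain ⟨h1, h2⟩ := ih (hs.left hL)
    exact ⟨h1, fun f hf => (List.mem_cons.1 hf).elim (fun h => h ▸ hs.right hL) (h2 f)⟩
  | right _ ih =>
    obtain ⟨h1, h2⟩ := ih (hs.right hL)
    exact ⟨h1, fun f hf => (List.mem_cons.1 hf).elim (fun h => h ▸ hs.left hL) (h2 f)⟩

/-- The nodes of `s` outside `s'`. -/
def between (s s' : BT) : Finset ℕ := s.flat.toFinset \ s'.flat.toFinset

/-- A boundary vertex lies in the bags of both ends of a tree edge that leaves the set. If this edge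
leaves `s`, its outer end is `p`; if it enters `s'`, its end outside `s'` is `p'`. So two bags cover
the boundary. -/
theorem admissible_between (hL : d.Layout A) {s s' : BT} {p p' : ℕ} (hs : d.Block A s p)
    (hs' : d.Block A s' p') : d.admissible (ind (between s s')) = true := by
  simp only [admissible, Bool.and_eq_true, decide_eq_true_eq]
  refine ⟨hL.shape_sdiff hs.infix_ord hs'.infix_ord,
    hL.bcount_le (p := p) (p' := p') fun v hv => ?_⟩
  obtain ⟨a, ha, b, hb, hab, hva, hvb⟩ := hL.conn _ v hv
  simp only [between, Finset.mem_sdiff, List.mem_toFinset, not_and, not_not] at ha hb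
  by_cases h : b ∈ s.flat
  · rw [← hs'.eq_of_adj (hb h) ha.2 (hL.symm _ _ hab)]
    exact Or.inr hva
  · rw [← hs.eq_of_adj ha.1 h hab]
    exact Or.inl hvb

theorem der_single (hL : d.Layout A) {i : ℕ} (hi : i < d.N) : d.Der {i} 1 := by
  refine .leaf i hi ?_
  simp only [admissible, Bool.and_eq_true, decide_eq_true_eq]
  constructor
  · obtain ⟨u, w, h⟩ := List.append_of_mem ((hL.mem_ord i).2 hi)
    have := hL.shape_sdiff (X := [i]) (Y := []) ⟨u, w, by simp [h]⟩ ⟨[], d.ord, by simp⟩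
    simpa using this
  · refine hL.bcount_le (p := i) (p' := i) fun v hv => ?_
    obtain ⟨a, ha, b, -, -, hva, -⟩ := hL.conn _ v hv
    rw [Finset.mem_singleton.1 ha] at hva
    exact Or.inl hva

/-- The pieces along a path are joined in a balanced fashion: a path of length at most 2^j is cut in
two, and each of the j halvings costs one round. All sets that occur are differences of nested
subtrees, hence admissible. -/
theorem der_between (hL : d.Layout A) {h : ℕ} (hh : 1 ≤ h) (j : ℕ) {s s' : BT} {p p' : ℕ}
    {fs : List (ℕ × BT × ℕ)} (hpath : BT.Path s p fs s' p') (hs : d.Block A s p) (hne : fs ≠ [])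
    (hlen : fs.length ≤ 2 ^ j) (hder : ∀ f ∈ fs, f.2.1.flat ≠ [] → d.Der f.2.1.flat.toFinset h) :
    d.Der (between s s') (h + 1 + j) := by
  induction j generalizing s s' p p' fs with
  | zero =>
    have hadm := admissible_between hL hs (Block.path hL hpath hs).1
    obtain ⟨f, rfl⟩ : ∃ f, fs = [f] := by
      cases fs with
      | nil => exact absurd rfl hne
      | cons f fs => exact ⟨f, by cases fs with
        | nil => rfl
        | cons _ _ => simp at hlen⟩
    -- A single step contributes the node that is passed and the subtree left behind; if the latter
    -- is empty, the round is spent idly.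
    have key : f.1 ∈ s.flat → f.1 ∉ f.2.1.flat →
        between s s' = {f.1} ∪ f.2.1.flat.toFinset → d.Der (between s s') (h + 1 + 0) := by
      intro hmem hnotMem heq
      have h1 := (der_single hL (hs.lt hL hmem)).mono hh
      by_cases h2 : f.2.1.flat = []
      · rw [heq, h2]
        simpa using h1.succ
      · rw [heq] at hadm ⊢
        exact h1.merge (hder f (by simp) h2) (by simpa using hnotMem) hadm
    have hnd := hs.nodup hL
    cases hpath with
    | left hp =>
      cases hp
      simp only [BT.flat, List.nodup_cons, List.mem_append, not_or] at hnd
      have hdis := (List.nodup_append.1 hnd.2).2.2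
      refine key (by simp [BT.flat]) hnd.1.2 ?_
      ext a
      simp only [between, BT.flat, Finset.mem_sdiff, List.mem_toFinset, List.mem_cons,
        List.mem_append, Finset.mem_union, Finset.mem_singleton]
      constructor
      · tauto
      · rintro (rfl | h1)
        · tauto
        · exact ⟨by tauto, fun h2 => hdis a h2 a h1 rfl⟩
    | right hp =>
      cases hp
      simp only [BT.flat, List.nodup_cons, List.mem_append, not_or] at hnd
      have hdis := (List.nodup_append.1 hnd.2).2.2
      refine key (by simp [BT.flat]) hnd.1.1 ?_
      ext a
      simp only [between, BT.flat, Finset.mem_sdiff, List.mem_toFinset, List.mem_cons,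
        List.mem_append, Finset.mem_union, Finset.mem_singleton]
      constructor
      · tauto
      · rintro (rfl | h1)
        · tauto
        · exact ⟨by tauto, fun h2 => hdis a h1 a h2 rfl⟩
  | succ j ih =>
    by_cases hsmall : fs.length ≤ 2 ^ j
    · exact (ih hpath hs hne hsmall hder).succ
    -- Cut the path after 2^j steps, at the subtree `s₁`; the nodes between `s` and `s'` split into
    -- those before and those after `s₁`.
    · have hadm := admissible_between hL hs (Block.path hL hpath hs).1
      have hp := hpath
      rw [← List.take_append_drop (2 ^ j) fs] at hp
      obtain ⟨s₁, p₁, h1, h2⟩ := hp.split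
      have hs₁ := (Block.path hL h1 hs).1
      have hpos : 0 < 2 ^ j := by positivity
      have hl1 : (fs.take (2 ^ j)).length = 2 ^ j := by simp; omega
      have hl2 : (fs.drop (2 ^ j)).length = fs.length - 2 ^ j := by simp
      have d1 := ih h1 hs (fun h0 => by rw [h0] at hl1; simp at hl1; omega) hl1.le
        fun f hf => hder f (List.mem_of_mem_take hf)
      have d2 := ih h2 hs₁ (fun h0 => by rw [h0] at hl2; simp at hl2; omega)
        (by rw [hl2]; rw [pow_succ] at hlen; omega) fun f hf => hder f (List.mem_of_mem_drop hf)
      have heq : between s s' = between s s₁ ∪ between s₁ s' := by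
        have e1 := h1.subset
        have e2 := h2.subset
        ext a
        have e1 := e1 a
        have e2 := e2 a
        simp only [between, Finset.mem_sdiff, List.mem_toFinset, Finset.mem_union]
        tauto
      rw [heq] at hadm ⊢
      refine d1.merge d2 ?_ hadm
      rw [Finset.disjoint_left]
      intro a
      simp only [between, Finset.mem_sdiff, List.mem_toFinset]
      tauto

/-- The subtrees hanging off the heavy path have less than 2^k nodes if the tree has less than
2^(k+1). They are derived recursively, and the path, shorter than 2^K, costs K + 1 further rounds.
-/
theorem der_block (hL : d.Layout A) {K : ℕ} (hK : d.N < 2 ^ K) (k : ℕ) {t : BT} {p : ℕ}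
    (ht : d.Block A t p) (hne : t.flat ≠ []) (hlen : t.flat.length < 2 ^ k) :
    d.Der t.flat.toFinset (k * (K + 1) + 1) := by
  induction k generalizing t p with
  | zero => exact absurd (List.length_eq_zero_iff.1 (by simpa using hlen)) hne
  | succ k ih =>
    obtain ⟨fs, p', hpath, hfs, hsmall⟩ := t.exists_heavy_path p
    have hle : t.flat.length ≤ d.N := by
      obtain ⟨u, w, h⟩ := ht.infix_ord
      have := congrArg List.length h
      simp only [List.length_append, hL.length_ord] at this
      omega
    have h1 := der_between hL (h := k * (K + 1) + 1) (by omega) K hpath ht ?_ (by omega) ?_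
    · have h2 : between t .nil = t.flat.toFinset := by simp [between, BT.flat]
      rw [h2] at h1
      exact h1.mono (by ring_nf; omega)
    · rintro rfl
      cases hpath
      exact hne rfl
    · intro f hf hf'
      refine ih ((Block.path hL hpath ht).2 f hf) hf' ?_
      have := hsmall f hf
      rw [pow_succ] at hlen
      omega

end Data

/-! ### Depth-first orderings -/

/-- Insertion of `x` behind `y`. -/
def insAfter (y x : ℕ) (L : List ℕ) : List ℕ := L.flatMap fun z => if z = y then [z, x] else [z]

/-- The nodes outside `L` that are adjacent to a node of `L`, with this neighbour. -/
def fringe (nb : ℕ → List ℕ) (L : List ℕ) : List (ℕ × ℕ) :=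
  L.flatMap fun y => ((nb y).filter fun x => !L.any fun z => decide (z = x)).map fun x => (x, y)

/-- One step of the construction of the ordering: a new node is inserted behind its neighbour. -/
def grow (nb : ℕ → List ℕ) (L : List ℕ) : List ℕ :=
  if (fringe nb L).length = 0 then L
  else insAfter ((fringe nb L).getD 0 (0, 0)).2 ((fringe nb L).getD 0 (0, 0)).1 L

/-- A depth-first ordering of the nodes of a tree that is given by its neighbour lists. -/
def dfsOrder (N : ℕ) (nb : ℕ → List ℕ) : List ℕ := (grow nb)^[N] [0]

namespace BT

/-- Insertion of `x` as the first child of `y`. -/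
def ins (y x : ℕ) : BT → BT
  | nil => nil
  | node z l r => node z (if z = y then node x nil (ins y x l) else ins y x l) (ins y x r)

theorem flat_ins (y x : ℕ) (t : BT) : (ins y x t).flat = insAfter y x t.flat := by
  induction t with
  | nil => rfl
  | node z l r ihl ihr =>
    simp only [ins, flat, insAfter, List.flatMap_cons, List.flatMap_append] at *
    split_ifs with h <;> simp [flat, ihl, ihr]

theorem mem_edges_ins {y x p a b : ℕ} {t : BT} (h : (a, b) ∈ t.edges p) :
    (a, b) ∈ (ins y x t).edges p := by
  induction t generalizing p with
  | nil => exact h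
  | node z l r ihl ihr =>
    simp only [ins, edges, List.mem_cons, List.mem_append] at *
    rcases h with h | h | h
    · exact Or.inl h
    · right; left
      split_ifs with hz
      · simp [edges, ihl h]
      · exact ihl h
    · exact Or.inr (Or.inr (ihr h))

theorem mem_edges_ins_self {y x p : ℕ} {t : BT} (h : y ∈ t.flat) :
    (x, y) ∈ (ins y x t).edges p := by
  induction t generalizing p with
  | nil => simp [flat] at h
  | node z l r ihl ihr =>
    simp only [ins, edges, flat, List.mem_cons, List.mem_append] at *
    by_cases hz : z = y
    · right; left; simp [hz, edges]
    · rcases h with h | h | h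
      · exact absurd h.symm hz
      · right; left; rw [if_neg hz]; exact ihl h
      · exact Or.inr (Or.inr (ihr h))

end BT

theorem mem_insAfter {y x : ℕ} {L : List ℕ} (hy : y ∈ L) {a : ℕ} :
    a ∈ insAfter y x L ↔ a = x ∨ a ∈ L := by
  simp only [insAfter, List.mem_flatMap]
  constructor
  · rintro ⟨z, hz, ha⟩
    split_ifs at ha <;> simp only [List.mem_cons, List.not_mem_nil, or_false] at ha
    · rcases ha with rfl | rfl <;> simp [hz]
    · simp [ha, hz]
  · rintro (rfl | h)
    · exact ⟨y, hy, by simp⟩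
    · exact ⟨a, h, by split_ifs <;> simp⟩

theorem insAfter_of_notMem {y x : ℕ} {L : List ℕ} (hy : y ∉ L) : insAfter y x L = L := by
  induction L with
  | nil => rfl
  | cons z L ih =>
    simp only [List.mem_cons, not_or] at hy
    have := ih hy.2
    simp only [insAfter, List.flatMap_cons] at *
    rw [if_neg (Ne.symm hy.1), this]
    rfl

theorem insAfter_perm {y x : ℕ} {L : List ℕ} (hL : L.Nodup) (hy : y ∈ L) :
    (insAfter y x L).Perm (x :: L) := by
  induction L with
  | nil => simp at hy
  | cons z L ih =>
    rw [List.nodup_cons] at hL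
    by_cases hz : z = y
    · subst hz
      have := insAfter_of_notMem (x := x) hL.1
      simp only [insAfter, List.flatMap_cons, if_pos] at *
      rw [this]
      exact List.Perm.swap _ _ _
    · have hyL : y ∈ L := (List.mem_cons.1 hy).resolve_left (Ne.symm hz)
      have := ih hL.2 hyL
      simp only [insAfter, List.flatMap_cons, if_neg hz] at *
      exact (this.cons z).trans (List.Perm.swap _ _ _)

/-! ### Growing a depth-first ordering of a tree node by node -/

section Tree

variable {N : ℕ} (T : SimpleGraph (Fin N))

/-- Adjacency of nodes that are given as numbers. -/
def NodeAdj (i j : ℕ) : Prop := ∃ (hi : i < N) (hj : j < N), T.Adj ⟨i, hi⟩ ⟨j, hj⟩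

variable {T}

/-- A set of nodes with a nonempty complement in a connected graph can be left along an edge. -/
theorem exists_adj_leaving {V : Type} {H : SimpleGraph V} (hH : H.Preconnected)
    {S : Set V} {a b : V}
    (ha : a ∈ S) (hb : b ∉ S) : ∃ x ∈ S, ∃ y ∉ S, H.Adj x y := by
  obtain ⟨p⟩ := hH a b
  obtain ⟨e, -, h1, h2⟩ := p.exists_boundary_dart S ha hb
  exact ⟨_, h1, _, h2, e.adj⟩

/-- Putting `x` before a path from `y` to `y'` that avoids `x` gives a path from `x` to `y'`; in a
forest it must be the edge itself. -/
theorem eq_of_adj_of_walk (hT : T.IsAcyclic) {x y y' : Fin N} (hxy : T.Adj x y) (hxy' : T.Adj x y')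
    (p : T.Walk y y') (hx : x ∉ p.support) : y = y' := by
  classical
  have hx' : x ∉ p.bypass.support := fun h => hx (p.support_bypass_subset_support h)
  have h1 : (SimpleGraph.Walk.cons hxy p.bypass).IsPath :=
    (SimpleGraph.Walk.cons_isPath_iff _ _).2 ⟨p.bypass_isPath, hx'⟩
  have h2 : (SimpleGraph.Walk.cons hxy' SimpleGraph.Walk.nil).IsPath := by
    simp [SimpleGraph.Walk.cons_isPath_iff, hxy'.ne]
  have h3 := (hT.subsingleton_path x y').elim ⟨_, h1⟩ ⟨_, h2⟩
  have h4 := congrArg (fun q : T.Path x y' => q.1.support) h3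
  simp only [SimpleGraph.Walk.support_cons, SimpleGraph.Walk.support_nil] at h4
  have h5 : y ∈ p.bypass.support := p.bypass.start_mem_support
  rw [(List.cons.inj h4).2] at h5
  simpa using h5

/-- The state of the construction of the ordering. -/
structure Grown (T : SimpleGraph (Fin N)) (L : List ℕ) : Prop where
  nodup : L.Nodup
  lt : ∀ i ∈ L, i < N
  -- The machine stores only the list; the ordered tree behind it occurs in the proof alone. The
  -- root receives the parent `N`, which is no node.
  tree : ∃ t : BT, t.flat = L ∧ ∀ a ∈ L, ∀ b ∈ L, NodeAdj T a b →
    (a, b) ∈ t.edges N ∨ (b, a) ∈ t.edges N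
  walk : ∀ a b : Fin N, (a : ℕ) ∈ L → (b : ℕ) ∈ L → ∃ p : T.Walk a b, ∀ c ∈ p.support, (c : ℕ) ∈ L
  zero_mem : 0 ∈ L

theorem Grown.start (hN : 0 < N) : Grown T [0] where
  nodup := by simp
  lt := by simpa using hN
  tree := by
    refine ⟨.node 0 .nil .nil, rfl, fun a ha b hb ⟨h1, h2, h⟩ => ?_⟩
    obtain rfl := List.mem_singleton.1 ha
    obtain rfl := List.mem_singleton.1 hb
    exact absurd h (T.irrefl)
  walk a b ha hb := by
    obtain rfl : a = b := Fin.ext (by simp at ha hb; omega)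
    exact ⟨.nil, by simpa using ha⟩
  zero_mem := by simp

/-- The listed nodes are connected to each other, so by acyclicity `y` is the only neighbour of `x`
among them. A first child comes directly behind its parent in preorder, which makes the insertion a
preorder again. -/
theorem Grown.insAfter (hT : T.IsAcyclic) {L : List ℕ} (h : Grown T L) {x y : ℕ} (hx : x ∉ L)
    (hy : y ∈ L) (hxy : NodeAdj T x y) : Grown T (insAfter y x L) := by
  obtain ⟨hxN, hyN, hadj⟩ := hxy
  refine ⟨?_, fun i hi => ?_, ?_, ?_, (mem_insAfter hy).2 (Or.inr h.zero_mem)⟩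
  · exact (insAfter_perm h.nodup hy).nodup_iff.2 (List.nodup_cons.2 ⟨hx, h.nodup⟩)
  · rcases (mem_insAfter hy).1 hi with rfl | hi
    · exact hxN
    · exact h.lt i hi
  · obtain ⟨t, ht, hedge⟩ := h.tree
    have huniq : ∀ z ∈ L, NodeAdj T x z → z = y := by
      rintro z hz ⟨_, hzN, hadj'⟩
      obtain ⟨p, hp⟩ := h.walk ⟨z, hzN⟩ ⟨y, hyN⟩ hz hy
      exact congrArg Fin.val (eq_of_adj_of_walk hT hadj' hadj p fun hxp => hx (hp _ hxp))
    have hself : (x, y) ∈ (BT.ins y x t).edges N := BT.mem_edges_ins_self (ht ▸ hy)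
    refine ⟨t.ins y x, by rw [BT.flat_ins, ht], fun a ha b hb hab => ?_⟩
    rcases (mem_insAfter hy).1 ha with ha' | ha'
    · rcases (mem_insAfter hy).1 hb with hb' | hb'
      · obtain ⟨_, _, hab⟩ := hab
        subst ha' hb'
        exact absurd hab T.irrefl
      · rw [ha'] at hab ⊢
        rw [huniq b hb' hab]
        exact Or.inl hself
    · rcases (mem_insAfter hy).1 hb with hb' | hb'
      · obtain ⟨h1, h2, hab⟩ := hab
        subst hb'
        rw [huniq a ha' ⟨h2, h1, hab.symm⟩]
        exact Or.inr hself
      · exact (hedge a ha' b hb' hab).imp BT.mem_edges_ins BT.mem_edges_ins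
  · have hxb : ∀ b : Fin N, (b : ℕ) ∈ L → ∃ p : T.Walk ⟨x, hxN⟩ b,
        ∀ c ∈ p.support, (c : ℕ) ∈ MinStableCut.insAfter y x L := fun b hb => by
      obtain ⟨p, hp⟩ := h.walk ⟨y, hyN⟩ b hy hb
      refine ⟨.cons hadj p, fun c hc => (mem_insAfter hy).2 ?_⟩
      rcases List.mem_cons.1 hc with rfl | hc
      · exact Or.inl rfl
      · exact Or.inr (hp c hc)
    intro a b ha hb
    rcases (mem_insAfter hy).1 ha with ha' | ha'
    · obtain rfl : a = ⟨x, hxN⟩ := Fin.ext ha'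
      rcases (mem_insAfter hy).1 hb with hb' | hb'
      · obtain rfl : b = ⟨x, hxN⟩ := Fin.ext hb'
        exact ⟨.nil, by simpa using ha⟩
      · exact hxb b hb'
    · rcases (mem_insAfter hy).1 hb with hb' | hb'
      · obtain rfl : b = ⟨x, hxN⟩ := Fin.ext hb'
        obtain ⟨p, hp⟩ := hxb a ha'
        exact ⟨p.reverse, fun c hc => hp c (by simpa using hc)⟩
      · obtain ⟨p, hp⟩ := h.walk a b ha' hb'
        exact ⟨p, fun c hc => (mem_insAfter hy).2 (Or.inr (hp c hc))⟩

variable {nb : ℕ → List ℕ}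

theorem mem_fringe {L : List ℕ} {x y : ℕ} :
    (x, y) ∈ fringe nb L ↔ y ∈ L ∧ x ∈ nb y ∧ x ∉ L := by
  simp only [fringe, List.mem_flatMap, List.mem_map, List.mem_filter, Prod.mk.injEq]
  constructor
  · rintro ⟨z, hz, w, ⟨hw, hwL⟩, rfl, rfl⟩
    simp only [Bool.not_eq_true', List.any_eq_false, decide_eq_true_eq] at hwL
    exact ⟨hz, hw, fun h => hwL w h rfl⟩
  · rintro ⟨h1, h2, h3⟩
    refine ⟨y, h1, x, ⟨h2, ?_⟩, rfl, rfl⟩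
    simp only [Bool.not_eq_true', List.any_eq_false, decide_eq_true_eq]
    exact fun z hz hzx => h3 (hzx ▸ hz)

theorem Grown.length_le {L : List ℕ} (h : Grown T L) : L.length ≤ N := by
  have : L.toFinset ⊆ Finset.range N := fun i hi => by
    simpa using h.lt i (by simpa using hi)
  simpa [List.toFinset_card_of_nodup h.nodup] using Finset.card_le_card this

theorem Grown.grow (hT : T.IsTree) (hnb : ∀ i j, j ∈ nb i ↔ NodeAdj T i j) {L : List ℕ}
    (h : Grown T L) : Grown T (grow nb L) ∧ min (L.length + 1) N ≤ (grow nb L).length := by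
  unfold MinStableCut.grow
  split_ifs with h0
  -- With an empty fringe no edge leaves `L`, so by connectedness `L` contains all nodes.
  · refine ⟨h, ?_⟩
    by_contra hlt
    have hlen : L.length < N := by omega
    obtain ⟨b, hb⟩ : ∃ b : Fin N, (b : ℕ) ∉ L := by
      by_contra hall
      push Not at hall
      have : Finset.range N ⊆ L.toFinset := fun i hi => by
        simpa using hall ⟨i, by simpa using hi⟩
      have := Finset.card_le_card this
      rw [List.toFinset_card_of_nodup h.nodup, Finset.card_range] at this
      omega
    obtain ⟨x, hx, y, hy, hxy⟩ := exists_adj_leaving hT.1.preconnected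
      (S := {c : Fin N | (c : ℕ) ∈ L}) (a := ⟨0, by omega⟩) (b := b) h.zero_mem hb
    have : ((y : ℕ), (x : ℕ)) ∈ fringe nb L :=
      mem_fringe.2 ⟨hx, (hnb _ _).2 ⟨x.2, y.2, hxy⟩, hy⟩
    rw [List.length_eq_zero_iff.1 h0] at this
    simp at this
  · have hpos : 0 < (fringe nb L).length := by omega
    have hmem : (fringe nb L).getD 0 (0, 0) ∈ fringe nb L := by
      rw [List.getD_eq_getElem?_getD, List.getElem?_eq_getElem hpos]
      exact List.getElem_mem hpos
    generalize (fringe nb L).getD 0 (0, 0) = q at hmem ⊢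
    obtain ⟨x, y⟩ := q
    obtain ⟨hy, hxy, hx⟩ := mem_fringe.1 hmem
    obtain ⟨h1, h2, h3⟩ := (hnb _ _).1 hxy
    refine ⟨h.insAfter hT.2 hx hy ⟨h2, h1, h3.symm⟩, ?_⟩
    rw [(insAfter_perm h.nodup hy).length_eq, List.length_cons]
    exact min_le_left _ _

theorem grown_iterate (hT : T.IsTree) (hN : 0 < N) (hnb : ∀ i j, j ∈ nb i ↔ NodeAdj T i j) (k : ℕ) :
    Grown T ((grow nb)^[k] [0]) ∧ min (k + 1) N ≤ ((grow nb)^[k] [0]).length := by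
  induction k with
  | zero => exact ⟨.start hN, by simp⟩
  | succ k ih =>
    rw [Function.iterate_succ_apply']
    obtain ⟨h1, h2⟩ := ih
    obtain ⟨h3, h4⟩ := h1.grow hT hnb
    exact ⟨h3, by omega⟩

theorem grown_dfsOrder (hT : T.IsTree) (hN : 0 < N) (hnb : ∀ i j, j ∈ nb i ↔ NodeAdj T i j) :
    Grown T (dfsOrder N nb) ∧ ∀ i, i ∈ dfsOrder N nb ↔ i < N := by
  obtain ⟨h1, h2⟩ := grown_iterate hT hN hnb N
  rw [← dfsOrder] at h1 h2
  refine ⟨h1, fun i => ⟨h1.lt i, fun hi => ?_⟩⟩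
  have hsub : (dfsOrder N nb).toFinset ⊆ Finset.range N := fun i hi => by
    simpa using h1.lt i (by simpa using hi)
  have heq := Finset.eq_of_subset_of_card_le hsub (by
    rw [List.toFinset_card_of_nodup h1.nodup, Finset.card_range]
    omega)
  have : i ∈ (dfsOrder N nb).toFinset := by rw [heq]; simpa using hi
  simpa using this

/-- In a depth-first ordering of a tree, all nodes are derived in few rounds. -/
theorem Data.Layout.der_range {d : Data} (hL : d.Layout (NodeAdj T)) (hdN : d.N = N) (hT : T.IsTree)
    (hN : 0 < N) (hnb : ∀ i j, j ∈ nb i ↔ NodeAdj T i j) (hord : d.ord = dfsOrder N nb) {K : ℕ}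
    (hK : N < 2 ^ K) : d.Der (Finset.range d.N) (K * (K + 1) + 1) := by
  obtain ⟨h1, h2⟩ := grown_dfsOrder hT hN hnb
  obtain ⟨t, ht, hedge⟩ := h1.tree
  have hblock : d.Block (NodeAdj T) t N := by
    refine ⟨⟨[], [], by simp [ht, hord]⟩, fun a ha b hab => ?_, fun h => ?_⟩
    · exact hedge a (ht ▸ ha) b ((h2 b).2 hab.2.1) hab
    · rw [ht, h2] at h
      omega
  have hflat : t.flat.toFinset = Finset.range d.N := by
    ext i; simp [ht, h2, hdN]
  rw [← hflat]
  refine Data.der_block hL (hdN ▸ hK) K hblock ?_ ?_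
  · rw [ht]; exact List.ne_nil_of_mem h1.zero_mem
  · rw [ht]; exact h1.length_le.trans_lt hK

end Tree

/-! ### Running time of the dynamic program -/

instance : Enc Data := ⟨fun d => Enc.enc (d.adj, d.dec, d.ord, d.b, d.q, d.R)⟩

namespace PT

variable {α β γ σ : Type} [Enc α] [Enc β] [Enc γ] [Enc σ] {m : α → ℕ}

theorem get0 {l : α → List ℕ} {i : α → ℕ} (hl : PT m l) (hi : PT m i) :
    PT m (fun a => get0 (l a) (i a)) := hl.getD hi (const_nat 0)

theorem vec {n : α → ℕ} {f : α → ℕ → ℕ} (hm : PolyBdd m (fun a => sz a)) (hn : PT m n)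
    (hb : PolyBdd m n) (hf : PT (ext m) fun q : α × ℕ => f q.1 q.2) :
    PT m (fun a => vec (n a) (f a)) := map hm (range hn hb) hf

theorem rsum {n : α → ℕ} {f : α → ℕ → ℕ} (hm : PolyBdd m (fun a => sz a)) (hn : PT m n)
    (hb : PolyBdd m n) (hf : PT (ext m) fun q : α × ℕ => f q.1 q.2) :
    PT m (fun a => rsum (n a) (f a)) := sum (map hm (range hn hb) hf)

section Data

variable {d : α → Data} {S x k l : α → List ℕ} {u v i : α → ℕ} {e e' : α → Entry}

theorem toTuple (hd : PT m d) :
    PT m fun a => ((d a).adj, (d a).dec, (d a).ord, (d a).b, (d a).q, (d a).R) :=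
  hd.cast fun _ => rfl

theorem adj (hd : PT m d) : PT m fun a => (d a).adj := hd.toTuple.fst
theorem dec (hd : PT m d) : PT m fun a => (d a).dec := hd.toTuple.snd.fst
theorem ord (hd : PT m d) : PT m fun a => (d a).ord := hd.toTuple.snd.snd.fst
theorem b (hd : PT m d) : PT m fun a => (d a).b := hd.toTuple.snd.snd.snd.fst
theorem q (hd : PT m d) : PT m fun a => (d a).q := hd.toTuple.snd.snd.snd.snd.fst
theorem R (hd : PT m d) : PT m fun a => (d a).R := hd.toTuple.snd.snd.snd.snd.snd

theorem n (hd : PT m d) : PT m fun a => (d a).n := hd.adj.length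
theorem N (hd : PT m d) : PT m fun a => (d a).N := hd.dec.length

theorem n_bdd (hd : PT m d) : PolyBdd m fun a => (d a).n :=
  hd.adj.bdd.mono fun _ => (length_lt_sz _).le

theorem N_bdd (hd : PT m d) : PolyBdd m fun a => (d a).N :=
  hd.dec.bdd.mono fun _ => (length_lt_sz _).le

theorem wt (hm : PolyBdd m (fun a => sz a)) (hd : PT m d) (hu : PT m u) (hv : PT m v) :
    PT m fun a => (d a).wt (u a) (v a) := by
  unfold Data.wt
  exact sum (map hm (filter hm (hd.adj.getD hu nil) (var.fst.eq hv.lift)) var.snd)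

theorem bag (hd : PT m d) (hi : PT m i) : PT m fun a => (d a).bag (i a) := by
  unfold Data.bag
  exact (hd.dec.getD hi (nil.pair nil)).snd

theorem inBag (hm : PolyBdd m (fun a => sz a)) (hd : PT m d) (hi : PT m i) (hv : PT m v) :
    PT m fun a => (d a).inBag (i a) (v a) := by
  unfold Data.inBag
  exact any hm (hd.bag hi) (var.eq hv.lift)

theorem own (hm : PolyBdd m (fun a => sz a)) (hd : PT m d) (hu : PT m u) (hv : PT m v) :
    PT m fun a => (d a).own (u a) (v a) := by
  unfold Data.own
  exact get0 (filter hm (range hd.N hd.N_bdd) ((inBag hm.ext hd.lift var hu.lift).and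
    (inBag hm.ext hd.lift var hv.lift))) (const_nat 0)

theorem ow (hm : PolyBdd m (fun a => sz a)) (hd : PT m d) (hS : PT m S) (hu : PT m u)
    (hv : PT m v) : PT m fun a => (d a).ow (MinStableCut.get0 (S a)) (u a) (v a) := by
  unfold Data.ow
  exact ite_prop ((get0 hS (own hm hd hu hv)).eq (const_nat 0)) (const_nat 0) (wt hm hd hu hv)

theorem deg (hm : PolyBdd m (fun a => sz a)) (hd : PT m d) (hS : PT m S) (hv : PT m v) :
    PT m fun a => (d a).deg (MinStableCut.get0 (S a)) (v a) := by
  unfold Data.deg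
  exact rsum hm hd.n hd.n_bdd (ow hm.ext hd.lift hS.lift hv.lift var)

theorem cr (hm : PolyBdd m (fun a => sz a)) (hd : PT m d) (hS : PT m S) (hx : PT m x)
    (hv : PT m v) :
    PT m fun a => (d a).cr (MinStableCut.get0 (S a)) (MinStableCut.get0 (x a)) (v a) := by
  unfold Data.cr
  exact rsum hm hd.n hd.n_bdd (ite_prop ((get0 hx.lift var).eq (get0 hx.lift hv.lift))
    (const_nat 0) (ow hm.ext hd.lift hS.lift hv.lift var))

theorem cost (hm : PolyBdd m (fun a => sz a)) (hd : PT m d) (hS : PT m S) (hx : PT m x) :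
    PT m fun a => (d a).cost (MinStableCut.get0 (S a)) (MinStableCut.get0 (x a)) := by
  unfold Data.cost
  refine rsum hm hd.n hd.n_bdd (rsum hm.ext hd.lift.n hd.lift.n_bdd (ite (and ?_ (not ?_))
    (ow hm.ext.ext hd.lift.lift hS.lift.lift var.lift var) (const_nat 0)))
  · exact (get0 hx.lift.lift var.lift).eq (const_nat 0)
  · exact (get0 hx.lift.lift var).eq (const_nat 0)

theorem inV (hm : PolyBdd m (fun a => sz a)) (hd : PT m d) (hS : PT m S) (hv : PT m v) :
    PT m fun a => (d a).inV (MinStableCut.get0 (S a)) (v a) := by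
  unfold Data.inV
  exact any hm (range hd.N hd.N_bdd) ((lt (const_nat 0) (get0 hS.lift var)).and
    (inBag hm.ext hd.lift var hv.lift))

theorem outV (hm : PolyBdd m (fun a => sz a)) (hd : PT m d) (hS : PT m S) (hv : PT m v) :
    PT m fun a => (d a).outV (MinStableCut.get0 (S a)) (v a) := by
  unfold Data.outV
  exact any hm (range hd.N hd.N_bdd) (((get0 hS.lift var).eq (const_nat 0)).and
    (inBag hm.ext hd.lift var hv.lift))

theorem inB (hm : PolyBdd m (fun a => sz a)) (hd : PT m d) (hS : PT m S) (hv : PT m v) :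
    PT m fun a => (d a).inB (MinStableCut.get0 (S a)) (v a) :=
  (inV hm hd hS hv).and (outV hm hd hS hv)

theorem shape (hm : PolyBdd m (fun a => sz a)) (hd : PT m d) (hS : PT m S) :
    PT m fun a => (d a).shape (MinStableCut.get0 (S a)) := by
  have hN : ∀ {β : Type} [Enc β] {m : β → ℕ} {d : β → Data}, PT m d →
      PT m fun a => List.range ((d a).N + 1) := fun hd =>
    range (hd.N.add (const_nat 1)) (hd.N_bdd.add (.const _ 1))
  unfold Data.shape
  refine any hm (hN hd) (any hm.ext (hN hd.lift) (any hm.ext.ext (hN hd.lift.lift)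
    (any hm.ext.ext.ext (hN hd.lift.lift.lift) (all hm.ext.ext.ext.ext
      (range hd.lift.lift.lift.lift.N hd.lift.lift.lift.lift.N_bdd) (beq (lt (const_nat 0)
        (get0 hS.lift.lift.lift.lift.lift (get0 hd.lift.lift.lift.lift.lift.ord var)))
        (and (and (le ?_ var) (lt var ?_)) (not (and (le ?_ var) (lt var ?_)))))))))
  · exact var.lift.lift.lift.lift
  · exact var.lift.lift.lift
  · exact var.lift.lift
  · exact var.lift

theorem bcount (hm : PolyBdd m (fun a => sz a)) (hd : PT m d) (hS : PT m S) :
    PT m fun a => (d a).bcount (MinStableCut.get0 (S a)) := by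
  unfold Data.bcount
  exact length (filter hm (range hd.n hd.n_bdd) (inB hm.ext hd.lift hS.lift var))

theorem good (hm : PolyBdd m (fun a => sz a)) (hd : PT m d) (he : PT m e) :
    PT m fun a => (d a).good (e a) := by
  unfold Data.good Data.admissible Data.settled
  exact ((shape hm hd he.fst).and ((bcount hm hd he.fst).le ((const_nat 2).mul hd.b))).and
    (all hm (range hd.n hd.n_bdd) ((inB hm.ext hd.lift he.fst.lift var).or
      ((hd.q.lift.mul (deg hm.ext hd.lift he.fst.lift var)).le
        (((const_nat 2).mul ((get0 he.snd.snd.lift var).add (hd.R.lift.add (const_nat 1)))).mul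
          (deg hm.ext hd.lift he.fst.lift var)))))

theorem sameKey (hm : PolyBdd m (fun a => sz a)) (hd : PT m d) (he : PT m e) (he' : PT m e') :
    PT m fun a => (d a).sameKey (e a) (e' a) := by
  unfold Data.sameKey
  exact (all hm (range hd.N hd.N_bdd) ((get0 he.fst.lift var).eq (get0 he'.fst.lift var))).and
    (all hm (range hd.n hd.n_bdd) ((inB hm.ext hd.lift he.fst.lift var).not.or
      (((get0 he.snd.fst.lift var).eq (get0 he'.snd.fst.lift var)).and
        ((get0 he.snd.snd.lift var).eq (get0 he'.snd.snd.lift var)))))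

theorem compat (hm : PolyBdd m (fun a => sz a)) (hd : PT m d) (he : PT m e) (he' : PT m e') :
    PT m fun a => (d a).compat (e a) (e' a) := by
  unfold Data.compat
  exact (all hm (range hd.N hd.N_bdd) (((get0 he.fst.lift var).eq (const_nat 0)).or
      ((get0 he'.fst.lift var).eq (const_nat 0)))).and
    (all hm (range hd.n hd.n_bdd) (((inV hm.ext hd.lift he.fst.lift var).and
      (inV hm.ext hd.lift he'.fst.lift var)).not.or
        ((get0 he.snd.fst.lift var).eq (get0 he'.snd.fst.lift var))))

theorem merge (hm : PolyBdd m (fun a => sz a)) (hd : PT m d) (he : PT m e) (he' : PT m e') :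
    PT m fun a => (d a).merge (e a) (e' a) := by
  unfold Data.merge
  exact (vec hm hd.N hd.N_bdd ((get0 he.fst.lift var).add (get0 he'.fst.lift var))).pair
    ((vec hm hd.n hd.n_bdd (ite_prop ((get0 he.snd.fst.lift var).eq (const_nat 0))
      (get0 he'.snd.fst.lift var) (get0 he.snd.fst.lift var))).pair
    (vec hm hd.n hd.n_bdd ((((get0 he.snd.snd.lift var).mul
      (deg hm.ext hd.lift he.fst.lift var)).add ((get0 he'.snd.snd.lift var).mul
      (deg hm.ext hd.lift he'.fst.lift var))).div
      ((deg hm.ext hd.lift he.fst.lift var).add (deg hm.ext hd.lift he'.fst.lift var)))))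

theorem single (hm : PolyBdd m (fun a => sz a)) (hd : PT m d) (hi : PT m i) :
    PT m fun a => (d a).single (i a) := by
  unfold Data.single
  exact vec hm hd.N hd.N_bdd (ite_prop (var.eq hi.lift) (const_nat 1) (const_nat 0))

theorem leaf (hm : PolyBdd m (fun a => sz a)) (hd : PT m d) (hi : PT m i) (hx : PT m x) :
    PT m fun a => (d a).leaf (i a) (x a) := by
  have hs := single hm hd hi
  unfold Data.leaf
  exact hs.pair (hx.pair (vec hm hd.n hd.n_bdd ((hd.q.lift.mul
    (cr hm.ext hd.lift hs.lift hx.lift var)).div (deg hm.ext hd.lift hs.lift var))))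

theorem sz_filter_le {l : List γ} {p : γ → Bool} : sz (l.filter p) ≤ sz l := by
  induction l with
  | nil => simp
  | cons a l ih =>
    rw [List.filter_cons, sz_cons]
    split_ifs
    · rw [sz_cons]; omega
    · omega

theorem ins {T : α → List Entry} (hm : PolyBdd m (fun a => sz a)) (hd : PT m d) (hT : PT m T)
    (he : PT m e) : PT m fun a => (d a).ins (T a) (e a) := by
  unfold Data.ins
  exact ite (any hm hT ((sameKey hm.ext hd.lift he.lift var).and
      ((cost hm.ext hd.lift var.fst var.snd.fst).le
        (cost hm.ext hd.lift he.lift.fst he.lift.snd.fst)))) hT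
    (he.cons (filter hm hT (sameKey hm.ext hd.lift he.lift var).not))

theorem sz_prune_le (d : Data) (T : List Entry) : sz (d.prune T) ≤ sz T := by
  induction T using List.reverseRecOn with
  | nil => exact le_rfl
  | append_singleton T e ih =>
    rw [Data.prune_append_singleton]
    have h1 : sz (d.ins (d.prune T) e) ≤ sz (d.prune T) + sz e + 1 := by
      unfold Data.ins
      split_ifs
      · omega
      · rw [sz_cons]
        have := sz_filter_le (l := d.prune T) (p := fun e' => !d.sameKey e e')
        omega
    have h2 := sz_append T [e]
    rw [sz_cons, sz_nil] at h2
    omega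

theorem prune {T : α → List Entry} (hm : PolyBdd m (fun a => sz a)) (hd : PT m d) (hT : PT m T) :
    PT m fun a => (d a).prune (T a) := by
  unfold Data.prune
  exact foldl hm hT nil (ins hm.ext.ext hd.lift.lift var.lift var) hT.bdd
    fun a j _ => (sz_prune_le (d a) _).trans (sz_take_le _ j)

theorem step {T : α → List Entry} (hm : PolyBdd m (fun a => sz a)) (hd : PT m d) (hT : PT m T) :
    PT m fun a => (d a).step (T a) := by
  unfold Data.step Data.merges
  refine prune hm hd (hT.append (filter hm (flatMap hm hT (map hm.ext (filter hm.ext hT.lift ?_)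
    ?_)) (good hm.ext hd.lift var)))
  · exact compat hm.ext.ext hd.lift.lift var.lift var
  · exact merge hm.ext.ext hd.lift.lift var.lift var

theorem length_assign (n : ℕ) (l : List ℕ) : (Data.assign n l).length = 2 ^ l.length := by
  induction l using List.reverseRecOn with
  | nil => simp [Data.assign]
  | append_singleton l v ih =>
    simp only [Data.assign, List.foldl_append, List.foldl_cons, List.foldl_nil] at *
    simp [ih, pow_succ]
    omega

theorem sz_assign_le (n : ℕ) (l : List ℕ) :
    sz (Data.assign n l) ≤ 2 ^ l.length * ((n * 3 + 1) + 1) + 1 := by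
  rw [← length_assign n l]
  refine sz_list_le fun x hx => ?_
  obtain ⟨h1, h2, -⟩ := Data.mem_assign hx
  rw [← h1]
  refine sz_list_le (B := 2) fun v hv => ?_
  obtain ⟨i, hi, rfl⟩ := List.getElem_of_mem hv
  have := h2 i
  rw [MinStableCut.get0, List.getD_eq_getElem?_getD, List.getElem?_eq_getElem hi] at this
  exact (sz_nat_le _).trans (Nat.succ_le_succ this)

theorem assign {n : α → ℕ} (hm : PolyBdd m (fun a => sz a)) (hn : PT m n) (hnb : PolyBdd m n)
    (hl : PT m l) (hlb : PolyBdd m fun a => 2 ^ (l a).length) :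
    PT m fun a => Data.assign (n a) (l a) := by
  unfold Data.assign
  refine foldl (B := fun a => 2 ^ (l a).length * ((n a * 3 + 1) + 1) + 1) hm hl
    ((vec hm hn hnb (const_nat 0)).cons nil) (append var.lift (map hm.ext.ext var.lift
    (vec hm.ext.ext.ext hn.lift.lift.lift hnb.lift.lift.lift (ite_prop (var.eq var.lift.lift)
      (const_nat 1) (get0 var.lift var))))) ?_ ?_
  · exact (hlb.mul (((hnb.mul (.const m 3)).add (.const m 1)).add (.const m 1))).add (.const m 1)
  · intro a j _
    refine (sz_assign_le (n a) _).trans ?_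
    have : 2 ^ ((l a).take j).length ≤ 2 ^ (l a).length :=
      Nat.pow_le_pow_right (by omega) (by simp)
    have := Nat.mul_le_mul_right ((n a * 3 + 1) + 1) this
    omega

theorem leaves (hm : PolyBdd m (fun a => sz a)) (hd : PT m d)
    (hb : ∀ a i, ((d a).bag i).length ≤ (d a).b) (hbb : PolyBdd m fun a => 2 ^ (d a).b) :
    PT m fun a => (d a).leaves := by
  unfold Data.leaves
  refine filter hm (flatMap hm (range hd.N hd.N_bdd) (map hm.ext (assign hm.ext hd.lift.n
    hd.lift.n_bdd (hd.lift.bag var) (hbb.lift.mono fun q => ?_)) ?_)) (good hm.ext hd.lift var)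
  · exact Nat.pow_le_pow_right (by omega) (hb q.1 q.2)
  · exact leaf hm.ext.ext hd.lift.lift var.lift var

end Data

end PT

/-! ### The number of keys and the size of the table -/

namespace Data

variable {d : Data}

theorem sz_entry_le {e : Entry} (h : d.EntryOk e) :
    sz e ≤ (d.N * 3 + 1) + (d.n * 3 + 1) + (d.n * (sz d.q + 1) + 1) + 2 := by
  have key : ∀ (l : List ℕ) (B : ℕ), (∀ i, get0 l i ≤ B) → sz l ≤ l.length * (sz B + 1) + 1 := by
    intro l B hB
    refine sz_list_le fun v hv => ?_
    obtain ⟨i, hi, rfl⟩ := List.getElem_of_mem hv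
    have := hB i
    rw [get0, List.getD_eq_getElem?_getD, List.getElem?_eq_getElem hi] at this
    exact sz_nat_mono this
  have h1 := key _ _ h.S_le
  have h2 := key _ _ h.x_le
  have h3 := key _ _ h.k_le
  have h4 : sz 1 = 2 := by simp [sz_nat]
  rw [h.len_S, h4] at h1
  rw [h.len_x, h4] at h2
  rw [h.len_k] at h3
  have h5 : sz e = sz e.1 + (sz e.2.1 + sz e.2.2 + 1) + 1 := rfl
  omega

/-- Bound on the number of keys of entries. -/
def keyBound (d : Data) : ℕ := (d.N + 1) ^ 4 * (2 * (d.q + 1)) ^ (2 * d.b)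

theorem exists_code {S : ℕ → ℕ} (h : d.shape S = true) : ∃ c ∈ (Finset.range (d.N + 1) ×ˢ
    Finset.range (d.N + 1)) ×ˢ (Finset.range (d.N + 1) ×ˢ Finset.range (d.N + 1)),
    ∀ i < d.N, decide (0 < S (get0 d.ord i)) =
      ((decide (c.1.1 ≤ i) && decide (i < c.1.2)) &&
        !(decide (c.2.1 ≤ i) && decide (i < c.2.2))) := by
  simp only [shape, List.any_eq_true, List.all_eq_true, List.mem_range, beq_iff_eq] at h
  obtain ⟨a, ha, b, hb, c, hc, e, he, h⟩ := h
  exact ⟨((a, b), (c, e)), by simp; omega, h⟩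

/-- Four interval ends determine the node set. Once it is fixed, the key consists of a side and one
of q + 1 fractions at each of at most 2b boundary vertices. -/
theorem card_le_keyBound {A : ℕ → ℕ → Prop} (hL : d.Layout A) {T : List Entry}
    (hT : ∀ e ∈ T, d.EntryOk e) (hp : T.Pairwise fun e e' => d.sameKey e e' ≠ true) :
    T.length ≤ d.keyBound := by
  classical
  have hnd : T.Nodup := List.Pairwise.imp (fun {a b} h (hab : a = b) => h (hab ▸ sameKey_refl a)) hp
  have hadm : ∀ e ∈ T, d.shape (get0 e.1) = true ∧ d.bcount (get0 e.1) ≤ 2 * d.b := fun e he => by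
    have := (good_iff.1 (hT e he).isGood).1
    simpa [admissible] using this
  have hcode : ∀ e : Entry, ∃ c : (ℕ × ℕ) × (ℕ × ℕ), e ∈ T → c ∈ (Finset.range (d.N + 1) ×ˢ
    Finset.range (d.N + 1)) ×ˢ (Finset.range (d.N + 1) ×ˢ Finset.range (d.N + 1)) ∧
    ∀ i < d.N, decide (0 < get0 e.1 (get0 d.ord i)) = ((decide (c.1.1 ≤ i) && decide (i < c.1.2)) &&
      !(decide (c.2.1 ≤ i) && decide (i < c.2.2))) := fun e => by
    by_cases he : e ∈ T
    · obtain ⟨c, h1, h2⟩ := exists_code (hadm e he).1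
      exact ⟨c, fun _ => ⟨h1, h2⟩⟩
    · exact ⟨0, fun h => absurd h he⟩
  choose code hcode using hcode
  -- The code determines which values are positive, and values are at most 1; every node occurs in
  -- the ordering.
  have hsame : ∀ e ∈ T, ∀ e' ∈ T, code e = code e' → ∀ i < d.N, get0 e.1 i = get0 e'.1 i := by
    intro e he e' he' hc i hi
    obtain ⟨j, hj, rfl⟩ := List.getElem_of_mem ((hL.mem_ord i).2 hi)
    have hj' : j < d.N := by rw [← hL.length_ord]; exact hj
    have h1 := (hcode e he).2 j hj'
    have h2 := (hcode e' he').2 j hj'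
    rw [hc, ← h2, decide_eq_decide] at h1
    have h3 : get0 d.ord j = d.ord[j] := by
      rw [get0, List.getD_eq_getElem?_getD, List.getElem?_eq_getElem hj]; rfl
    rw [h3] at h1
    have h4 := (hT e he).S_le d.ord[j]
    have h5 := (hT e' he').S_le d.ord[j]
    omega
  have hfiber : ∀ c ∈ T.toFinset.image code,
      (T.toFinset.filter fun e => code e = c).card ≤ (2 * (d.q + 1)) ^ (2 * d.b) := by
    intro c hc
    obtain ⟨e₀, he₀, rfl⟩ := Finset.mem_image.1 hc
    rw [List.mem_toFinset] at he₀
    set B := ((List.range d.n).filter fun v => d.inB (get0 e₀.1) v).toFinset with hB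
    have hBcard : B.card ≤ 2 * d.b := (List.toFinset_card_le _).trans (hadm e₀ he₀).2
    have hpi := Finset.card_pi B fun _ => Finset.range 2 ×ˢ Finset.range (d.q + 1)
    simp only [Finset.card_product, Finset.card_range, Finset.prod_const] at hpi
    refine le_trans ?_ (hpi.le.trans (Nat.pow_le_pow_right (by omega) hBcard))
    refine Finset.card_le_card_of_injOn (fun e => fun v _ => (get0 e.2.1 v, get0 e.2.2 v))
      (fun e he => ?_) fun e he e' he' heq => ?_
    · simp only [Finset.coe_filter, List.mem_toFinset, Set.mem_ofPred_eq] at he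
      refine Finset.mem_coe.2 (Finset.mem_pi.2 fun v _ => Finset.mem_product.2 ⟨?_, ?_⟩)
      · have := (hT e he.1).x_le v
        simp only [Finset.mem_range]; omega
      · have := (hT e he.1).k_le v
        simp only [Finset.mem_range]; omega
    · simp only [Finset.coe_filter, List.mem_toFinset, Set.mem_ofPred_eq] at he he'
      by_contra hne
      have : Std.Symm fun e e' : Entry => d.sameKey e e' ≠ true :=
        ⟨fun a b h h' => h (sameKey_symm h')⟩
      refine hp.forall he.1 he'.1 hne (sameKey_iff.2
        ⟨hsame e he.1 e' he'.1 (he.2.trans he'.2.symm), fun v hv hvB => ?_⟩)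
      rw [inB_congr (hsame e he.1 e₀ he₀ he.2)] at hvB
      have := congrFun (congrFun heq v) (by simp [hB, hv, hvB])
      simpa using this
  have h1 := Finset.card_le_mul_card_image (f := code) T.toFinset _ hfiber
  rw [List.toFinset_card_of_nodup hnd] at h1
  have h2 : (T.toFinset.image code).card ≤ (d.N + 1) ^ 4 := by
    refine (Finset.card_le_card fun c hc => ?_).trans (show
      ((Finset.range (d.N + 1) ×ˢ Finset.range (d.N + 1)) ×ˢ (Finset.range (d.N + 1) ×ˢ
        Finset.range (d.N + 1))).card ≤ (d.N + 1) ^ 4 by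
        simp only [Finset.card_product, Finset.card_range]; exact le_of_eq (by ring))
    obtain ⟨e, he, rfl⟩ := Finset.mem_image.1 hc
    exact (hcode e (by simpa using he)).1
  calc T.length ≤ (2 * (d.q + 1)) ^ (2 * d.b) * (T.toFinset.image code).card := h1
    _ ≤ (2 * (d.q + 1)) ^ (2 * d.b) * (d.N + 1) ^ 4 := Nat.mul_le_mul_left _ h2
    _ = d.keyBound := mul_comm _ _

/-- The bound does not depend on the round: without pruning each round could square the table. -/
theorem sz_table_le {A : ℕ → ℕ → Prop} (hd : d.Valid) (hL : d.Layout A) (r : ℕ) :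
    sz (d.table r) ≤ d.keyBound * ((d.N * 3 + 1) + (d.n * 3 + 1) + (d.n * (sz d.q + 1) + 1) + 2 + 1)
      + 1 := by
  refine (sz_list_le fun e he => sz_entry_le (entryOk_of_mem_table hd he)).trans ?_
  have := Nat.mul_le_mul_right ((d.N * 3 + 1) + (d.n * 3 + 1) + (d.n * (sz d.q + 1) + 1) + 2 + 1)
    (card_le_keyBound hL (fun e he => entryOk_of_mem_table hd he) (pairwise_table r))
  omega

end Data

/-- The dynamic program runs in time polynomial in the number of keys. -/
theorem PT.output {α : Type} [Enc α] {m : α → ℕ} {d : α → Data} {A : α → ℕ → ℕ → Prop}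
    (hm : PolyBdd m (fun a => sz a)) (hd : PT m d) (hR : PolyBdd m fun a => (d a).R)
    (hK : PolyBdd m fun a => (d a).keyBound) (hv : ∀ a, (d a).Valid)
    (hL : ∀ a, (d a).Layout (A a)) : PT m fun a => (d a).output := by
  -- All cuts of a bag are listed for the leaves, which the number of keys pays for.
  have hbb : PolyBdd m fun a => 2 ^ (d a).b := hK.mono fun a => by
    calc 2 ^ (d a).b ≤ (2 * ((d a).q + 1)) ^ (d a).b := Nat.pow_le_pow_left (by omega) _
      _ ≤ (2 * ((d a).q + 1)) ^ (2 * (d a).b) := Nat.pow_le_pow_right (by omega) (by omega)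
      _ ≤ _ := Nat.le_mul_of_pos_left _ (by positivity)
  have htable : PT m fun a => (d a).table (d a).R := by
    unfold Data.table
    refine iterate hm hd.R hR (prune hm hd (leaves hm hd (fun a => (hL a).bag_le) hbb))
      (step hm.ext hd.lift var) ?_ fun a j _ => Data.sz_table_le (hv a) (hL a) j
    exact (hK.mul ((((((hd.N_bdd.mul (.const m 3)).add (.const m 1)).add
      ((hd.n_bdd.mul (.const m 3)).add (.const m 1))).add
      ((hd.n_bdd.mul (hd.q.bdd.add (.const m 1))).add (.const m 1))).add (.const m 2)).add
      (.const m 1))).add (.const m 1)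
  unfold Data.output
  exact (getD (filter hm htable (all hm.ext (range hd.lift.N hd.lift.N_bdd)
    ((const_nat 0).lt (get0 var.lift.fst var)))) (const_nat 0) (nil.pair (nil.pair nil))).snd.fst

/-! ### Existence of stable cuts -/

section StableCut

variable {V : Type} (G : SimpleGraph V) (w : Sym2 V → ℕ)

open Classical in
/-- The weight of a pair of vertices, `0` for non-edges. -/
noncomputable def pairWeight (u v : V) : ℕ := if G.Adj u v then w s(u, v) else 0

theorem pairWeight_comm (u v : V) : pairWeight G w u v = pairWeight G w v u := by
  unfold pairWeight
  rw [Sym2.eq_swap]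
  by_cases h : G.Adj u v
  · rw [if_pos h, if_pos h.symm]
  · rw [if_neg h, if_neg fun h' => h h'.symm]

variable [Fintype V]

theorem weightedDegree_eq (v : V) : weightedDegree G w v = ∑ u, pairWeight G w v u := rfl

theorem crossWeight_eq (side : V → Bool) (v : V) :
    crossWeight G w side v = ∑ u, if side u = side v then 0 else pairWeight G w v u := by
  refine Finset.sum_congr rfl fun u _ => ?_
  unfold pairWeight
  by_cases h1 : side u = side v <;> by_cases h2 : G.Adj v u <;> simp [h1, h2]

theorem cutWeight_eq (side : V → Bool) : cutWeight G w side =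
    ∑ u, ∑ v, if side u = false ∧ side v = true then pairWeight G w u v else 0 := by
  refine Finset.sum_congr rfl fun u _ => Finset.sum_congr rfl fun v _ => ?_
  unfold pairWeight
  by_cases h1 : side u = false ∧ side v = true <;> by_cases h2 : G.Adj u v <;> simp [h1, h2]

/-- A cut of maximum weight is stable. -/
theorem exists_isStable : ∃ side : V → Bool, IsStable G w side := by
  classical
  obtain ⟨s, -, hs⟩ := Finset.exists_max_image Finset.univ
    (fun s : V → Bool => ∑ v, crossWeight G w s v) Finset.univ_nonempty
  refine ⟨s, fun v => ?_⟩
  -- Twice the weight of the cut, with the edges at `v` split off; these are counted from both ends.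
  -- Moving `v` to the other side changes only this second term, from the crossing weight at `v` to
  -- the rest of its degree.
  have key : ∀ s : V → Bool, ∑ v, crossWeight G w s v =
      (∑ u ∈ Finset.univ.erase v, ∑ t ∈ Finset.univ.erase v,
        if s t = s u then 0 else pairWeight G w u t) + 2 * crossWeight G w s v := by
    intro s
    have h1 : ∀ u, crossWeight G w s u = (if s v = s u then 0 else pairWeight G w u v) +
        ∑ t ∈ Finset.univ.erase v, if s t = s u then 0 else pairWeight G w u t := fun u => by
      rw [crossWeight_eq, ← Finset.add_sum_erase _ _ (Finset.mem_univ v)]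
    have h2 : crossWeight G w s v =
        ∑ u ∈ Finset.univ.erase v, if s v = s u then 0 else pairWeight G w u v := by
      rw [h1 v, if_pos rfl, zero_add]
      refine Finset.sum_congr rfl fun u _ => ?_
      rw [pairWeight_comm]
      simp only [eq_comm]
    rw [← Finset.add_sum_erase _ _ (Finset.mem_univ v),
      Finset.sum_congr rfl fun u _ => h1 u, Finset.sum_add_distrib, ← h2]
    ring
  have hflip := hs (Function.update s v (!s v)) (Finset.mem_univ _)
  rw [key, key s] at hflip
  have h3 : (∑ u ∈ Finset.univ.erase v, ∑ t ∈ Finset.univ.erase v,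
      if Function.update s v (!s v) t = Function.update s v (!s v) u then 0 else pairWeight G w u t)
      = ∑ u ∈ Finset.univ.erase v, ∑ t ∈ Finset.univ.erase v,
        if s t = s u then 0 else pairWeight G w u t :=
    Finset.sum_congr rfl fun u hu => Finset.sum_congr rfl fun t ht => by
      rw [Function.update_of_ne (Finset.ne_of_mem_erase hu),
        Function.update_of_ne (Finset.ne_of_mem_erase ht)]
  have h4 : weightedDegree G w v =
      crossWeight G w (Function.update s v (!s v)) v + crossWeight G w s v := by
    rw [weightedDegree_eq, crossWeight_eq, crossWeight_eq, ← Finset.sum_add_distrib]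
    refine Finset.sum_congr rfl fun u _ => ?_
    by_cases hu : u = v
    · subst hu
      simp [pairWeight]
    · rw [Function.update_of_ne hu, Function.update_self]
      cases s u <;> cases s v <;> simp
  rw [div_le_iff₀ (by norm_num)]
  exact_mod_cast (by omega : weightedDegree G w v ≤ crossWeight G w s v * 2)

end StableCut

/-! ### The instances as data of the machine -/

/-- Least number `k` with `N < 2 ^ k`, computed by doubling, together with `2 ^ k`. -/
def doubling (N : ℕ) : ℕ × ℕ :=
  (fun s : ℕ × ℕ => if s.2 ≤ N then (s.1 + 1, 2 * s.2) else s)^[N + 1] (0, 1)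

/-- As long as the power is at most `N`, no step has been idle; after N + 1 steps this would mean
2^(N+1) ≤ N. -/
theorem doubling_iterate (N j : ℕ) :
    let s := (fun s : ℕ × ℕ => if s.2 ≤ N then (s.1 + 1, 2 * s.2) else s)^[j] (0, 1)
    s.2 = 2 ^ s.1 ∧ s.1 ≤ j ∧ s.2 ≤ 2 * N + 1 ∧ (s.2 ≤ N → s.1 = j) := by
  induction j with
  | zero => simp
  | succ j ih =>
    simp only [Function.iterate_succ_apply'] at *
    obtain ⟨h1, h2, h3, h4⟩ := ih
    split_ifs with h
    · have := h4 h
      refine ⟨?_, ?_, ?_, ?_⟩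
      · simp only [h1, pow_succ]; ring
      · simp only; omega
      · simp only; omega
      · simp only; omega
    · exact ⟨h1, by omega, h3, fun h' => absurd h' h⟩

theorem lt_two_pow_doubling (N : ℕ) : N < 2 ^ (doubling N).1 := by
  obtain ⟨h1, h2, h3, h4⟩ := doubling_iterate N (N + 1)
  unfold doubling
  rw [← h1]
  by_contra h
  have h5 := h4 (by omega)
  rw [h5] at h1
  have : N + 1 < 2 ^ (N + 1) := Nat.lt_two_pow_self
  omega

theorem two_pow_doubling_le (N : ℕ) : 2 ^ (doubling N).1 ≤ 2 * N + 1 := by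
  obtain ⟨h1, h2, h3, h4⟩ := doubling_iterate N (N + 1)
  unfold doubling
  rwa [← h1]

theorem doubling_le (N : ℕ) : (doubling N).1 ≤ N + 1 := (doubling_iterate N (N + 1)).2.1

theorem PT.doubling {α : Type} [Enc α] {m N : α → ℕ} (hm : PolyBdd m (fun a => sz a)) (hN : PT m N)
    (hb : PolyBdd m N) : PT m fun a => (doubling (N a)).1 := by
  unfold MinStableCut.doubling
  refine fst (iterate (B := fun a => (N a + 3) + (2 * N a + 2) + 1)
    (f := fun a (s : ℕ × ℕ) => if s.2 ≤ N a then (s.1 + 1, 2 * s.2) else s)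
    hm (hN.add (const_nat 1)) (hb.add (.const m 1))
    ((const_nat 0).pair (const_nat 1)) (ite_prop (var.snd.le hN.lift)
      ((var.fst.add (const_nat 1)).pair ((const_nat 2).mul var.snd)) var) ?_ fun a j hj => ?_)
  · exact ((hb.add (.const m 3)).add (((PolyBdd.const m 2).mul hb).add (.const m 2))).add
      (.const m 1)
  · obtain ⟨h1, h2, h3, h4⟩ := doubling_iterate (N a) j
    generalize (fun s : ℕ × ℕ => if s.2 ≤ N a then (s.1 + 1, 2 * s.2) else s)^[j] (0, 1) = s at *
    have h5 : sz s = sz s.1 + sz s.2 + 1 := rfl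
    have h6 := sz_nat_le s.1
    have h7 := sz_nat_le s.2
    omega

/-- An instance of the problem. -/
structure Inst where
  n : ℕ
  N : ℕ
  G : SimpleGraph (Fin n)
  w : Sym2 (Fin n) → ℕ
  D : TreeDecomposition G N
  ε : ℚ
  ε_pos : 0 < ε

noncomputable instance : Enc Inst := ⟨fun I => encodeInput I.G I.w I.D I.ε⟩

namespace Inst

variable (I : Inst)

open Classical in
/-- The adjacency lists of the graph. -/
noncomputable def adj : List (List (ℕ × ℕ)) :=
  (List.finRange I.n).map fun v => ((List.finRange I.n).filter fun u => I.G.Adj v u).map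
    fun u : Fin I.n => ((u : ℕ), I.w s(v, u))

open Classical in
/-- The neighbour lists and bags of the tree decomposition. -/
noncomputable def dec : List (List ℕ × List ℕ) :=
  (List.finRange I.N).map fun i =>
    (((List.finRange I.N).filter fun j => I.D.tree.Adj i j).map fun j : Fin I.N => (j : ℕ),
      ((List.finRange I.n).filter fun v => v ∈ I.D.bag i).map fun v : Fin I.n => (v : ℕ))

/-- The components of the input. -/
noncomputable def raw : ℕ × ℕ × List (List (ℕ × ℕ)) × List (List ℕ × List ℕ) × ℕ × ℕ × ℕ :=
  (I.n, I.N, I.adj, I.dec, I.ε.num.toNat, I.ε.den, 0)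

/-- A list is a nested pair closed by 0, so the final 0 of the tuple plays the role of the end of
the list. -/
theorem enc_raw : Enc.enc I.raw = Enc.enc I := by
  have h1 : Enc.enc I.adj = encodeGraph I.G I.w := by
    simp only [Enc.enc, adj, encodeGraph, List.map_map, Function.comp_def]
  have h2 : Enc.enc I.dec = encodeDecomposition I.D := by
    simp only [Enc.enc, dec, encodeDecomposition, List.map_map, Function.comp_def]
  have h3 : Enc.enc I = encodeInput I.G I.w I.D I.ε := rfl
  rw [h3, raw, encodeInput, ← h1, ← h2]
  rfl

/-- The neighbours of a node. -/
noncomputable def nb (i : ℕ) : List ℕ := (I.dec.getD i ([], [])).1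

/-- The maximum size of a bag. -/
noncomputable def b : ℕ :=
  ((List.range (I.n + 1)).filter fun k => I.dec.all fun e => decide (e.2.length ≤ k)).getD 0 0

noncomputable def rounds : ℕ := (doubling I.N).1 * ((doubling I.N).1 + 1)

/-- The data for the dynamic program. -/
noncomputable def data : Data where
  adj := I.adj
  dec := I.dec
  ord := dfsOrder I.N I.nb
  b := I.b
  -- Chosen so that (R+1)/q ≤ ε/2; the final + 1 undoes the rounding of the quotient.
  q := 2 * (I.rounds + 1) * I.ε.den / I.ε.num.toNat + 1
  R := I.rounds

/-- In trivial instances every cut is nearly stable. -/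
noncomputable def isTrivial : Bool := decide (I.b ≤ 1) || decide (I.ε.den ≤ I.ε.num.toNat)

/-- The output of the algorithm. -/
noncomputable def solution : List ℕ :=
  if I.isTrivial = true then vec I.n fun _ => 0 else I.data.output

/-! ### The data of an instance describe its graph and tree decomposition -/

variable {I}

theorem length_adj : I.adj.length = I.n := by simp [adj]

theorem length_dec : I.dec.length = I.N := by simp [dec]

theorem data_n : I.data.n = I.n := length_adj

theorem data_N : I.data.N = I.N := length_dec

theorem sum_map_filter {γ : Type} (l : List γ) (p : γ → Bool) (f : γ → ℕ) :
    ((l.filter p).map f).sum = (l.map fun a => if p a = true then f a else 0).sum := by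
  induction l with
  | nil => rfl
  | cons a l ih => by_cases h : p a = true <;> simp [h, ih]

theorem wt_eq (u v : Fin I.n) : I.data.wt u v = pairWeight I.G I.w u v := by
  classical
  have h1 : I.data.adj.getD u [] = ((List.finRange I.n).filter fun t => I.G.Adj u t).map
      fun t : Fin I.n => ((t : ℕ), I.w s(u, t)) := by
    simp [data, adj, List.getD_eq_getElem?_getD]
  rw [Data.wt, h1, sum_map_filter, List.map_map, sum_map_filter, ← Fin.sum_univ_def,
    Finset.sum_eq_single v]
  · simp [pairWeight]
  · intro t _ ht
    have : (t : ℕ) ≠ v := fun h => ht (Fin.ext h)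
    simp [this]
  · simp

theorem wt_eq_zero {u v : ℕ} (h : ¬ (u < I.n ∧ v < I.n)) : I.data.wt u v = 0 := by
  classical
  by_cases hu : u < I.n
  · have hv : ¬ v < I.n := fun hv => h ⟨hu, hv⟩
    have h1 : I.data.adj.getD u [] = ((List.finRange I.n).filter fun t => I.G.Adj ⟨u, hu⟩ t).map
        fun t : Fin I.n => ((t : ℕ), I.w s(⟨u, hu⟩, t)) := by
      simp [data, adj, List.getD_eq_getElem?_getD, hu]
    rw [Data.wt, h1, sum_map_filter, List.map_map, sum_map_filter, ← Fin.sum_univ_def]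
    refine Finset.sum_eq_zero fun t _ => ?_
    have : (t : ℕ) ≠ v := fun h => hv (h ▸ t.2)
    simp [this]
  · have h1 : I.data.adj.getD u [] = [] := by
      rw [List.getD_eq_default]
      rw [show I.data.adj = I.adj from rfl, length_adj]
      omega
    rw [Data.wt, h1]
    simp

theorem mem_bag {i v : ℕ} : v ∈ I.data.bag i ↔
    ∃ (hi : i < I.N) (hv : v < I.n), (⟨v, hv⟩ : Fin I.n) ∈ I.D.bag ⟨i, hi⟩ := by
  classical
  have hdec : I.data.dec = I.dec := rfl
  by_cases hi : i < I.N
  · have h1 : I.data.bag i = ((List.finRange I.n).filter fun v => v ∈ I.D.bag ⟨i, hi⟩).map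
        fun v : Fin I.n => (v : ℕ) := by
      simp [Data.bag, hdec, dec, List.getD_eq_getElem?_getD, hi]
    rw [h1]
    simp only [List.mem_map, List.mem_filter, List.mem_finRange, true_and, decide_eq_true_eq]
    constructor
    · rintro ⟨t, ht, rfl⟩
      exact ⟨hi, t.2, ht⟩
    · rintro ⟨_, hv, h⟩
      exact ⟨_, h, rfl⟩
  · have h1 : I.data.bag i = [] := by
      rw [Data.bag, hdec, List.getD_eq_default _ _ (by rw [length_dec]; omega)]
    rw [h1]
    simp [hi]

theorem mem_nb (i j : ℕ) : j ∈ I.nb i ↔ NodeAdj I.D.tree i j := by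
  classical
  unfold NodeAdj
  by_cases hi : i < I.N
  · have h1 : I.nb i = ((List.finRange I.N).filter fun j => I.D.tree.Adj ⟨i, hi⟩ j).map
        fun j : Fin I.N => (j : ℕ) := by
      simp [nb, dec, List.getD_eq_getElem?_getD, hi]
    rw [h1]
    simp only [List.mem_map, List.mem_filter, List.mem_finRange, true_and, decide_eq_true_eq]
    constructor
    · rintro ⟨t, ht, rfl⟩
      exact ⟨hi, t.2, ht⟩
    · rintro ⟨_, hv, h⟩
      exact ⟨_, h, rfl⟩
  · have h1 : I.nb i = [] := by
      rw [nb, List.getD_eq_default _ _ (by rw [length_dec]; omega)]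
    rw [h1]
    simp [hi]

theorem N_pos : 0 < I.N := by
  obtain ⟨i⟩ := I.D.isTree.1.nonempty
  exact i.pos

theorem b_spec : (∀ e ∈ I.dec, e.2.length ≤ I.b) ∧
    ∀ k, (∀ e ∈ I.dec, e.2.length ≤ k) → I.b ≤ k := by
  classical
  set P : ℕ → Bool := fun k => I.dec.all fun e => decide (e.2.length ≤ k) with hP
  have hPiff : ∀ k, P k = true ↔ ∀ e ∈ I.dec, e.2.length ≤ k := fun k => by simp [hP]
  have hn : P I.n = true := by
    rw [hPiff]
    intro e he
    simp only [dec, List.mem_map] at he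
    obtain ⟨i, -, rfl⟩ := he
    simpa using List.length_filter_le (fun v => decide (v ∈ I.D.bag i)) (List.finRange I.n)
  have hmem : I.n ∈ (List.range (I.n + 1)).filter P := by simp [hn]
  have hsorted : ((List.range (I.n + 1)).filter P).Pairwise (· < ·) :=
    List.pairwise_lt_range.filter _
  have hb : I.b = ((List.range (I.n + 1)).filter P).getD 0 0 := rfl
  generalize hl : (List.range (I.n + 1)).filter P = l at *
  cases l with
  | nil => simp at hmem
  | cons a l =>
    rw [List.getD_cons_zero] at hb
    have ha : a ∈ (List.range (I.n + 1)).filter P := by simp [hl]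
    rw [List.mem_filter] at ha
    refine ⟨by rw [hb]; exact (hPiff a).1 ha.2, fun k hk => ?_⟩
    rw [hb]
    by_cases hkn : k ≤ I.n
    · have hk' : k ∈ a :: l := by
        rw [← hl]
        simp only [List.mem_filter, List.mem_range]
        exact ⟨by omega, (hPiff k).2 hk⟩
      rcases List.mem_cons.1 hk' with rfl | hk'
      · exact le_rfl
      · exact ((List.pairwise_cons.1 hsorted).1 k hk').le
    · have := List.mem_range.1 ha.1
      omega

theorem length_bag (i : Fin I.N) : (I.data.bag i).length = (I.D.bag i).card := by
  classical
  have h1 : I.data.bag i = ((List.finRange I.n).filter fun v => v ∈ I.D.bag i).map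
      fun v : Fin I.n => (v : ℕ) := by
    simp [Data.bag, show I.data.dec = I.dec from rfl, dec, List.getD_eq_getElem?_getD]
  rw [h1, List.length_map, ← List.toFinset_card_of_nodup ((List.nodup_finRange _).filter _)]
  congr 1
  ext v
  simp

theorem bag_le (i : ℕ) : (I.data.bag i).length ≤ I.b := by
  rw [Data.bag, show I.data.dec = I.dec from rfl, List.getD_eq_getElem?_getD]
  by_cases hi : i < I.dec.length
  · rw [List.getElem?_eq_getElem hi]
    exact b_spec.1 _ (List.getElem_mem hi)
  · rw [List.getElem?_eq_none (by omega)]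
    simp

theorem card_bag_le (i : Fin I.N) : (I.D.bag i).card ≤ I.b := length_bag i ▸ bag_le i

theorem b_le : I.b ≤ I.D.width + 1 := by
  classical
  refine b_spec.2 _ fun e he => ?_
  obtain ⟨j, hj, rfl⟩ := List.getElem_of_mem he
  have hj' : j < I.N := by rwa [length_dec] at hj
  have h1 := length_bag (I := I) ⟨j, hj'⟩
  rw [Data.bag, show I.data.dec = I.dec from rfl, List.getD_eq_getElem?_getD,
    List.getElem?_eq_getElem hj] at h1
  have h2 := Finset.le_sup (f := fun i => (I.D.bag i).card) (Finset.mem_univ (⟨j, hj'⟩ : Fin I.N))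
  simp only [Option.getD_some] at h1
  rw [h1]
  unfold TreeDecomposition.width
  omega

theorem valid : I.data.Valid where
  cover u v h := by
    by_cases huv : u < I.n ∧ v < I.n
    · obtain ⟨hu, hv⟩ := huv
      have h1 := wt_eq (I := I) ⟨u, hu⟩ ⟨v, hv⟩
      simp only at h1
      have hadj : I.G.Adj ⟨u, hu⟩ ⟨v, hv⟩ := by
        by_contra hadj
        rw [h1, pairWeight, if_neg hadj] at h
        exact h rfl
      obtain ⟨i, hi, hi'⟩ := I.D.exists_edge_bag _ _ hadj
      exact ⟨i, by rw [data_N]; exact i.2, Data.inBag_iff.2 (mem_bag.2 ⟨i.2, hu, hi⟩),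
        Data.inBag_iff.2 (mem_bag.2 ⟨i.2, hv, hi'⟩)⟩
    · exact absurd (wt_eq_zero huv) h
  lt_n i v h := by
    obtain ⟨-, hv, -⟩ := mem_bag.1 (Data.inBag_iff.1 h)
    rwa [data_n]

theorem layout : I.data.Layout (NodeAdj I.D.tree) where
  nodup := (grown_dfsOrder I.D.isTree N_pos mem_nb).1.nodup
  mem_ord i := by
    rw [data_N]
    exact (grown_dfsOrder I.D.isTree N_pos mem_nb).2 i
  symm := fun _ _ ⟨hi, hj, h⟩ => ⟨hj, hi, h.symm⟩
  conn F v h := by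
    obtain ⟨h1, h2⟩ := Data.inB_iff.1 h
    obtain ⟨i, -, hiF, hiv⟩ := Data.inV_iff.1 h1
    obtain ⟨j, -, hjF, hjv⟩ := Data.outV_iff.1 h2
    obtain ⟨hi, hv, hiv⟩ := mem_bag.1 (Data.inBag_iff.1 hiv)
    obtain ⟨hj, _, hjv⟩ := mem_bag.1 (Data.inBag_iff.1 hjv)
    -- The nodes whose bags contain `v` induce a connected graph that meets both `F` and its
    -- complement.
    obtain ⟨x, hx, y, hy, hxy⟩ := exists_adj_leaving (I.D.connected ⟨v, hv⟩).preconnected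
      (S := {c | ((c : Fin I.N) : ℕ) ∈ F}) (a := ⟨⟨i, hi⟩, hiv⟩) (b := ⟨⟨j, hj⟩, hjv⟩)
      (ind_pos.1 hiF) (ind_eq_zero.1 hjF)
    exact ⟨x.1, hx, y.1, hy, ⟨x.1.2, y.1.2, hxy⟩, mem_bag.2 ⟨x.1.2, hv, x.2⟩,
      mem_bag.2 ⟨y.1.2, hv, y.2⟩⟩
  bag_le := bag_le

theorem der : I.data.Der (Finset.range I.data.N) (I.data.R + 1) :=
  layout.der_range data_N I.D.isTree N_pos mem_nb rfl (lt_two_pow_doubling I.N)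

/-! ### Cuts of the graph and cuts of the data -/

theorem rsum_wt (v : Fin I.n) :
    rsum I.data.n (fun u => I.data.wt v u) = weightedDegree I.G I.w v := by
  rw [rsum_eq, data_n, Finset.sum_range, weightedDegree_eq]
  exact Finset.sum_congr rfl fun u _ => wt_eq v u

variable {x : ℕ → ℕ} {s : Fin I.n → Bool}

theorem rsum_cross (hx : ∀ v : Fin I.n, x v = (s v).toNat) (v : Fin I.n) :
    rsum I.data.n (fun u => if x u = x v then 0 else I.data.wt v u) =
      crossWeight I.G I.w s v := by
  rw [rsum_eq, data_n, Finset.sum_range, crossWeight_eq]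
  refine Finset.sum_congr rfl fun u _ => ?_
  rw [hx, hx, wt_eq]
  cases s u <;> cases s v <;> simp

theorem totalCost_eq (hx : ∀ v : Fin I.n, x v = (s v).toNat) :
    I.data.totalCost x = cutWeight I.G I.w s := by
  rw [Data.totalCost, rsum_eq, data_n, Finset.sum_range, cutWeight_eq]
  refine Finset.sum_congr rfl fun u _ => ?_
  rw [rsum_eq, Finset.sum_range]
  refine Finset.sum_congr rfl fun v _ => ?_
  rw [hx, hx, wt_eq]
  cases s u <;> cases s v <;> simp

/-- A cut as a function on the natural numbers. -/
def extend {n : ℕ} (side : Fin n → Bool) (v : ℕ) : ℕ :=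
  if h : v < n then (side ⟨v, h⟩).toNat else 0

theorem extend_apply {n : ℕ} (side : Fin n → Bool) (v : Fin n) :
    extend side v = (side v).toNat := by
  simp [extend]

theorem stable_extend (h : IsStable I.G I.w s) : I.data.Stable (extend s) := by
  refine ⟨fun v => ?_, fun v => ?_⟩
  · unfold extend
    split_ifs
    · exact Bool.toNat_le _
    · omega
  · by_cases hv : v < I.n
    · have h1 := rsum_wt (I := I) ⟨v, hv⟩
      have h2 := rsum_cross (extend_apply s) ⟨v, hv⟩
      simp only at h1 h2
      rw [h1, h2]
      have h3 := h ⟨v, hv⟩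
      rw [div_le_iff₀ (by norm_num)] at h3
      have h4 : weightedDegree I.G I.w ⟨v, hv⟩ ≤ crossWeight I.G I.w s ⟨v, hv⟩ * 2 := by
        exact_mod_cast h3
      omega
    · rw [rsum_eq_zero fun u => wt_eq_zero fun h => hv h.1]
      omega

/-- The cut that is returned. -/
noncomputable def side (I : Inst) (v : Fin I.n) : Bool := decide (get0 I.solution v ≠ 0)

theorem num_pos : 0 < I.ε.num.toNat := by
  have := Rat.num_pos.2 I.ε_pos
  omega

theorem eps_eq : I.ε = (I.ε.num.toNat : ℚ) / I.ε.den := by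
  have h1 : ((I.ε.num.toNat : ℤ) : ℚ) = I.ε.num := by
    rw [Int.toNat_of_nonneg (Rat.num_pos.2 I.ε_pos).le]
  rw [← Int.cast_natCast, h1]
  exact (Rat.num_div_den I.ε).symm

theorem solution_spec : I.solution.length = I.n ∧ (∀ v, get0 I.solution v ≤ 1) ∧
    (∀ v : Fin I.n, (1 - I.ε) * (weightedDegree I.G I.w v : ℚ) / 2 ≤
      (crossWeight I.G I.w I.side v : ℚ)) ∧
    ∀ side', IsStable I.G I.w side' → cutWeight I.G I.w I.side ≤ cutWeight I.G I.w side' := by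
  have hden : (0 : ℚ) < I.ε.den := by exact_mod_cast I.ε.den_pos
  have hnum : (0 : ℚ) < I.ε.num.toNat := by exact_mod_cast num_pos
  by_cases ht : I.isTrivial = true
  · have hsol : I.solution = vec I.n fun _ => 0 := if_pos ht
    have h0 : ∀ v, get0 I.solution v = 0 := fun v => by rw [hsol, get0_vec, ite_self]
    have hside : ∀ v, I.side v = false := fun v => by simp [side, h0]
    refine ⟨by rw [hsol, length_vec], fun v => by rw [h0]; omega, fun v => ?_, fun side' _ => ?_⟩
    · have hc : (0 : ℚ) ≤ crossWeight I.G I.w I.side v := Nat.cast_nonneg _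
      have hd : (0 : ℚ) ≤ weightedDegree I.G I.w v := Nat.cast_nonneg _
      simp only [isTrivial, Bool.or_eq_true, decide_eq_true_eq] at ht
      rcases ht with ht | ht
      -- An edge would give a bag with two vertices, but all bags have at most one.
      · have hdeg : weightedDegree I.G I.w v = 0 := by
          rw [weightedDegree_eq]
          refine Finset.sum_eq_zero fun u _ => if_neg fun hadj => ?_
          obtain ⟨i, h1, h2⟩ := I.D.exists_edge_bag _ _ hadj
          have := Finset.one_lt_card.2 ⟨_, h1, _, h2, hadj.ne⟩
          have := card_bag_le i
          omega
        rw [hdeg]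
        simp
      · have : 1 ≤ I.ε := by
          rw [eps_eq, le_div_iff₀ hden, one_mul]
          exact_mod_cast ht
        nlinarith
    · rw [cutWeight_eq]
      simp [hside]
  · have hsol : I.solution = I.data.output := if_neg ht
    obtain ⟨s₀, hs₀⟩ := exists_isStable I.G I.w
    obtain ⟨h1, h2, h3, h4⟩ := Data.output_spec valid der (stable_extend hs₀)
    rw [← hsol] at h1 h2 h3 h4
    have hx : ∀ v : Fin I.n, get0 I.solution v = (I.side v).toNat := fun v => by
      have := h2 v
      unfold side
      by_cases h : get0 I.solution v = 0
      · simp [h]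
      · have : get0 I.solution v = 1 := by omega
        simp [this]
    refine ⟨h1.trans data_n, h2, fun v => ?_, fun side' hs => ?_⟩
    · have h5 := h3 v (by rw [data_n]; exact v.2)
      rw [rsum_wt, rsum_cross hx] at h5
      set d := weightedDegree I.G I.w v
      set c := crossWeight I.G I.w I.side v
      -- Turns the slack of 2(R+1)·deg in the guarantee of the dynamic program into at most qε·deg.
      have hq : (2 * (I.rounds + 1) : ℚ) ≤ I.data.q * I.ε := by
        have h6 : 2 * (I.rounds + 1) * I.ε.den < I.data.q * I.ε.num.toNat := by
          have := Nat.lt_div_mul_add (num_pos (I := I)) (a := 2 * (I.rounds + 1) * I.ε.den)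
          simp only [data]
          rw [add_mul, one_mul]
          exact this
        have h7 : (2 * (I.rounds + 1) * I.ε.den : ℚ) ≤ I.data.q * I.ε.num.toNat := by
          exact_mod_cast h6.le
        rw [eps_eq, ← mul_div_assoc, le_div_iff₀ hden]
        exact h7
      have h8 : (I.data.q : ℚ) * d ≤ 2 * I.data.q * c + 2 * (I.rounds + 1) * d := by
        exact_mod_cast h5
      have hqpos : (0 : ℚ) < I.data.q := by
        have : 0 < I.data.q := Nat.succ_pos _
        exact_mod_cast this
      have h9 := mul_le_mul_of_nonneg_right hq (Nat.cast_nonneg (α := ℚ) d)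
      have h10 : (I.data.q : ℚ) * ((1 - I.ε) * d) ≤ I.data.q * (2 * c) := by linarith
      have h11 := le_of_mul_le_mul_left h10 hqpos
      linarith
    · have h5 := h4 _ (stable_extend hs)
      rwa [totalCost_eq hx, totalCost_eq (extend_apply side')] at h5

theorem encodeCut_side : encodeCut I.side = Enc.enc I.solution := by
  obtain ⟨h1, h2, -⟩ := solution_spec (I := I)
  have h3 : I.solution = (List.finRange I.n).map fun v => (I.side v).toNat := by
    refine List.ext_getElem (by simp [h1]) fun i hi hi' => ?_
    have h4 : get0 I.solution i = I.solution[i] := by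
      rw [get0, List.getD_eq_getElem?_getD, List.getElem?_eq_getElem hi]; rfl
    have h5 := h2 i
    rw [List.getElem_map, List.getElem_finRange]
    unfold side
    simp only [Fin.val_cast]
    rw [← h4]
    by_cases h : get0 I.solution i = 0
    · simp [h]
    · have : get0 I.solution i = 1 := by omega
      simp [this]
  rw [h3]
  simp only [Enc.enc, encodeCut, List.map_map, Function.comp_def]

/-! ### Running time of the algorithm -/

/-- The size of an instance. -/
noncomputable def inputSize (I : Inst) : ℕ := sz I + I.n + I.N

/-- The measure in which the running time is polynomial. -/
noncomputable def measure (I : Inst) : ℕ :=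
  -- For trivial instances the permitted time need not cover the number of keys: for width 0 its
  -- first factor is constant although q grows with 1/ε, and for large ε its base may be 1.
  I.inputSize + if I.isTrivial = true then 0 else I.data.keyBound

theorem sz_bdd : PolyBdd inputSize (fun I => sz I) :=
  .le_self fun I => by unfold inputSize; omega

theorem n_bdd : PolyBdd inputSize (fun I => I.n) :=
  .le_self fun I => by unfold inputSize; omega

theorem N_bdd : PolyBdd inputSize (fun I => I.N) :=
  .le_self fun I => by unfold inputSize; omega

theorem pt_raw : PT inputSize raw := .of_enc enc_raw sz_bdd
theorem pt_n : PT inputSize n := pt_raw.fst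
theorem pt_N : PT inputSize N := pt_raw.snd.fst
theorem pt_adj : PT inputSize adj := pt_raw.snd.snd.fst
theorem pt_dec : PT inputSize dec := pt_raw.snd.snd.snd.fst
theorem pt_num : PT inputSize fun I => I.ε.num.toNat := pt_raw.snd.snd.snd.snd.fst
theorem pt_den : PT inputSize fun I => I.ε.den := pt_raw.snd.snd.snd.snd.snd.fst

theorem pt_b : PT inputSize b := by
  unfold b
  exact PT.getD (PT.filter sz_bdd (PT.range (pt_n.add (.const_nat 1)) (n_bdd.add (.const _ 1)))
    (PT.all sz_bdd.ext pt_dec.lift (PT.le PT.var.snd.length PT.var.lift))) (.const_nat 0)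
    (.const_nat 0)

theorem pt_rounds : PT inputSize rounds := by
  have := PT.doubling sz_bdd pt_N N_bdd
  unfold rounds
  exact this.mul (this.add (.const_nat 1))

theorem rounds_bdd : PolyBdd inputSize rounds :=
  ((N_bdd.add (.const _ 1)).mul ((N_bdd.add (.const _ 1)).add (.const _ 1))).mono fun I =>
    Nat.mul_le_mul (doubling_le I.N) (Nat.succ_le_succ (doubling_le I.N))

theorem pt_grow {α : Type} [Enc α] {m : α → ℕ} {I : α → Inst} {L : α → List ℕ}
    (hm : PolyBdd m (fun a => sz a)) (hI : PT m fun a => (I a).dec) (hL : PT m L) :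
    PT m fun a => grow (I a).nb (L a) := by
  have hf : PT m fun a => fringe (I a).nb (L a) := by
    unfold fringe nb
    exact PT.flatMap hm hL (PT.map hm.ext (PT.filter hm.ext (hI.lift.getD PT.var
      (PT.nil.pair PT.nil)).fst (PT.any hm.ext.ext hL.lift.lift (PT.var.eq PT.var.lift)).not)
      (PT.var.pair PT.var.lift))
  have h0 := hf.getD (.const_nat 0) ((PT.const_nat 0).pair (PT.const_nat 0))
  unfold grow insAfter
  exact PT.ite_prop (hf.length.eq (.const_nat 0)) hL (PT.flatMap hm hL (PT.ite_prop
    (PT.var.eq h0.lift.snd) (PT.var.cons (h0.lift.fst.cons .nil)) (PT.var.cons .nil)))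

theorem pt_ord : PT inputSize fun I => dfsOrder I.N I.nb := by
  unfold dfsOrder
  refine PT.iterate (B := fun I => I.N * (I.N + 1 + 1) + 1) sz_bdd pt_N N_bdd
    ((PT.const_nat 0).cons .nil) (pt_grow sz_bdd.ext pt_dec.lift PT.var) ?_ fun I j _ => ?_
  · exact (N_bdd.mul ((N_bdd.add (.const _ 1)).add (.const _ 1))).add (.const _ 1)
  · obtain ⟨h, -⟩ := grown_iterate I.D.isTree N_pos mem_nb j
    refine (sz_list_le (B := I.N + 1) fun i hi => (sz_nat_le i).trans ?_).trans ?_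
    · have := h.lt i hi
      omega
    · have := Nat.mul_le_mul_right (I.N + 1 + 1) h.length_le
      omega

theorem pt_data : PT inputSize data :=
  (pt_adj.pair (pt_dec.pair (pt_ord.pair (pt_b.pair (((((PT.const_nat 2).mul
    (pt_rounds.add (.const_nat 1))).mul pt_den).div pt_num |>.add (.const_nat 1)).pair
      pt_rounds))))).cast fun _ => rfl

theorem pt_isTrivial : PT inputSize isTrivial := (pt_b.le (.const_nat 1)).or (pt_den.le pt_num)

theorem inputSize_bdd : PolyBdd measure inputSize := .le_self fun I => by unfold measure; omega

theorem pt_solution : PT measure solution := by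
  refine PT.ite_sub (b := isTrivial) (f := fun I => vec I.1.n fun _ => 0)
    (g := fun I => I.1.data.output) (pt_isTrivial.mono_measure inputSize_bdd) ?_ ?_
    (fun I h => if_pos h) fun I h => if_neg (by simp [h])
  · exact ((PT.vec (f := fun _ _ => 0) sz_bdd pt_n n_bdd
      (.const_nat 0)).mono_measure inputSize_bdd).restrict _
  · obtain ⟨c, hc⟩ := sz_bdd.comp (f := fun I => I) inputSize_bdd
    obtain ⟨c', hc'⟩ := rounds_bdd.comp (f := fun I => I) inputSize_bdd
    refine PT.output (A := fun I => NodeAdj I.1.D.tree) ⟨c, fun I => hc I.1⟩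
      ((pt_data.mono_measure inputSize_bdd).restrict _) ⟨c', fun I => hc' I.1⟩
      (.le_self fun I => ?_) (fun I => valid) fun I => layout
    have := I.2
    simp [measure, this]

end Inst

/-! ### The bound on the running time -/

/-- Raise x/j ≤ exp(x/j) to the power j and use e < 4. With x about log N and j a multiple of the
width, this separates (log N)^tw into a function of tw and a polynomial in N. -/
theorem pow_le_pow_self_mul_four_pow (x : ℕ) {j : ℕ} (hj : 0 < j) : x ^ j ≤ j ^ j * 4 ^ x := by
  have hj' : (0 : ℝ) < j := by exact_mod_cast hj
  have h1 : (x : ℝ) / j ≤ Real.exp ((x : ℝ) / j) := by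
    have := Real.add_one_le_exp ((x : ℝ) / j)
    linarith
  have h2 : ((x : ℝ) / j) ^ j ≤ Real.exp x := by
    refine (pow_le_pow_left₀ (by positivity) h1 j).trans_eq ?_
    rw [← Real.exp_nat_mul]
    congr 1
    field_simp
  have h3 : Real.exp x ≤ 4 ^ x := by
    rw [← mul_one (x : ℝ), Real.exp_nat_mul]
    refine pow_le_pow_left₀ (Real.exp_pos _).le ?_ x
    have := Real.exp_one_lt_d9
    linarith
  rw [div_pow, div_le_iff₀ (by positivity)] at h2
  have h4 : (x : ℝ) ^ j ≤ j ^ j * 4 ^ x := by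
    calc (x : ℝ) ^ j ≤ Real.exp x * j ^ j := h2
      _ ≤ 4 ^ x * j ^ j := mul_le_mul_of_nonneg_right h3 (by positivity)
      _ = _ := mul_comm _ _
  exact_mod_cast h4

namespace Inst

/-- The parameter in which the running time is polynomial. -/
noncomputable def bits (I : Inst) : ℕ :=
  I.n + I.N + Nat.log 2 (maxWeight I.G I.w) + bitLength I.ε

/-- The parameter in which the running time is exponential. -/
noncomputable def ratio (I : Inst) : ℚ := max 1 ((I.D.width : ℚ) / I.ε)

variable {I : Inst}

theorem two_le_bitLength : 2 ≤ bitLength I.ε := by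
  have h1 := Nat.size_pos.2 (num_pos (I := I))
  have h2 := Nat.size_pos.2 I.ε.den_pos
  unfold bitLength
  omega

theorem one_le_ratio : 1 ≤ I.ratio := le_max_left _ _

theorem size_polynomial_le {y : ℕ} (hy : 2 ≤ y) :
    (y * ((y * ((2 * y + 1) + 1) + 1) + 1) + 1) +
      (y * ((2 * (y * (y + 1) + 1) + 1) + 1) + 1) + 6 * y + 11 ≤ 20 * y ^ 3 := by
  obtain ⟨z, rfl⟩ : ∃ z, y = z + 2 := ⟨y - 2, by omega⟩
  ring_nf
  nlinarith [sq_nonneg z, pow_nonneg (Nat.zero_le z) 3]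

theorem inputSize_le : I.inputSize ≤ 20 * I.bits ^ 3 := by
  classical
  have hY : I.bits = I.n + I.N + Nat.log 2 (maxWeight I.G I.w) + bitLength I.ε := rfl
  have h2 := two_le_bitLength (I := I)
  have hbl : bitLength I.ε = I.ε.num.toNat.size + I.ε.den.size := rfl
  set Y := I.bits
  have hn : ∀ v : Fin I.n, sz (v : ℕ) ≤ Y := fun v => (sz_nat_le v).trans (by omega)
  have hN : ∀ v : Fin I.N, sz (v : ℕ) ≤ Y := fun v => (sz_nat_le v).trans (by omega)
  have hadj : sz I.adj ≤ Y * ((Y * ((2 * Y + 1) + 1) + 1) + 1) + 1 := by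
    refine (sz_list_le (B := Y * ((2 * Y + 1) + 1) + 1) fun l hl => ?_).trans ?_
    · obtain ⟨v, -, rfl⟩ := List.mem_map.1 hl
      refine (sz_list_le (B := 2 * Y + 1) fun e he => ?_).trans ?_
      · obtain ⟨u, hu, rfl⟩ := List.mem_map.1 he
        have hvu : I.G.Adj v u := by simpa using (List.mem_filter.1 hu).2
        have hw : I.w s(v, u) ≤ maxWeight I.G I.w :=
          Finset.le_sup (f := I.w) (by simpa using hvu)
        have hsize : (I.w s(v, u)).size ≤ Nat.log 2 (maxWeight I.G I.w) + 1 :=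
          Nat.size_le.2 (hw.trans_lt (Nat.lt_pow_succ_log_self (by omega) _))
        have h3 := hn u
        rw [sz_pair, sz_nat (I.w s(v, u))]
        omega
      · refine Nat.add_le_add_right (Nat.mul_le_mul_right _ ?_) 1
        have := List.length_filter_le (fun u => decide (I.G.Adj v u)) (List.finRange I.n)
        simp only [List.length_map, List.length_finRange] at *
        omega
    · refine Nat.add_le_add_right (Nat.mul_le_mul_right _ ?_) 1
      rw [length_adj]
      omega
  have hdec : sz I.dec ≤ Y * ((2 * (Y * (Y + 1) + 1) + 1) + 1) + 1 := by
    refine (sz_list_le (B := 2 * (Y * (Y + 1) + 1) + 1) fun e he => ?_).trans ?_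
    · obtain ⟨i, -, rfl⟩ := List.mem_map.1 he
      have key : ∀ l : List ℕ, l.length ≤ Y → (∀ a ∈ l, sz a ≤ Y) → sz l ≤ Y * (Y + 1) + 1 :=
        fun l hl h => (sz_list_le h).trans (Nat.add_le_add_right (Nat.mul_le_mul_right _ hl) 1)
      have k1 := key (((List.finRange I.N).filter fun j => I.D.tree.Adj i j).map
        fun j : Fin I.N => (j : ℕ)) (by
          have := List.length_filter_le (fun j => decide (I.D.tree.Adj i j)) (List.finRange I.N)
          simp only [List.length_map, List.length_finRange] at *
          omega) (fun a ha => by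
          obtain ⟨j, -, rfl⟩ := List.mem_map.1 ha
          exact hN j)
      have k2 := key (((List.finRange I.n).filter fun v => v ∈ I.D.bag i).map
        fun v : Fin I.n => (v : ℕ)) (by
          have := List.length_filter_le (fun v => decide (v ∈ I.D.bag i)) (List.finRange I.n)
          simp only [List.length_map, List.length_finRange] at *
          omega) (fun a ha => by
          obtain ⟨j, -, rfl⟩ := List.mem_map.1 ha
          exact hn j)
      rw [sz_pair]
      omega
    · refine Nat.add_le_add_right (Nat.mul_le_mul_right _ ?_) 1
      rw [length_dec]
      omega
  have hraw : sz I = sz I.n + (sz I.N + (sz I.adj + (sz I.dec + (sz I.ε.num.toNat +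
      (sz I.ε.den + 1 + 1) + 1) + 1) + 1) + 1) + 1 := by
    have h3 : sz I = sz I.raw := by rw [sz, sz, enc_raw]
    have h4 : sz 0 = 1 := by simp [sz_nat]
    rw [h3, raw]
    simp only [sz_pair, h4]
  have e1 := sz_nat_le I.n
  have e2 := sz_nat_le I.N
  have e3 := sz_nat I.ε.num.toNat
  have e4 := sz_nat I.ε.den
  have hlin : I.inputSize ≤ sz I.adj + sz I.dec + 6 * Y + 11 := by
    unfold inputSize
    omega
  exact (hlin.trans (by omega)).trans (size_polynomial_le (show 2 ≤ Y by omega))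

/-- Nontriviality gives tw ≥ 1 and ε < 1, so both tw and 1/ε are at most the ratio M. The exponent
48 collects 4 from powers of q, 8 from powers of log N and 36 from constants. -/
theorem keyBound_le (ht : I.isTrivial ≠ true) : (I.data.keyBound : ℚ) ≤
    2 ^ 40 * (I.bits : ℚ) ^ 6 * I.ratio ^ (48 * I.D.width) := by
  simp only [isTrivial, ne_eq, Bool.or_eq_true, decide_eq_true_eq, not_or, not_le] at ht
  obtain ⟨hb, hε⟩ := ht
  have hbw := b_le (I := I)
  have hbl := two_le_bitLength (I := I)
  set tw := I.D.width with htw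
  set M := I.ratio with hM
  set Y := I.bits with hY
  set K := (doubling I.N).1 with hK
  have hM1 : 1 ≤ M := one_le_ratio
  have htw1 : 1 ≤ tw := by omega
  have hden : (0 : ℚ) < I.ε.den := by exact_mod_cast I.ε.den_pos
  have hnum : (0 : ℚ) < I.ε.num.toNat := by exact_mod_cast num_pos
  have hε1 : I.ε ≤ 1 := by
    rw [eps_eq, div_le_one hden]
    exact_mod_cast hε.le
  have hεpos := I.ε_pos
  have htwQ : (1 : ℚ) ≤ tw := by exact_mod_cast htw1
  have hMtw : (tw : ℚ) ≤ M := by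
    refine le_trans ?_ (le_max_right _ _)
    rw [le_div_iff₀ hεpos]
    nlinarith
  have hMε : 1 / I.ε ≤ M :=
    le_trans (div_le_div_of_nonneg_right htwQ hεpos.le) (le_max_right _ _)
  have hbase : (2 * ((I.data.q : ℚ) + 1)) ≤ 8 * ((K : ℚ) + 1) ^ 2 * M := by
    have h1 : (I.data.q : ℚ) ≤ 2 * (I.rounds + 1) * (1 / I.ε) + 1 := by
      have h2 := Nat.cast_div_le (α := ℚ) (m := 2 * (I.rounds + 1) * I.ε.den)
        (n := I.ε.num.toNat)
      have h3 : 1 / I.ε = I.ε.den / I.ε.num.toNat := by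
        conv_lhs => rw [eps_eq]
        rw [one_div_div]
      rw [h3, ← mul_div_assoc]
      simp only [data]
      push_cast at h2 ⊢
      linarith
    have h2 : (I.rounds : ℚ) = K * (K + 1) := by
      rw [rounds, ← hK]
      push_cast
      ring
    have hK0 : (0 : ℚ) ≤ K := Nat.cast_nonneg _
    have h3 : 2 * ((I.rounds : ℚ) + 1) * (1 / I.ε) ≤ 2 * (I.rounds + 1) * M :=
      mul_le_mul_of_nonneg_left hMε (by positivity)
    rw [h2] at h1 h3
    nlinarith [mul_nonneg hK0 (sub_nonneg.2 hM1),
      mul_nonneg (mul_nonneg hK0 hK0) (sub_nonneg.2 hM1)]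
  -- Bags have at most tw + 1 ≤ 2·tw vertices, so the exponent is at most 4·tw.
  have hpow : (2 * ((I.data.q : ℚ) + 1)) ^ (2 * I.b) ≤
      8 ^ (4 * tw) * ((K : ℚ) + 1) ^ (8 * tw) * M ^ (4 * tw) := by
    have h1 : (1 : ℚ) ≤ 2 * ((I.data.q : ℚ) + 1) := by
      have : (0 : ℚ) ≤ I.data.q := Nat.cast_nonneg _
      linarith
    calc (2 * ((I.data.q : ℚ) + 1)) ^ (2 * I.b) ≤ (2 * ((I.data.q : ℚ) + 1)) ^ (4 * tw) :=
          pow_le_pow_right₀ h1 (by omega)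
      _ ≤ (8 * ((K : ℚ) + 1) ^ 2 * M) ^ (4 * tw) := pow_le_pow_left₀ (by linarith) hbase _
      _ = _ := by
        rw [mul_pow, mul_pow, ← pow_mul]
        congr 3
        ring
  have hKpow : ((K : ℚ) + 1) ^ (8 * tw) ≤ 8 ^ (8 * tw) * M ^ (8 * tw) * (16 * (Y : ℚ) ^ 2) := by
    have h1 := pow_le_pow_self_mul_four_pow (K + 1) (j := 8 * tw) (by omega)
    have h2 : 4 ^ (K + 1) ≤ 16 * Y ^ 2 := by
      have h3 := two_pow_doubling_le I.N
      have h4 : 2 ^ K ≤ 2 * Y := by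
        rw [hY, bits]
        rw [← hK] at h3
        omega
      calc 4 ^ (K + 1) = 4 * (2 ^ K) ^ 2 := by rw [← pow_mul, mul_comm K, pow_mul]; ring
        _ ≤ 4 * (2 * Y) ^ 2 := Nat.mul_le_mul_left _ (Nat.pow_le_pow_left h4 2)
        _ = 16 * Y ^ 2 := by ring
    have h5 : ((K : ℚ) + 1) ^ (8 * tw) ≤ (8 * (tw : ℚ)) ^ (8 * tw) * (16 * (Y : ℚ) ^ 2) := by
      exact_mod_cast h1.trans (Nat.mul_le_mul_left _ h2)
    refine h5.trans (mul_le_mul_of_nonneg_right ?_ (by positivity))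
    rw [mul_pow]
    exact mul_le_mul_of_nonneg_left (pow_le_pow_left₀ (by positivity) hMtw _) (by positivity)
  have hconst : (8 : ℚ) ^ (4 * tw) * 8 ^ (8 * tw) ≤ 2 ^ 36 * M ^ (36 * tw) := by
    have h1 : (8 : ℚ) ^ (4 * tw) * 8 ^ (8 * tw) = 2 ^ (36 * tw) := by
      rw [← pow_add, show (8 : ℚ) = 2 ^ 3 by norm_num, ← pow_mul]
      congr 1
      ring
    rw [h1]
    -- A constant to the power tw is a constant for tw = 1, where M may be as small as 1, and a
    -- power of M for tw ≥ 2, where M ≥ 2.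
    rcases htw1.eq_or_lt with h2 | h2
    · rw [← h2]
      exact le_mul_of_one_le_right (by positivity) (one_le_pow₀ hM1)
    · have h3 : (2 : ℚ) ≤ M := le_trans (by exact_mod_cast h2) hMtw
      calc (2 : ℚ) ^ (36 * tw) ≤ M ^ (36 * tw) := pow_le_pow_left₀ (by norm_num) h3 _
        _ ≤ 2 ^ 36 * M ^ (36 * tw) := le_mul_of_one_le_left (by positivity) (by norm_num)
  have hNY : ((I.N : ℚ) + 1) ^ 4 ≤ (Y : ℚ) ^ 4 := by
    have : I.N + 1 ≤ Y := by rw [hY, bits]; omega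
    exact_mod_cast Nat.pow_le_pow_left this 4
  have hkey : (I.data.keyBound : ℚ) =
      ((I.N : ℚ) + 1) ^ 4 * (2 * ((I.data.q : ℚ) + 1)) ^ (2 * I.b) := by
    rw [Data.keyBound, data_N]
    push_cast
    rfl
  have hM0 : 0 < M := by linarith
  calc (I.data.keyBound : ℚ)
      ≤ (Y : ℚ) ^ 4 * (8 ^ (4 * tw) * (8 ^ (8 * tw) * M ^ (8 * tw) * (16 * (Y : ℚ) ^ 2)) *
          M ^ (4 * tw)) := by
        rw [hkey]
        refine mul_le_mul hNY (hpow.trans ?_) (by positivity) (by positivity)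
        exact mul_le_mul_of_nonneg_right (mul_le_mul_of_nonneg_left hKpow (by positivity))
          (by positivity)
    _ = 16 * (Y : ℚ) ^ 6 * M ^ (12 * tw) * (8 ^ (4 * tw) * 8 ^ (8 * tw)) := by
        rw [show 12 * tw = 8 * tw + 4 * tw by ring, pow_add]
        ring
    _ ≤ 16 * (Y : ℚ) ^ 6 * M ^ (12 * tw) * (2 ^ 36 * M ^ (36 * tw)) :=
        mul_le_mul_of_nonneg_left hconst (by positivity)
    _ = 2 ^ 40 * (Y : ℚ) ^ 6 * M ^ (48 * tw) := by
        rw [show 48 * tw = 12 * tw + 36 * tw by ring, pow_add]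
        ring

theorem measure_le : (I.measure : ℚ) + 2 ≤
    2 ^ 41 * (I.bits : ℚ) ^ 6 * I.ratio ^ (48 * I.D.width) := by
  have h1 : (I.inputSize : ℚ) ≤ 20 * (I.bits : ℚ) ^ 3 := by exact_mod_cast inputSize_le
  have hbits : (1 : ℚ) ≤ I.bits := by
    have := two_le_bitLength (I := I)
    have : 1 ≤ I.bits := by unfold bits; omega
    exact_mod_cast this
  have hM := one_le_pow₀ (one_le_ratio (I := I)) (n := 48 * I.D.width)
  have h36 : (I.bits : ℚ) ^ 3 ≤ (I.bits : ℚ) ^ 6 := pow_le_pow_right₀ hbits (by norm_num)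
  have h6 : (1 : ℚ) ≤ (I.bits : ℚ) ^ 6 := one_le_pow₀ hbits
  have h7 : (I.bits : ℚ) ^ 6 ≤ (I.bits : ℚ) ^ 6 * I.ratio ^ (48 * I.D.width) :=
    le_mul_of_one_le_right (by positivity) hM
  have h8 : ((if I.isTrivial = true then 0 else I.data.keyBound : ℕ) : ℚ) ≤
      2 ^ 40 * (I.bits : ℚ) ^ 6 * I.ratio ^ (48 * I.D.width) := by
    split_ifs with ht
    · have : (0 : ℚ) ≤ I.ratio := zero_le_one.trans one_le_ratio
      simp only [Nat.cast_zero]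
      positivity
    · exact keyBound_le ht
  rw [measure, Nat.cast_add]
  nlinarith

end Inst

end MinStableCut

theorem theorem4p3 :
    ∃ (p : MinStableCut.Prog) (c : ℕ),
      ∀ (n N : ℕ) (G : SimpleGraph (Fin n)) (w : Sym2 (Fin n) → ℕ)
        (D : MinStableCut.TreeDecomposition G N) (ε : ℚ), 0 < ε →
        ∃ (side : Fin n → Bool) (t : ℕ),
          MinStableCut.Run p (MinStableCut.encodeInput G w D ε) (MinStableCut.encodeCut side) t ∧
          (t : ℚ) ≤ (c : ℚ) * (max 1 ((D.width : ℚ) / ε)) ^ (c * D.width) *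
            ((n : ℚ) + (N : ℚ) + (Nat.log 2 (MinStableCut.maxWeight G w) : ℚ) +
              (MinStableCut.bitLength ε : ℚ)) ^ c ∧
          (∀ v : Fin n, (1 - ε) * (MinStableCut.weightedDegree G w v : ℚ) / 2 ≤
            (MinStableCut.crossWeight G w side v : ℚ)) ∧
          (∀ side' : Fin n → Bool, MinStableCut.IsStable G w side' →
            MinStableCut.cutWeight G w side ≤ MinStableCut.cutWeight G w side') := by
  obtain ⟨p, T, ⟨c, hc⟩, -, hrun⟩ := MinStableCut.Inst.pt_solution
  obtain ⟨A, hA⟩ : ∃ A : ℕ, A = 2 ^ 41 := ⟨_, rfl⟩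
  -- One constant that dominates the leading factor A^c, the exponent 48c of the ratio and the
  -- exponent 6c of the polynomial part; both bases are at least 1.
  refine ⟨p, A ^ c + 48 * c + 6 * c, fun n N G w D ε hε => ?_⟩
  set c' := A ^ c + 48 * c + 6 * c with hc'
  let I : MinStableCut.Inst := ⟨n, N, G, w, D, ε, hε⟩
  obtain ⟨t, ht, hrun⟩ := hrun I
  obtain ⟨-, -, h1, h2⟩ := MinStableCut.Inst.solution_spec (I := I)
  refine ⟨I.side, t, ?_, ?_, h1, h2⟩
  · rw [show MinStableCut.encodeCut I.side = MinStableCut.Enc.enc I.solution from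
      MinStableCut.Inst.encodeCut_side]
    exact hrun
  have hbits : (n : ℚ) + (N : ℚ) + (Nat.log 2 (MinStableCut.maxWeight G w) : ℚ) +
      (MinStableCut.bitLength ε : ℚ) = I.bits := by
    simp only [MinStableCut.Inst.bits]
    push_cast
    rfl
  rw [hbits, show max 1 ((D.width : ℚ) / ε) = I.ratio from rfl,
    show D.width = I.D.width from rfl]
  have hY : (1 : ℚ) ≤ I.bits := by
    have := MinStableCut.Inst.two_le_bitLength (I := I)
    have : 1 ≤ I.bits := by unfold MinStableCut.Inst.bits; omega
    exact_mod_cast this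
  have hM := MinStableCut.Inst.one_le_ratio (I := I)
  have hM0 : 0 < I.ratio := by linarith
  have hle : (I.measure : ℚ) + 2 ≤ A * (I.bits : ℚ) ^ 6 * I.ratio ^ (48 * I.D.width) := by
    rw [hA]
    exact_mod_cast MinStableCut.Inst.measure_le (I := I)
  have hAc := Nat.zero_le (A ^ c)
  calc (t : ℚ) ≤ ((I.measure : ℚ) + 2) ^ c := by exact_mod_cast ht.trans (hc I)
    _ ≤ (A * (I.bits : ℚ) ^ 6 * I.ratio ^ (48 * I.D.width)) ^ c :=
        pow_le_pow_left₀ (by positivity) hle c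
    _ = (A : ℚ) ^ c * I.ratio ^ (48 * c * I.D.width) * (I.bits : ℚ) ^ (6 * c) := by
        rw [mul_pow, mul_pow, ← pow_mul (I.bits : ℚ), ← pow_mul I.ratio,
          show 48 * I.D.width * c = 48 * c * I.D.width by ring]
        ring
    _ ≤ c' * I.ratio ^ (c' * I.D.width) * (I.bits : ℚ) ^ c' := by
        refine mul_le_mul (mul_le_mul ?_ ?_ (by positivity) (by positivity)) ?_ (by positivity)
          (by positivity)
        · have : A ^ c ≤ c' := by omega
          exact_mod_cast this
        · exact pow_le_pow_right₀ hM (Nat.mul_le_mul_right _ (by omega))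
        · exact pow_le_pow_right₀ hY (by omega)
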